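/- **Setting.** A bilevel problem $(P)$ is a family of instances, coded by binary words $w$. An instance consists of domains $\mathcal X\subseteq\mathbb R^{n_x}$, $\mathcal Y\subseteq\mathbb R^{n_y}$, functions $F$, $G_k$ ($k\le m_u$), $f$, $g_i$ ($i\le m_l$) of $(x,y)$ and a tolerance $\delta\ge 0$; numbers of variables and of constraints may vary with the instance. The lower level parameterized by $x\in\mathcal X$ is $\min_{y\in\mathcal Y}\{f(x,y) : g_i(x,y)\le 0\ \forall i\}$. The near-optimal robust version of $(P)$ is $$\min_{x,v} F(x,v)\quad\text{s.t.}\quad x\in\mathcal X,\ G_k(x,v)\le 0\ \forall k,\quad v\in\operatorname*{argmin}_{y\in\mathcal Y}\{f(x,y): g(x,y)\le 0\},\quad G_k(x,z)\le 0\ \ \forall k,\ \forall z\in\mathcal Z(x;\delta),$$ where $\mathcal Z(x;\delta)=\{y\in\mathcal Y : f(x,y)\le f(x,v)+\delta,\ g(x,y)\le 0\}$. Its $k$-th adversarial problem, for given rational $x\in\mathcal X$ and lower-level feasible $v$, is $\max_{z\in\mathcal Z(x;\delta)}G_k(x,z)$. Complexity is that of the Turing model, with rational numbers and vectors coded in binary.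 The data are effective: $m_u$ (in unary), $\delta$, the rational values of $F,f,G_k$ at rational points of $\mathcal X\times\mathcal Y$, and lower-level feasibility of a rational point $y$ for a rational $x\in\mathcal X$ are computable in polynomial time. A minimization problem is *in $\mathcal P$* if one can decide in polynomial time, given an instance and a rational bound $\gamma$, whether there is a feasible solution of value $\le\gamma$, and whether there is one of value $<\gamma$ (for a maximization problem: $\ge\gamma$, $>\gamma$). The near-optimal robust problem is *in $\mathcal{NP}$* if the decision problem "given $w$ and a rational $\Gamma$, is there a feasible $(x,v)$ with $F(x,v)\le\Gamma$?" is in $\mathcal{NP}$. It *has solutions of polynomial size* if every yes-instance $(w,\Gamma)$ of this decision problem has a rational feasible $(x,v)$ with $F(x,v)\le\Gamma$ of encoding length polynomial in that of $(w,\Gamma)$. Let $\mathcal H$ be a set of real-valued functions on $\mathcal Y$ given by codes (binary words). The lower level is in $\mathcal P^*[\mathcal H]$ if it is in $\mathcal P$ and if the following problem is in $\mathcal P$, where the instance, a rational $x\in\mathcal X$, rational $\alpha,\beta,c$ and the code of $h\in\mathcal H$ are part of the input: minimize $h(y)$ over $(y,u)$ subject to $y\in\mathcal Y$, $g(x,y)\le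 0$, $f(x,y)\le u$ and the additional linear constraint $\alpha^\top y+\beta u\le c$. "$-G_k(x,\cdot)\in\mathcal H$" means that for all rational $x\in\mathcal X$ and all $k$ a code of a function of $\mathcal H$ equal to $-G_k(x,\cdot)$ on $\mathcal Y$ can be computed in polynomial time from $w,x,k$. **Theorem 2.** 1. Suppose that the lower level is convex ($\mathcal Y$ is convex and, for $x\in\mathcal X$, $f(x,\cdot)$ and all $g_i(x,\cdot)$ are convex on $\mathcal Y$) and in $\mathcal P^*[\mathcal H]$ for a set $\mathcal H$ of convex functions, and that $-G_k(x,\cdot)\in\mathcal H$. Then the adversarial problems are in $\mathcal P$; deciding whether a given rational $(x,v)$ is a feasible solution of the near-optimal robust problem with $F(x,v)\le\Gamma$ is in $\mathcal P$; and, if the near-optimal robust problem has solutions of polynomial size, it is in $\mathcal{NP}$. 2. If the upper-level constraints are instead convex and non-affine with respect to the lower-level variables, the near-optimal robust version is in general not in $\mathcal{NP}$: if $\mathcal{NP}\ne co\mathcal{NP}$, there are a bilevel problem with effective data and a set $\mathcal H$ of convex functions such that the lower level is convex and in $\mathcal P^*[\mathcal H]$, all $G_k(x,\cdot)$ with $x\in\mathcal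 X$ are convex and not affine on $\mathcal Y$, the near-optimal robust problem has solutions of polynomial size, the adversarial problems (value $\ge\gamma$?) are in $\mathcal{NP}$, and the near-optimal robust problem is not in $\mathcal{NP}$. -/

import Mathlib

noncomputable section

namespace NearOptBilevel

/-! ### Machine model and complexity classes

Programs act on finitely many stacks of bits. Every elementary instruction inspects or changes the
top of a single stack and costs one step, so this is the usual multi-stack (equivalently multi-tape)
machine, with structured control flow instead of a transition table. -/

/-- Binary words. -/
abbrev Word := List Bool

/-- Contents of the stacks (a program mentions only finitely many of them). -/
abbrev Store := ℕ → Word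

/-- Stack programs. -/
inductive Prog : Type
  /-- do nothing -/
  | skip : Prog
  /-- push the bit `b` on stack `i` -/
  | push (i : ℕ) (b : Bool) : Prog
  /-- remove the top of stack `i` (no effect if it is empty) -/
  | pop (i : ℕ) : Prog
  /-- run the first program, then the second -/
  | seq (p q : Prog) : Prog
  /-- branch on stack `i`: top is `true` / top is `false` / stack is empty -/
  | branch (i : ℕ) (p q r : Prog) : Prog
  /-- repeat the body as long as stack `i` is nonempty -/
  | loop (i : ℕ) (p : Prog) : Prog

/-- `Run P s t s'`: started in store `s`, the program `P` halts after exactly `t` steps in `s'`. -/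
inductive Run : Prog → Store → ℕ → Store → Prop
  | skip (s : Store) : Run .skip s 1 s
  | push (s : Store) (i : ℕ) (b : Bool) : Run (.push i b) s 1 (Function.update s i (b :: s i))
  | pop (s : Store) (i : ℕ) : Run (.pop i) s 1 (Function.update s i (s i).tail)
  | seq {p q : Prog} {s s' s'' : Store} {m n : ℕ} :
      Run p s m s' → Run q s' n s'' → Run (.seq p q) s (m + n) s''
  | branch_true {i : ℕ} {p q r : Prog} {s s' : Store} {n : ℕ} :
      (s i).head? = some true → Run p s n s' → Run (.branch i p q r) s (n + 1) s'
  | branch_false {i : ℕ} {p q r : Prog} {s s' : Store} {n : ℕ} :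
      (s i).head? = some false → Run q s n s' → Run (.branch i p q r) s (n + 1) s'
  | branch_empty {i : ℕ} {p q r : Prog} {s s' : Store} {n : ℕ} :
      s i = [] → Run r s n s' → Run (.branch i p q r) s (n + 1) s'
  | loop_done {i : ℕ} {p : Prog} {s : Store} : s i = [] → Run (.loop i p) s 1 s
  | loop_step {i : ℕ} {p : Prog} {s s' s'' : Store} {m n : ℕ} :
      s i ≠ [] → Run p s m s' → Run (.loop i p) s' n s'' → Run (.loop i p) s (m + n + 1) s''

/-- Inputs: tuples of `m` words. -/
abbrev Input (m : ℕ) := Fin m → Word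

/-- Size of an input: total number of bits. -/
def size {m : ℕ} (a : Input m) : ℕ := ∑ i, (a i).length

/-- Initial store: the words of the input on stacks `0, …, m - 1`, all other stacks empty. -/
def initStore {m : ℕ} (a : Input m) : Store := fun i => if h : i < m then a ⟨i, h⟩ else []

/-- `φ` is computable in time polynomial in the size of the input (the output is on stack `0`). -/
def PolyTime {m : ℕ} (φ : Input m → Word) : Prop :=
  ∃ (P : Prog) (p : Polynomial ℕ), ∀ a : Input m,
    ∃ (t : ℕ) (s : Store), t ≤ p.eval (size a) ∧ Run P (initStore a) t s ∧ s 0 = φ a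

/-- The class P of decision problems on `m`-tuples of words. -/
def ClassP (m : ℕ) : Set (Set (Input m)) :=
  {L | ∃ φ : Input m → Word, PolyTime φ ∧ ∀ a, a ∈ L ↔ φ a = [true]}

/-- The class NP: membership has certificates of polynomial length that are verifiable in P. -/
def ClassNP (m : ℕ) : Set (Set (Input m)) :=
  {L | ∃ V ∈ ClassP (m + 1), ∃ p : Polynomial ℕ, ∀ a : Input m,
    a ∈ L ↔ ∃ c : Word, c.length ≤ p.eval (size a) ∧ Fin.snoc (α := fun _ => Word) a c ∈ V}

/-- The class coNP. -/
def ClassCoNP (m : ℕ) : Set (Set (Input m)) := {L | Lᶜ ∈ ClassNP m}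

/-! ### Binary encodings of rational numbers and vectors -/

/-- A fraction (not necessarily in lowest terms) with positive denominator. -/
abbrev Frac := ℤ × ℕ+

/-- The real number denoted by a fraction. -/
def Frac.val (r : Frac) : ℝ := (r.1 : ℝ) / ((r.2 : ℕ) : ℝ)

/-- The real vector denoted by a vector of fractions. -/
def vecVal {n : ℕ} (x : Fin n → Frac) : Fin n → ℝ := fun j => (x j).val

/-- Self-delimiting binary code of a natural number. -/
def encNat (n : ℕ) : Word := (n.bits.flatMap fun b => [true, b]) ++ [false]

/-- Code of a fraction: sign, numerator, denominator. -/
def encFrac (r : Frac) : Word := decide (r.1 < 0) :: (encNat r.1.natAbs ++ encNat r.2)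

/-- Code of a rational vector: the codes of its entries, one after the other. -/
def encVec {n : ℕ} (x : Fin n → Frac) : Word := (List.ofFn x).flatMap encFrac

/-- Unary code of a natural number. -/
def unary (k : ℕ) : Word := List.replicate k true

/-! ### Bilevel problems -/

/-- A bilevel problem in the sense of complexity theory: for every word `w` (the code of an
instance) upper-level variables `x` with domain `X w`, lower-level variables `y` with domain `Y w`,
objectives `F`, `f`, constraints `G k ≤ 0` and `g i ≤ 0`, and a tolerance `δ`. -/
structure BilevelProblem where
  /-- number of upper-level variables -/
  nx : Word → ℕ
  /-- number of lower-level variables -/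
  ny : Word → ℕ
  /-- number of upper-level constraints -/
  mu : Word → ℕ
  /-- number of lower-level constraints -/
  ml : Word → ℕ
  /-- domain of the upper-level variables -/
  X : ∀ w, Set (Fin (nx w) → ℝ)
  /-- domain of the lower-level variables -/
  Y : ∀ w, Set (Fin (ny w) → ℝ)
  /-- upper-level objective -/
  F : ∀ w, (Fin (nx w) → ℝ) → (Fin (ny w) → ℝ) → ℝ
  /-- upper-level constraints -/
  G : ∀ w, Fin (mu w) → (Fin (nx w) → ℝ) → (Fin (ny w) → ℝ) → ℝ
  /-- lower-level objective -/
  f : ∀ w, (Fin (nx w) → ℝ) → (Fin (ny w) → ℝ) → ℝ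
  /-- lower-level constraints -/
  g : ∀ w, Fin (ml w) → (Fin (nx w) → ℝ) → (Fin (ny w) → ℝ) → ℝ
  /-- tolerance for near-optimality -/
  δ : Word → ℝ
  δ_nonneg : ∀ w, 0 ≤ δ w

namespace BilevelProblem

variable (B : BilevelProblem)

/-- Feasible set of the lower level parameterized by `x`. -/
def lowerFeasible (w : Word) (x : Fin (B.nx w) → ℝ) : Set (Fin (B.ny w) → ℝ) :=
  {y | y ∈ B.Y w ∧ ∀ i, B.g w i x y ≤ 0}

/-- Optimal solutions of the lower level parameterized by `x`. -/
def lowerArgmin (w : Word) (x : Fin (B.nx w) → ℝ) : Set (Fin (B.ny w) → ℝ) :=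
  {v | v ∈ B.lowerFeasible w x ∧ ∀ y ∈ B.lowerFeasible w x, B.f w x v ≤ B.f w x y}

/-- The near-optimal set: lower-level solutions within `δ` of the value of `v`. -/
def nearOptimal (w : Word) (x : Fin (B.nx w) → ℝ) (v : Fin (B.ny w) → ℝ) :
    Set (Fin (B.ny w) → ℝ) :=
  {z | z ∈ B.lowerFeasible w x ∧ B.f w x z ≤ B.f w x v + B.δ w}

/-- Feasible points of the near-optimal robust version of the bilevel problem. -/
def NORFeasible (w : Word) (x : Fin (B.nx w) → ℝ) (v : Fin (B.ny w) → ℝ) : Prop :=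
  x ∈ B.X w ∧ (∀ k, B.G w k x v ≤ 0) ∧ v ∈ B.lowerArgmin w x ∧
    ∀ k, ∀ z ∈ B.nearOptimal w x v, B.G w k x z ≤ 0

/-- Decision version of the near-optimal robust bilevel problem: given an instance and a bound `Γ`,
is there a feasible solution with objective value at most `Γ`? -/
def norDecision : Set (Input 2) :=
  {a | ∃ (w : Word) (Γ : Frac), a = ![w, encFrac Γ] ∧
    ∃ x v, B.NORFeasible w x v ∧ B.F w x v ≤ Γ.val}

/-- The verification problem: is the given rational `(x, v)` a feasible solution of the near-optimal
robust problem with objective value at most `Γ`? -/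
def norVerification : Set (Input 4) :=
  {a | ∃ (w : Word) (Γ : Frac) (x : Fin (B.nx w) → Frac) (v : Fin (B.ny w) → Frac),
    a = ![w, encFrac Γ, encVec x, encVec v] ∧
    B.NORFeasible w (vecVal x) (vecVal v) ∧ B.F w (vecVal x) (vecVal v) ≤ Γ.val}

/-- Solutions are objects of polynomial size: whenever the near-optimal robust problem has a
solution of value at most `Γ`, it has a rational one of polynomial encoding length. -/
def HasPolySizeSolutions : Prop :=
  ∃ p : Polynomial ℕ, ∀ (w : Word) (Γ : Frac),
    (∃ x v, B.NORFeasible w x v ∧ B.F w x v ≤ Γ.val) →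
    ∃ (x : Fin (B.nx w) → Frac) (v : Fin (B.ny w) → Frac),
      B.NORFeasible w (vecVal x) (vecVal v) ∧ B.F w (vecVal x) (vecVal v) ≤ Γ.val ∧
      (encVec x).length + (encVec v).length ≤ p.eval (size ![w, encFrac Γ])

/-- The data of the problem are given effectively: the number of upper-level constraints, the
tolerance, the functions `F`, `f`, `G k` at rational points of their domains, and feasibility of
rational points for the lower level are computable in polynomial time. -/
structure PolyPresented : Prop where
  mu_comp : PolyTime fun a : Input 1 => unary (B.mu (a 0))
  delta_comp : ∃ φ : Input 1 → Word, PolyTime φ ∧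
    ∀ w, ∃ r : Frac, φ ![w] = encFrac r ∧ r.val = B.δ w
  F_comp : ∃ φ : Input 3 → Word, PolyTime φ ∧
    ∀ (w : Word) (x : Fin (B.nx w) → Frac) (y : Fin (B.ny w) → Frac),
      vecVal x ∈ B.X w → vecVal y ∈ B.Y w →
      ∃ r : Frac, φ ![w, encVec x, encVec y] = encFrac r ∧ r.val = B.F w (vecVal x) (vecVal y)
  f_comp : ∃ φ : Input 3 → Word, PolyTime φ ∧
    ∀ (w : Word) (x : Fin (B.nx w) → Frac) (y : Fin (B.ny w) → Frac),
      vecVal x ∈ B.X w → vecVal y ∈ B.Y w →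
      ∃ r : Frac, φ ![w, encVec x, encVec y] = encFrac r ∧ r.val = B.f w (vecVal x) (vecVal y)
  G_comp : ∃ φ : Input 4 → Word, PolyTime φ ∧
    ∀ (w : Word) (x : Fin (B.nx w) → Frac) (y : Fin (B.ny w) → Frac) (k : Fin (B.mu w)),
      vecVal x ∈ B.X w → vecVal y ∈ B.Y w →
      ∃ r : Frac, φ ![w, encVec x, encVec y, unary k] = encFrac r ∧
        r.val = B.G w k (vecVal x) (vecVal y)
  feasible_dec :
    {a : Input 3 | ∃ (w : Word) (x : Fin (B.nx w) → Frac) (y : Fin (B.ny w) → Frac),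
      a = ![w, encVec x, encVec y] ∧ vecVal x ∈ B.X w ∧ vecVal y ∈ B.lowerFeasible w (vecVal x)}
    ∈ ClassP 3

/-- The lower level is a convex problem. -/
structure LowerConvex : Prop where
  convex_Y : ∀ w, Convex ℝ (B.Y w)
  convex_f : ∀ w, ∀ x ∈ B.X w, ConvexOn ℝ (B.Y w) (B.f w x)
  convex_g : ∀ w, ∀ x ∈ B.X w, ∀ i, ConvexOn ℝ (B.Y w) (B.g w i x)

/-- The upper-level constraints are convex and not affine in the lower-level variables. -/
def UpperConvexNonaffine : Prop :=
  ∀ w, ∀ x ∈ B.X w, ∀ k, ConvexOn ℝ (B.Y w) (B.G w k x) ∧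
    ¬ ∃ A : (Fin (B.ny w) → ℝ) →ᵃ[ℝ] ℝ, ∀ y ∈ B.Y w, B.G w k x y = A y

/-- A set of objective functions of the lower-level variables. For each instance `w` it is the set
`{H w c | c}`; the word `c` is the code by which the function is given in an input (for linear
functions: the coefficients). -/
abbrev FunctionClass : Type := ∀ w : Word, Word → (Fin (B.ny w) → ℝ) → ℝ

/-- All functions of the class are convex. -/
def ConvexClass (H : B.FunctionClass) : Prop := ∀ w c, ConvexOn ℝ (B.Y w) (H w c)

/-- An optimization problem is polynomially solvable if comparing its optimal value with a rational
bound is in P. `D (· ≤ ·)` asks for a feasible solution at least as good as the bound,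
`D (· < ·)` for one strictly better than the bound. -/
def PolySolvable {m : ℕ} (D : (ℝ → ℝ → Prop) → Set (Input m)) : Prop :=
  D (· ≤ ·) ∈ ClassP m ∧ D (· < ·) ∈ ClassP m

/-- The lower-level problem `min f(x, y)`, compared with the bound `γ`. -/
def lowerDecision (rel : ℝ → ℝ → Prop) : Set (Input 3) :=
  {a | ∃ (w : Word) (x : Fin (B.nx w) → Frac) (γ : Frac),
    a = ![w, encVec x, encFrac γ] ∧ vecVal x ∈ B.X w ∧
    ∃ y ∈ B.lowerFeasible w (vecVal x), rel (B.f w (vecVal x) y) γ.val}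

/-- The lower-level problem in epigraph form, that is with variables `(y, u)` and the constraint
`f(x, y) ≤ u`, with the additional linear constraint `∑ α j * y j + β * u ≤ c` and with the
objective function replaced by the member of `H` of code `h`, compared with the bound `γ`. -/
def lowerStarDecision (H : B.FunctionClass) (rel : ℝ → ℝ → Prop) : Set (Input 7) :=
  {a | ∃ (w : Word) (x : Fin (B.nx w) → Frac) (α : Fin (B.ny w) → Frac) (β c : Frac)
      (h : Word) (γ : Frac),
    a = ![w, encVec x, encVec α, encFrac β, encFrac c, h, encFrac γ] ∧ vecVal x ∈ B.X w ∧
    ∃ y ∈ B.lowerFeasible w (vecVal x), ∃ u : ℝ, B.f w (vecVal x) y ≤ u ∧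
      ∑ j, (α j).val * y j + β.val * u ≤ c.val ∧ rel (H w h y) γ.val}

/-- The lower level is in `P*[H]`. -/
def LowerInPStar (H : B.FunctionClass) : Prop :=
  PolySolvable B.lowerDecision ∧ PolySolvable (B.lowerStarDecision H)

/-- `-G k (x, ·)` belongs to `H`; its code is computable from the instance, `x` and `k`. -/
def NegUpperIn (H : B.FunctionClass) : Prop :=
  ∃ φ : Input 3 → Word, PolyTime φ ∧
    ∀ (w : Word) (x : Fin (B.nx w) → Frac) (k : Fin (B.mu w)), vecVal x ∈ B.X w →
      ∀ y ∈ B.Y w, H w (φ ![w, encVec x, unary k]) y = - B.G w k (vecVal x) y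

/-- The `k`-th adversarial problem: maximize `G k (x, z)` over the near-optimal set, compared with
the bound `γ`. -/
def adversarialDecision (rel : ℝ → ℝ → Prop) : Set (Input 5) :=
  {a | ∃ (w : Word) (x : Fin (B.nx w) → Frac) (v : Fin (B.ny w) → Frac) (k : Fin (B.mu w))
      (γ : Frac),
    a = ![w, encVec x, encVec v, unary k, encFrac γ] ∧ vecVal x ∈ B.X w ∧
    vecVal v ∈ B.lowerFeasible w (vecVal x) ∧
    ∃ z ∈ B.nearOptimal w (vecVal x) (vecVal v), rel γ.val (B.G w k (vecVal x) z)}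

end BilevelProblem

end NearOptBilevel

end

open NearOptBilevel

/-!
**Membership in P and NP.** For a lower-level feasible `v`, the near-optimal set is the feasible set
of the lower level in epigraph form with the additional constraint `u ≤ f (x, v) + δ`, that is with
the linear constraint `α · y + β u ≤ c` for `α = 0`, `β = 1` and `c = f (x, v) + δ`. Maximizing
`G k (x, ·)` over it is minimizing `-G k (x, ·)`, a member of `H`. So the adversarial problem
reduces to a problem that `P*[H]` declares polynomially solvable
(`BilevelProblem.adversarialDecision_mem_classP`). A point `(x, v)` is feasible for the near-optimal
robust problem iff `x` is in its domain and `v` is feasible for the lower level, no point of the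
lower level has value less than `f (x, v)`, and no adversarial problem has a value greater than `0`
(`BilevelProblem.norVerification_mem_classP`); the constraints at `v` itself follow, since `v` is
near-optimal. Solutions of polynomial size then serve as certificates
(`BilevelProblem.norDecision_mem_classNP`).

**Nonmembership.** Let `L` be in NP with a complement that is not in NP, and let `V` be a verifier
with certificates of length at most `p |w|`. The lower level is to minimize `s` over the convex set
`t ^ 2 ≤ s`; its only solution is the origin, and with the tolerance `4 ^ (p |w| + 1)` all points
`(n, n ^ 2)` with `n < 2 ^ (p |w| + 1)` are near-optimal. These points are extreme, so that a convex
function can have independent values there: `peaks` is the maximum of `-1`, of `-s`, and, for each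
`n` that codes a certificate, of an affine function which is `1` at `(n, n ^ 2)` and at most `-1` at
every point of the epigraph with `|t - n| ≥ 1 / 2`. With the constraint `peaks ≤ 0`, the
near-optimal robust problem is solvable iff `w` has no certificate (`norFeasible_peakProblem_iff`),
so it is not in NP (`compl_mem_classNP`). Only the integer nearest to `t` matters for the value at
`(t, s)`, hence `peaks` is computable in polynomial time. For `H` the affine functions are taken.
Comparing the minimum of an affine function over the part of the epigraph in a half-plane with a
rational bound is the solvability of two linear inequalities on the epigraph; this amounts to
finitely many polynomial conditions on the coefficients, without square roots
(`polyDec_parabolaFeasible`).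

**Polynomial time.** Both parts need actual programs. `Assigns` says that a program assigns a
function of some stacks to a stack, in polynomial time and without changing any other stack; it is
what composition and iteration along a word (`PolyTime.foldl`) need. Arithmetic of binary numbers,
integers and fractions is built on these two principles.
-/

noncomputable section

namespace NearOptBilevel

open Function

/-! ### Elementary stack programs -/

/-- `P`, started in `S`, halts in `S'` after at most `n` steps. -/
def Exec (P : Prog) (S : Store) (n : ℕ) (S' : Store) : Prop := ∃ t ≤ n, Run P S t S'

theorem Exec.mono {P : Prog} {S S' : Store} {m n : ℕ} (h : Exec P S m S') (hmn : m ≤ n) :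
    Exec P S n S' := by
  obtain ⟨t, ht, hr⟩ := h
  exact ⟨t, ht.trans hmn, hr⟩

theorem Exec.seq {P Q : Prog} {S S' S'' : Store} {m n : ℕ} (h : Exec P S m S')
    (h' : Exec Q S' n S'') : Exec (.seq P Q) S (m + n) S'' := by
  obtain ⟨t, ht, hr⟩ := h
  obtain ⟨t', ht', hr'⟩ := h'
  exact ⟨t + t', by omega, .seq hr hr'⟩

theorem exec_skip (S : Store) : Exec .skip S 1 S := ⟨1, le_rfl, .skip S⟩

theorem exec_push (S : Store) (i : ℕ) (b : Bool) :
    Exec (.push i b) S 1 (update S i (b :: S i)) := ⟨1, le_rfl, .push S i b⟩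

theorem exec_pop (S : Store) (i : ℕ) : Exec (.pop i) S 1 (update S i (S i).tail) :=
  ⟨1, le_rfl, .pop S i⟩

theorem Exec.branch_true {i : ℕ} {P Q R : Prog} {S S' : Store} {n : ℕ}
    (hi : (S i).head? = some true) (h : Exec P S n S') : Exec (.branch i P Q R) S (n + 1) S' := by
  obtain ⟨t, ht, hr⟩ := h
  exact ⟨t + 1, by omega, .branch_true hi hr⟩

theorem Exec.branch_false {i : ℕ} {P Q R : Prog} {S S' : Store} {n : ℕ}
    (hi : (S i).head? = some false) (h : Exec Q S n S') : Exec (.branch i P Q R) S (n + 1) S' := by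
  obtain ⟨t, ht, hr⟩ := h
  exact ⟨t + 1, by omega, .branch_false hi hr⟩

theorem Exec.branch_empty {i : ℕ} {P Q R : Prog} {S S' : Store} {n : ℕ}
    (hi : S i = []) (h : Exec R S n S') : Exec (.branch i P Q R) S (n + 1) S' := by
  obtain ⟨t, ht, hr⟩ := h
  exact ⟨t + 1, by omega, .branch_empty hi hr⟩

theorem exec_loop_done {i : ℕ} {P : Prog} {S : Store} (hi : S i = []) : Exec (.loop i P) S 1 S :=
  ⟨1, le_rfl, .loop_done hi⟩

theorem Exec.loop_step {i : ℕ} {P : Prog} {S S' S'' : Store} {m n : ℕ} (hi : S i ≠ [])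
    (h : Exec P S m S') (h' : Exec (.loop i P) S' n S'') : Exec (.loop i P) S (m + n + 1) S'' := by
  obtain ⟨t, ht, hr⟩ := h
  obtain ⟨t', ht', hr'⟩ := h'
  exact ⟨t + t' + 1, by omega, .loop_step hi hr hr'⟩

/-- Empty stack `i`. -/
def Prog.clear (i : ℕ) : Prog := .loop i (.pop i)

theorem exec_clear (S : Store) (i : ℕ) :
    Exec (.clear i) S (2 * (S i).length + 1) (update S i []) := by
  generalize hl : S i = l
  induction l generalizing S with
  | nil =>
    rw [show update S i [] = S by rw [← hl, update_eq_self]]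
    exact (exec_loop_done hl).mono (by simp)
  | cons b l ih =>
    have := ih (update S i (S i).tail) (by simp [hl])
    rw [update_idem] at this
    refine (Exec.loop_step (by simp [hl]) (exec_pop S i) this).mono ?_
    simp only [List.length_cons]; omega

/-- Move the contents of stack `i` onto stack `j`, reversing the order. -/
def Prog.pour (i j : ℕ) : Prog :=
  .loop i (.branch i (.seq (.push j true) (.pop i)) (.seq (.push j false) (.pop i)) .skip)

theorem exec_pour {i j : ℕ} (hij : i ≠ j) (S : Store) :
    Exec (.pour i j) S (4 * (S i).length + 1)
      (update (update S i []) j ((S i).reverse ++ S j)) := by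
  generalize hl : S i = l
  induction l generalizing S with
  | nil =>
    have : update (update S i []) j (([] : Word).reverse ++ S j) = S := by
      ext1 k; by_cases hk : k = j <;> by_cases hk' : k = i <;> simp_all
    rw [this]
    exact (exec_loop_done hl).mono (by simp)
  | cons b l ih =>
    have h1 : Exec (.branch i (.seq (.push j true) (.pop i)) (.seq (.push j false) (.pop i)) .skip)
        S 3 (update (update S j (b :: S j)) i l) := by
      have h2 : ∀ b', Exec (.seq (.push j b') (.pop i)) S 2
          (update (update S j (b' :: S j)) i l) := by
        intro b'
        have := (exec_push S j b').seq (exec_pop _ i)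
        simpa [update_of_ne hij, hl] using this
      cases b
      · exact Exec.branch_false (by simp [hl]) (h2 false)
      · exact Exec.branch_true (by simp [hl]) (h2 true)
    have h3 := ih (update (update S j (b :: S j)) i l) (by simp)
    have h4 := Exec.loop_step (by simp [hl]) h1 h3
    have h5 : update (update (update (update S j (b :: S j)) i l) i []) j
        (l.reverse ++ (update (update S j (b :: S j)) i l) j)
        = update (update S i []) j ((b :: l).reverse ++ S j) := by
      ext1 k
      by_cases hk : k = j
      · subst hk; simp [update_of_ne hij.symm]
      · by_cases hk' : k = i <;> simp_all
    rw [h5] at h4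
    refine h4.mono ?_
    simp only [List.length_cons]; omega

/-- Move the contents of stack `i` onto stack `j`, using the empty stack `k`. -/
def Prog.move (i j k : ℕ) : Prog := .seq (.pour i k) (.pour k j)

theorem exec_move {i j k : ℕ} (hij : i ≠ j) (hik : i ≠ k) (hjk : j ≠ k) (S : Store)
    (hk : S k = []) :
    Exec (.move i j k) S (8 * (S i).length + 2) (update (update S i []) j (S i ++ S j)) := by
  have h := (exec_pour hik S).seq (exec_pour hjk.symm _)
  have h5 : ∀ A : Store, A = update (update S i []) k ((S i).reverse ++ S k) →
      update (update A k []) j ((A k).reverse ++ A j)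
        = update (update S i []) j (S i ++ S j) := by
    rintro A rfl
    ext1 l
    by_cases hl : l = j
    · subst hl; simp [hk, update_of_ne hij.symm, update_of_ne hjk]
    · by_cases hl' : l = k
      · subst hl'; simp [hk, update_of_ne hl, update_of_ne hik.symm]
      · by_cases hl'' : l = i <;> simp_all
  rw [h5 _ rfl] at h
  refine h.mono ?_
  simp [hk]; omega

/-- Copy the contents of stack `i` onto stack `j`, using the empty stack `k`. -/
def Prog.copy (i j k : ℕ) : Prog :=
  .seq (.pour i k) (.loop k (.branch k
    (.seq (.push i true) (.seq (.push j true) (.pop k)))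
    (.seq (.push i false) (.seq (.push j false) (.pop k))) .skip))

theorem exec_copy {i j k : ℕ} (hij : i ≠ j) (hik : i ≠ k) (hjk : j ≠ k) (S : Store)
    (hk : S k = []) :
    Exec (.copy i j k) S (9 * (S i).length + 2) (update S j (S i ++ S j)) := by
  have key : ∀ (l : Word) (S : Store), S k = l →
      Exec (.loop k (.branch k
        (.seq (.push i true) (.seq (.push j true) (.pop k)))
        (.seq (.push i false) (.seq (.push j false) (.pop k))) .skip)) S (5 * l.length + 1)
        (update (update (update S k []) i (l.reverse ++ S i)) j (l.reverse ++ S j)) := by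
    intro l
    induction l with
    | nil =>
      intro S hl
      have : update (update (update S k []) i (([] : Word).reverse ++ S i)) j
          (([] : Word).reverse ++ S j) = S := by
        ext1 x
        by_cases hx : x = j
        · simp_all
        · by_cases hx' : x = i
          · simp_all
          · by_cases hx'' : x = k <;> simp_all
      rw [this]
      exact (exec_loop_done hl).mono (by simp)
    | cons b l ih =>
      intro S hl
      have h1 : Exec (.branch k
          (.seq (.push i true) (.seq (.push j true) (.pop k)))
          (.seq (.push i false) (.seq (.push j false) (.pop k))) .skip)
          S 4 (update (update (update S i (b :: S i)) j (b :: S j)) k l) := by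
        have h2 : ∀ b', Exec (.seq (.push i b') (.seq (.push j b') (.pop k))) S 3
            (update (update (update S i (b' :: S i)) j (b' :: S j)) k l) := by
          intro b'
          have := (exec_push S i b').seq ((exec_push _ j b').seq (exec_pop _ k))
          simpa [update_of_ne hij, update_of_ne hij.symm, update_of_ne hjk.symm,
            update_of_ne hik.symm, hl] using this
        cases b
        · exact Exec.branch_false (by simp [hl]) (h2 false)
        · exact Exec.branch_true (by simp [hl]) (h2 true)
      have h3 := ih (update (update (update S i (b :: S i)) j (b :: S j)) k l) (by simp)
      have h4 := Exec.loop_step (by simp [hl]) h1 h3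
      have h5 : ∀ A : Store, A = update (update (update S i (b :: S i)) j (b :: S j)) k l →
          update (update (update A k []) i (l.reverse ++ A i)) j (l.reverse ++ A j) =
          update (update (update S k []) i ((b :: l).reverse ++ S i)) j
            ((b :: l).reverse ++ S j) := by
        rintro A rfl
        ext1 x
        by_cases hx : x = j
        · subst hx; simp [update_of_ne hjk]
        · by_cases hx' : x = i
          · subst hx'; simp [update_of_ne hik, update_of_ne hij]
          · by_cases hx'' : x = k
            · subst hx''; simp [update_of_ne hx, update_of_ne hx']
            · simp_all
      rw [h5 _ rfl] at h4
      refine h4.mono ?_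
      simp only [List.length_cons]; omega
  have h := (exec_pour hik S).seq (key _ _ rfl)
  have h5 : ∀ A : Store, A = update (update S i []) k ((S i).reverse ++ S k) →
      update (update (update A k []) i ((A k).reverse ++ A i)) j ((A k).reverse ++ A j)
        = update S j (S i ++ S j) := by
    rintro A rfl
    ext1 l
    by_cases hl : l = j
    · subst hl; simp [hk, update_of_ne hij.symm, update_of_ne hjk]
    · by_cases hl' : l = i
      · subst hl'; simp [hk, update_of_ne hl, update_of_ne hik]
      · by_cases hl'' : l = k
        · subst hl''; simp [hk, update_of_ne hl, update_of_ne hl']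
        · simp_all
  rw [h5 _ rfl] at h
  refine h.mono ?_
  simp [hk]; omega

/-- Replace the stacks `d, …, d + n - 1` of `S` by the words `a`. -/
def place (d : ℕ) (S : Store) {n : ℕ} (a : Input n) : Store :=
  fun i => if h : d ≤ i ∧ i - d < n then a ⟨i - d, h.2⟩ else S i

theorem place_apply_add (d : ℕ) (S : Store) {n : ℕ} (a : Input n) (i : Fin n) :
    place d S a (d + i) = a i := by
  simp [place]

theorem place_of_lt {d : ℕ} {S : Store} {n : ℕ} {a : Input n} {i : ℕ} (hi : i < d) :
    place d S a i = S i := by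
  simp [place]; omega

theorem place_of_ge {d : ℕ} {S : Store} {n : ℕ} {a : Input n} {i : ℕ} (hi : d + n ≤ i) :
    place d S a i = S i := by
  simp only [place]; rw [dif_neg]; omega

theorem length_le_size {n : ℕ} (a : Input n) (i : Fin n) : (a i).length ≤ size a :=
  Finset.single_le_sum (f := fun i => (a i).length) (fun _ _ => Nat.zero_le _) (Finset.mem_univ i)

theorem size_le_of_forall {n : ℕ} {a : Input n} {M : ℕ} (h : ∀ i, (a i).length ≤ M) :
    size a ≤ n * M := by
  simpa [size] using Finset.sum_le_card_nsmul Finset.univ (fun i => (a i).length) M (fun i _ => h i)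

/-- Empty the stacks `d, …, d + n - 1`. -/
def Prog.clearRange (d : ℕ) : ℕ → Prog
  | 0 => .skip
  | n + 1 => .seq (.clearRange d n) (.clear (d + n))

theorem exec_clearRange (d n : ℕ) (S : Store) :
    Exec (.clearRange d n) S (2 * size (fun i : Fin n => S (d + i)) + n + 1)
      (place d S (fun _ : Fin n => [])) := by
  induction n with
  | zero =>
    have : place d S (fun _ : Fin 0 => []) = S := by ext1 i; simp [place]
    rw [this]
    exact (exec_skip S).mono (by omega)
  | succ n ih =>
    have h := ih.seq (exec_clear _ (d + n))
    have h5 : update (place d S (fun _ : Fin n => [])) (d + n) []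
        = place d S (fun _ : Fin (n + 1) => []) := by
      ext1 i
      by_cases hi : i = d + n
      · subst hi; simp [place]
      · rw [update_of_ne hi]; simp only [place]
        by_cases h : d ≤ i ∧ i - d < n
        · rw [dif_pos h, dif_pos (by omega)]
        · rw [dif_neg h, dif_neg (by omega)]
    rw [h5] at h
    refine h.mono ?_
    rw [place_of_ge le_rfl]
    simp only [size, Fin.sum_univ_castSucc, Fin.val_castSucc, Fin.val_last]
    omega

/-! ### Relocation of programs -/

/-- All stacks mentioned by the program are below this bound. -/
def Prog.bound : Prog → ℕ
  | .skip => 0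
  | .push i _ => i + 1
  | .pop i => i + 1
  | .seq p q => max p.bound q.bound
  | .branch i p q r => max (i + 1) (max p.bound (max q.bound r.bound))
  | .loop i p => max (i + 1) p.bound

/-- The program that acts on stack `d + i` as the given one does on stack `i`. -/
def Prog.shift (d : ℕ) : Prog → Prog
  | .skip => .skip
  | .push i b => .push (d + i) b
  | .pop i => .pop (d + i)
  | .seq p q => .seq (p.shift d) (q.shift d)
  | .branch i p q r => .branch (d + i) (p.shift d) (q.shift d) (r.shift d)
  | .loop i p => .loop (d + i) (p.shift d)

theorem Run.frame {P : Prog} {S S' : Store} {t : ℕ} (h : Run P S t S') :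
    ∀ i, P.bound ≤ i → S' i = S i := by
  induction h with
  | skip => intros; rfl
  | push s i b => intro j hj; rw [update_of_ne]; simp only [Prog.bound] at hj; omega
  | pop s i => intro j hj; rw [update_of_ne]; simp only [Prog.bound] at hj; omega
  | seq _ _ ih ih' =>
    intro j hj; simp only [Prog.bound, sup_le_iff] at hj
    rw [ih' j hj.2, ih j hj.1]
  | branch_true _ _ ih =>
    intro j hj; simp only [Prog.bound, sup_le_iff] at hj; exact ih j hj.2.1
  | branch_false _ _ ih =>
    intro j hj; simp only [Prog.bound, sup_le_iff] at hj; exact ih j hj.2.2.1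
  | branch_empty _ _ ih =>
    intro j hj; simp only [Prog.bound, sup_le_iff] at hj; exact ih j hj.2.2.2
  | loop_done => intros; rfl
  | loop_step _ _ _ ih ih' =>
    intro j hj; rw [ih' j hj]; simp only [Prog.bound, sup_le_iff] at hj; exact ih j hj.2

/-- A step lengthens a stack by at most one bit. -/
theorem Run.length_le {P : Prog} {S S' : Store} {t : ℕ} (h : Run P S t S') :
    ∀ i, (S' i).length ≤ (S i).length + t := by
  induction h with
  | skip => intros; omega
  | push s i b => intro j; by_cases hj : j = i <;> simp_all
  | pop s i =>
    intro j; by_cases hj : j = i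
    · subst hj; simp; omega
    · simp_all
  | seq _ _ ih ih' => intro j; have := ih j; have := ih' j; omega
  | branch_true _ _ ih => intro j; have := ih j; omega
  | branch_false _ _ ih => intro j; have := ih j; omega
  | branch_empty _ _ ih => intro j; have := ih j; omega
  | loop_done => intros; omega
  | loop_step _ _ _ ih ih' => intro j; have := ih j; have := ih' j; omega

/-- The store that agrees with `L` below `d` and holds `S`, moved by `d`, from there on. -/
def merge (d : ℕ) (L S : Store) : Store := fun i => if i < d then L i else S (i - d)

theorem merge_add (d : ℕ) (L S : Store) (i : ℕ) : merge d L S (d + i) = S i := by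
  simp [merge]

theorem merge_of_lt {d : ℕ} {L S : Store} {i : ℕ} (h : i < d) : merge d L S i = L i := by
  simp [merge, h]

theorem update_merge (d : ℕ) (L S : Store) (i : ℕ) (w : Word) :
    update (merge d L S) (d + i) w = merge d L (update S i w) := by
  ext1 j
  by_cases hj : j = d + i
  · subst hj; simp [merge_add]
  · rw [update_of_ne hj]
    simp only [merge]
    split_ifs with h
    · rfl
    · rw [update_of_ne]; omega

theorem Run.shift {P : Prog} {S S' : Store} {t : ℕ} (h : Run P S t S') (d : ℕ) (L : Store) :
    Run (P.shift d) (merge d L S) t (merge d L S') := by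
  induction h with
  | skip s => exact .skip _
  | push s i b =>
    have := Run.push (merge d L s) (d + i) b
    rwa [merge_add, update_merge] at this
  | pop s i =>
    have := Run.pop (merge d L s) (d + i)
    rwa [merge_add, update_merge] at this
  | seq _ _ ih ih' => exact .seq ih ih'
  | branch_true hi _ ih => exact .branch_true (by rwa [merge_add]) ih
  | branch_false hi _ ih => exact .branch_false (by rwa [merge_add]) ih
  | branch_empty hi _ ih => exact .branch_empty (by rwa [merge_add]) ih
  | loop_done hi => exact .loop_done (by rwa [merge_add])
  | loop_step hi _ _ ih ih' => exact .loop_step (by rwa [merge_add]) ih ih'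

/-! ### Composition and recursion in polynomial time -/

theorem eval_mono (p : Polynomial ℕ) {m n : ℕ} (h : m ≤ n) : p.eval m ≤ p.eval n := by
  induction p using Polynomial.induction_on' with
  | add p q hp hq => simpa using Nat.add_le_add hp hq
  | monomial k a => simpa using Nat.mul_le_mul_left a (Nat.pow_le_pow_left h k)

/-- There are programs for the assignment `τ := φ (σ 0, …, σ (m - 1))`, whatever the stacks `σ i`
and `τ` are, that run in polynomial time, need only stacks from `d` on as working space and leave
these empty. -/
def Assigns {m : ℕ} (φ : Input m → Word) : Prop :=
  ∀ (σ : Fin m → ℕ) (τ d : ℕ), (∀ i, σ i < d) → τ < d → ∃ (P : Prog) (p : Polynomial ℕ),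
    ∀ S : Store, (∀ i, d ≤ i → S i = []) →
      Exec P S (p.eval (size (fun i => S (σ i)) + (S τ).length))
        (update S τ (φ fun i => S (σ i)))

theorem assigns_proj {m : ℕ} (j : Fin m) : Assigns fun a : Input m => a j := by
  intro σ τ d hσ hτ
  by_cases h : τ = σ j
  · refine ⟨.skip, 1, fun S _ => ?_⟩
    subst h
    simpa using exec_skip S
  · refine ⟨.seq (.clear τ) (.copy (σ j) τ d), 9 * Polynomial.X + 3, fun S hS => ?_⟩
    have h1 := (exec_clear S τ).seq (exec_copy (i := σ j) (j := τ) (k := d) (Ne.symm h)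
      (hσ j).ne hτ.ne _ (by rw [update_of_ne hτ.ne']; exact hS d le_rfl))
    simp only [update_idem, update_self, update_of_ne (Ne.symm h), List.append_nil] at h1
    refine h1.mono ?_
    have : (S (σ j)).length ≤ _ := length_le_size (fun i => S (σ i)) j
    simp only [Polynomial.eval_add, Polynomial.eval_mul, Polynomial.eval_ofNat, Polynomial.eval_X]
    omega

/-- Simultaneous assignment to the stacks `e, …, e + n - 1`. -/
theorem exists_assignAll {m n : ℕ} {φ : Fin n → Input m → Word} (hφ : ∀ i, Assigns (φ i))
    (σ : Fin m → ℕ) (e d : ℕ) (hσ : ∀ i, σ i < d) (hσe : ∀ i, σ i < e ∨ e + n ≤ σ i)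
    (hed : e + n ≤ d) :
    ∃ (P : Prog) (p : Polynomial ℕ), ∀ S : Store, (∀ i, d ≤ i → S i = []) →
      Exec P S (p.eval (size (fun i => S (σ i)) + size (fun i : Fin n => S (e + i))))
        (place e S (fun j => φ j fun i => S (σ i))) := by
  induction n with
  | zero =>
    refine ⟨.skip, 1, fun S _ => ?_⟩
    have : place e S (fun j : Fin 0 => φ j fun i => S (σ i)) = S := by ext1 i; simp [place]
    rw [this]
    simpa using exec_skip S
  | succ n ih =>
    obtain ⟨P, p, hP⟩ := ih (φ := fun i => φ i.castSucc) (fun i => hφ _)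
      (fun i => (hσe i).imp_right (by omega)) (by omega)
    obtain ⟨Q, q, hQ⟩ := hφ (Fin.last n) σ (e + n) d hσ (by omega)
    refine ⟨.seq P Q, p + q, fun S hS => ?_⟩
    have h1 := hP S hS
    have h2 := hQ (place e S fun j : Fin n => φ j.castSucc fun i => S (σ i)) (fun i hi => by
      rw [place_of_ge (by omega)]
      exact hS i hi)
    have h3 : (fun i => place e S (fun j : Fin n => φ j.castSucc fun i => S (σ i)) (σ i))
        = fun i => S (σ i) := by
      ext1 i
      rcases hσe i with h | h
      · rw [place_of_lt h]
      · rw [place_of_ge (by omega)]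
    rw [h3, place_of_ge le_rfl] at h2
    have h4 : update (place e S fun j : Fin n => φ j.castSucc fun i => S (σ i)) (e + n)
        (φ (Fin.last n) fun i => S (σ i)) = place e S (fun j => φ j fun i => S (σ i)) := by
      ext1 i
      by_cases hi : i = e + n
      · subst hi; simp [place, Fin.last]
      · rw [update_of_ne hi]; simp only [place]
        by_cases h : e ≤ i ∧ i - e < n
        · rw [dif_pos h, dif_pos (by omega)]; rfl
        · rw [dif_neg h, dif_neg (by omega)]
    rw [h4] at h2
    refine (h1.seq h2).mono ?_
    rw [Polynomial.eval_add]
    have h5 : size (fun i : Fin (n + 1) => S (e + i))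
        = size (fun i : Fin n => S (e + i)) + (S (e + n)).length := by
      simp [size, Fin.sum_univ_castSucc]
    rw [h5]
    exact Nat.add_le_add (eval_mono _ (by omega)) (eval_mono _ (by omega))

theorem PolyTime.length_le {m : ℕ} {φ : Input m → Word} (h : PolyTime φ) :
    ∃ p : Polynomial ℕ, ∀ a, (φ a).length ≤ p.eval (size a) := by
  obtain ⟨P, p, hP⟩ := h
  refine ⟨p + Polynomial.X, fun a => ?_⟩
  obtain ⟨t, s, ht, hr, hs⟩ := hP a
  have h1 := hr.length_le 0
  have h2 : (initStore a 0).length ≤ size a := by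
    simp only [initStore]; split_ifs with h
    · exact length_le_size a _
    · simp
  rw [← hs]
  simp only [Polynomial.eval_add, Polynomial.eval_X]
  omega

theorem size_le_of_polyTime {m n : ℕ} {φ : Fin n → Input m → Word} (h : ∀ i, PolyTime (φ i)) :
    ∃ p : Polynomial ℕ, ∀ a, size (fun i => φ i a) ≤ p.eval (size a) := by
  choose p hp using fun i => (h i).length_le
  refine ⟨∑ i, p i, fun a => ?_⟩
  rw [Polynomial.eval_finsetSum]
  exact Finset.sum_le_sum fun i _ => hp i a

/-- The program is relocated to the stacks from `d` on and run there on a copy of the arguments; its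
result is moved to `τ`, and the stacks that it has used are emptied. -/
theorem PolyTime.assigns {m : ℕ} {φ : Input m → Word} (h : PolyTime φ) : Assigns φ := by
  obtain ⟨P, p, hP⟩ := h
  intro σ τ d hσ hτ
  obtain ⟨C, c, hC⟩ := exists_assignAll (φ := fun (i : Fin m) (a : Input m) => a i) assigns_proj σ
    d (d + m) (fun i => by have := hσ i; omega) (fun i => Or.inl (hσ i)) le_rfl
  set B := max P.bound m + 1 with hB
  refine ⟨.seq C (.seq (P.shift d) (.seq (.clear τ) (.seq (.move d τ (d + B)) (.clearRange d B)))),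
    c + p + (2 * Polynomial.X + 1) + (8 * (p + Polynomial.X) + 2)
      + (2 * ((B : Polynomial ℕ) * (p + Polynomial.X)) + (B : Polynomial ℕ) + 1),
    fun S hS => ?_⟩
  set a : Input m := fun i => S (σ i) with ha
  obtain ⟨t, s, ht, hr, hs⟩ := hP a
  have h1 := hC S (fun i hi => hS i (by omega))
  have h2 : place d S a = merge d S (initStore a) := by
    ext1 i
    by_cases hi : i < d
    · rw [place_of_lt hi, merge_of_lt hi]
    · obtain ⟨j, rfl⟩ := Nat.exists_eq_add_of_le (not_lt.1 hi)
      rw [merge_add]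
      simp only [place, initStore]
      by_cases hj : j < m
      · rw [dif_pos ⟨by omega, by omega⟩, dif_pos hj]; simp
      · rw [dif_neg (by omega), dif_neg hj, hS _ (by omega)]
  change Exec C S _ (place d S a) at h1
  rw [h2] at h1
  have h3 : Exec (P.shift d) (merge d S (initStore a)) (p.eval (size a)) (merge d S s) :=
    ⟨t, ht, hr.shift d S⟩
  have hsB : ∀ i, B ≤ i → s i = [] := fun i hi => by
    rw [hr.frame i (by omega)]; simp only [initStore]; rw [dif_neg (by omega)]
  have hsl : ∀ i, (s i).length ≤ p.eval (size a) + size a := fun i => by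
    have h1 := hr.length_le i
    have h2 : (initStore a i).length ≤ size a := by
      simp only [initStore]; split_ifs with h
      · exact length_le_size a _
      · simp
    omega
  have h4 := exec_clear (merge d S s) τ
  rw [merge_of_lt hτ] at h4
  have h5 := exec_move (i := d) (j := τ) (k := d + B) hτ.ne' (by omega) (by omega)
    (update (merge d S s) τ []) (by
      rw [update_of_ne (by omega), merge_add, hsB _ le_rfl])
  have hd : update (merge d S s) τ [] d = φ a := by
    rw [update_of_ne hτ.ne', ← hs]; exact merge_add d S s 0
  rw [hd, update_self, List.append_nil] at h5
  have h6 := exec_clearRange d B (update (update (update (merge d S s) τ []) d []) τ (φ a))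
  have h7 : place d (update (update (update (merge d S s) τ []) d []) τ (φ a))
      (fun _ : Fin B => []) = update S τ (φ a) := by
    ext1 i
    by_cases hi : i = τ
    · subst hi; rw [place_of_lt hτ]; simp
    · by_cases hid : i < d
      · rw [place_of_lt hid, update_of_ne hi, update_of_ne hi, update_of_ne (by omega),
          update_of_ne hi, merge_of_lt hid]
      · obtain ⟨j, rfl⟩ := Nat.exists_eq_add_of_le (not_lt.1 hid)
        by_cases hj : j < B
        · rw [update_of_ne hi, hS _ (by omega)]
          exact place_apply_add d _ (fun _ : Fin B => []) ⟨j, hj⟩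
        · rw [place_of_ge (by omega), update_of_ne hi, update_of_ne hi, update_of_ne (by omega),
            update_of_ne hi, merge_add, hsB _ (by omega), hS _ (by omega)]
  rw [h7] at h6
  have h8 : size (fun i : Fin B =>
      update (update (update (merge d S s) τ []) d []) τ (φ a) (d + i))
      ≤ B * (p.eval (size a) + size a) := by
    refine size_le_of_forall fun i => ?_
    rw [update_of_ne (by omega)]
    by_cases hi : (i : ℕ) = 0
    · simp [hi]
    · rw [update_of_ne (by omega), update_of_ne (by omega), merge_add]; exact hsl i
  refine (h1.seq (h3.seq (h4.seq (h5.seq h6)))).mono ?_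
  have h9 : size (fun i : Fin m => S (d + i)) = 0 := by
    simp only [size]; exact Finset.sum_eq_zero fun i _ => by rw [hS _ (by omega)]; rfl
  have h10 : (φ a).length ≤ p.eval (size a) + size a := hs ▸ hsl 0
  rw [h9]
  simp only [Polynomial.eval_add, Polynomial.eval_mul, Polynomial.eval_ofNat, Polynomial.eval_X,
    Polynomial.eval_natCast, Nat.cast_id, Polynomial.eval_one]
  have e1 := eval_mono p (Nat.le_add_right (size a) (S τ).length)
  have e2 := eval_mono c (Nat.le_add_right (size a) (S τ).length)
  have e3 : B * (p.eval (size a) + size a) ≤ B * (p.eval (size a + (S τ).length)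
    + (size a + (S τ).length)) := Nat.mul_le_mul_left _ (by omega)
  change c.eval (size a) + _ ≤ _
  omega

theorem Assigns.polyTime {m : ℕ} {φ : Input m → Word} (h : Assigns φ) : PolyTime φ := by
  obtain ⟨P, p, hP⟩ := h (fun i => i) 0 (m + 1) (fun i => by omega) (by omega)
  refine ⟨P, p.comp (2 * Polynomial.X), fun a => ?_⟩
  have hin : (fun i : Fin m => initStore a i) = a := by ext1 i; simp [initStore]
  obtain ⟨t, ht, hr⟩ := hP (initStore a)
    (fun i hi => by simp only [initStore]; rw [dif_neg (by omega)])
  rw [hin] at ht hr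
  refine ⟨t, _, ht.trans ?_, hr, by simp⟩
  rw [Polynomial.eval_comp]
  refine eval_mono _ ?_
  have h2 : (initStore a 0).length ≤ size a := by
    simp only [initStore]; split_ifs with h
    · exact length_le_size a _
    · simp
  simp; omega

theorem polyTime_proj {m : ℕ} (j : Fin m) : PolyTime fun a : Input m => a j :=
  (assigns_proj j).polyTime

theorem PolyTime.comp {m n : ℕ} {φ : Input n → Word} {ψ : Fin n → Input m → Word}
    (hφ : PolyTime φ) (hψ : ∀ i, PolyTime (ψ i)) : PolyTime fun a => φ fun i => ψ i a := by
  refine Assigns.polyTime fun σ τ d hσ hτ => ?_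
  obtain ⟨q, hq⟩ := size_le_of_polyTime hψ
  obtain ⟨P, p, hP⟩ := exists_assignAll (fun i => (hψ i).assigns) σ d (d + n)
    (fun i => by have := hσ i; omega) (fun i => Or.inl (hσ i)) le_rfl
  obtain ⟨R, r, hR⟩ := hφ.assigns (fun i => d + i) τ (d + n) (fun i => by omega) (by omega)
  refine ⟨.seq P (.seq R (.clearRange d n)),
    p + r.comp (q + Polynomial.X) + (2 * q + (n : Polynomial ℕ) + 1), fun S hS => ?_⟩
  set a : Input m := fun i => S (σ i) with ha
  have h1 := hP S (fun i hi => hS i (by omega))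
  have h2 := hR (place d S fun j => ψ j a) (fun i hi => by
    rw [place_of_ge (by omega)]; exact hS i (by omega))
  simp only [place_apply_add] at h2
  rw [place_of_lt hτ] at h2
  have h3 := exec_clearRange d n (update (place d S fun j => ψ j a) τ (φ fun i => ψ i a))
  have h4 : place d (update (place d S fun j => ψ j a) τ (φ fun i => ψ i a)) (fun _ : Fin n => [])
      = update S τ (φ fun i => ψ i a) := by
    ext1 i
    by_cases hi : i = τ
    · subst hi; rw [place_of_lt hτ]; simp
    · rw [update_of_ne hi]
      by_cases hid : i < d
      · rw [place_of_lt hid, update_of_ne hi, place_of_lt hid]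
      · by_cases hin : i < d + n
        · rw [hS _ (by omega)]; simp [place]; omega
        · rw [place_of_ge (by omega), update_of_ne hi, place_of_ge (by omega)]
  have h5 : (fun i : Fin n =>
      update (place d S fun j => ψ j a) τ (φ fun i => ψ i a) (d + i)) = fun i => ψ i a := by
    ext1 i
    rw [update_of_ne (by omega), place_apply_add]
  rw [h4, h5] at h3
  refine (h1.seq (h2.seq h3)).mono ?_
  have h9 : size (fun i : Fin n => S (d + i)) = 0 := by
    simp only [size]; exact Finset.sum_eq_zero fun i _ => by rw [hS _ (by omega)]; rfl
  rw [h9]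
  simp only [Polynomial.eval_add, Polynomial.eval_mul, Polynomial.eval_ofNat, Polynomial.eval_X,
    Polynomial.eval_natCast, Nat.cast_id, Polynomial.eval_one, Polynomial.eval_comp]
  have e1 := eval_mono p (Nat.le_add_right (size a) (S τ).length)
  have e2 := hq a
  have e3 := eval_mono q (Nat.le_add_right (size a) (S τ).length)
  have e4 : r.eval (size (fun i => ψ i a) + (S τ).length)
      ≤ r.eval (q.eval (size a + (S τ).length) + (size a + (S τ).length)) :=
    eval_mono r (by omega)
  change p.eval (size a) + _ ≤ _
  omega

/-- Bounded recursion: a state of `r` words is updated by `g b` for each bit `b` of the word `w a`.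
If the size of the state remains polynomially bounded, the result is computable in polynomial
time. -/
theorem PolyTime.foldl {m r : ℕ} {g : Bool → Input r → Input r}
    (hg : ∀ b i, PolyTime fun s => g b s i) {init : Input m → Input r}
    (hinit : ∀ i, PolyTime fun a => init a i) {w : Input m → Word} (hw : PolyTime w)
    (q : Polynomial ℕ)
    (hq : ∀ a u, u <+: w a → size (u.foldl (fun s b => g b s) (init a)) ≤ q.eval (size a))
    (j : Fin r) : PolyTime fun a => (w a).foldl (fun s b => g b s) (init a) j := by
  refine Assigns.polyTime fun σ τ d hσ hτ => ?_
  obtain ⟨l, hl⟩ := hw.length_le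
  set D := d + r + 1 with hD
  obtain ⟨P, p, hP⟩ := exists_assignAll (fun i => (hinit i).assigns) σ d (d + r)
    (fun i => by have := hσ i; omega) (fun i => Or.inl (hσ i)) le_rfl
  obtain ⟨W, pw, hW⟩ := hw.assigns σ (d + r) D (fun i => by have := hσ i; omega) (by omega)
  obtain ⟨C, pc, hC⟩ := exists_assignAll (φ := fun (i : Fin r) (a : Input r) => a i) assigns_proj
    (fun i => D + i) d (D + r) (fun i => by omega) (fun i => Or.inr (by omega)) (by omega)
  -- the body of the loop, for either value of the bit
  have hbody : ∀ b : Bool, ∃ (Q : Prog) (pq : Polynomial ℕ), ∀ (S : Store) (s : Input r) (u : Word)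
      (M : ℕ), (∀ i, d ≤ i → S i = []) → size s ≤ M → size (g b s) ≤ M →
      Exec Q (update (place d S s) (d + r) u) (pq.eval M)
        (update (place d S (g b s)) (d + r) u) := by
    intro b
    obtain ⟨Q, pq, hQ⟩ := exists_assignAll (fun i => (hg b i).assigns) (fun i : Fin r => d + i) D
      (D + r) (fun i => by omega) (fun i => Or.inl (by omega)) le_rfl
    refine ⟨.seq Q (.seq C (.clearRange D r)), pq + pc.comp (2 * Polynomial.X) +
      (2 * Polynomial.X + (r : Polynomial ℕ) + 1), fun S s u M hS hs hgs => ?_⟩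
    have h1 := hQ (update (place d S s) (d + r) u) (fun i hi => by
      rw [update_of_ne (by omega), place_of_ge (by omega)]; exact hS i (by omega))
    have e1 : (fun i : Fin r => update (place d S s) (d + r) u (d + i)) = s := by
      ext1 i; rw [update_of_ne (by omega), place_apply_add]
    have e2 : size (fun i : Fin r => update (place d S s) (d + r) u (D + i)) = 0 := by
      simp only [size]
      exact Finset.sum_eq_zero fun i _ => by
        rw [update_of_ne (by omega), place_of_ge (by omega), hS _ (by omega)]; rfl
    rw [e1, e2] at h1
    have h2 := hC (place D (update (place d S s) (d + r) u) (fun i => g b s i)) (fun i hi => by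
      rw [place_of_ge (by omega), update_of_ne (by omega), place_of_ge (by omega)]
      exact hS i (by omega))
    have e3 : (fun i : Fin r => place D (update (place d S s) (d + r) u) (fun i => g b s i)
        (d + i)) = s := by
      ext1 i; rw [place_of_lt (by omega), update_of_ne (by omega), place_apply_add]
    simp only [place_apply_add, e3] at h2
    have h3 := exec_clearRange D r
      (place d (place D (update (place d S s) (d + r) u) fun i => g b s i) fun i => g b s i)
    have e4 : (fun i : Fin r => place d (place D (update (place d S s) (d + r) u)
        fun i => g b s i) (fun i => g b s i) (D + i)) = g b s := by
      ext1 i; rw [place_of_ge (by omega), place_apply_add]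
    have e5 : place D (place d (place D (update (place d S s) (d + r) u) fun i => g b s i)
        fun i => g b s i) (fun _ : Fin r => []) = update (place d S (g b s)) (d + r) u := by
      ext1 i
      by_cases hid : i < d
      · rw [place_of_lt (by omega), place_of_lt hid, place_of_lt (by omega),
          update_of_ne (by omega), place_of_lt hid, update_of_ne (by omega), place_of_lt hid]
      · by_cases hir : i < d + r
        · obtain ⟨k, rfl⟩ := Nat.exists_eq_add_of_le (not_lt.1 hid)
          have hk : k < r := by omega
          rw [place_of_lt (by omega), update_of_ne (by omega)]
          exact (place_apply_add d _ (g b s) ⟨k, hk⟩).trans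
            (place_apply_add d _ (g b s) ⟨k, hk⟩).symm
        · by_cases hi : i = d + r
          · subst hi
            rw [place_of_lt (by omega), place_of_ge (by omega), place_of_lt (by omega)]
            simp
          · rw [update_of_ne hi, place_of_ge (d := d) (by omega), hS i (by omega)]
            by_cases hiD : i < D + r
            · simp [place]; omega
            · rw [place_of_ge (by omega), place_of_ge (by omega), place_of_ge (by omega),
                update_of_ne hi, place_of_ge (by omega), hS i (by omega)]
    rw [e4, e5] at h3
    refine (h1.seq (h2.seq h3)).mono ?_
    simp only [Polynomial.eval_add, Polynomial.eval_mul, Polynomial.eval_ofNat, Polynomial.eval_X,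
      Polynomial.eval_natCast, Nat.cast_id, Polynomial.eval_one, Polynomial.eval_comp]
    have m1 := eval_mono pq hs
    have m2 : pc.eval (size (g b s) + size s) ≤ pc.eval (2 * M) := eval_mono pc (by omega)
    simp only [add_zero]
    change _ + (pc.eval (size (g b s) + size s) + _) ≤ _
    omega
  obtain ⟨QT, qt, hQT⟩ := hbody true
  obtain ⟨QF, qf, hQF⟩ := hbody false
  set L : Prog := .loop (d + r) (.seq (.branch (d + r) QT QF .skip) (.pop (d + r))) with hL
  have hloop : ∀ (S : Store) (M : ℕ), (∀ i, d ≤ i → S i = []) → ∀ (u : Word) (s : Input r),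
      (∀ v, v <+: u → size (v.foldl (fun s b => g b s) s) ≤ M) →
      Exec L (update (place d S s) (d + r) u) (u.length * (qt.eval M + qf.eval M + 3) + 1)
        (update (place d S (u.foldl (fun s b => g b s) s)) (d + r) []) := by
    intro S M hS u
    induction u with
    | nil => intro s _; exact (exec_loop_done (by simp)).mono (by simp)
    | cons b u ih =>
      intro s hs
      have h1 : size s ≤ M := by simpa using hs [] (by simp)
      have h2 : size (g b s) ≤ M := by simpa using hs [b] (by simp)
      have h3 : Exec (.branch (d + r) QT QF .skip) (update (place d S s) (d + r) (b :: u))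
          (qt.eval M + qf.eval M + 1) (update (place d S (g b s)) (d + r) (b :: u)) := by
        cases b
        · exact (Exec.branch_false (by simp) (hQF S s _ M hS h1 h2)).mono (by omega)
        · exact (Exec.branch_true (by simp) (hQT S s _ M hS h1 h2)).mono (by omega)
      have h4 := exec_pop (update (place d S (g b s)) (d + r) (b :: u)) (d + r)
      simp only [update_self, update_idem, List.tail_cons] at h4
      have h5 := ih (g b s) (fun v hv => by
        simpa using hs (b :: v) (by simpa using hv))
      have h6 := Exec.loop_step (i := d + r) (by simp) (h3.seq h4) h5
      refine h6.mono ?_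
      simp only [List.length_cons, Nat.add_mul]
      omega
  obtain ⟨E, pe, hE⟩ := assigns_proj j (fun i => d + i) τ (d + r) (fun i => by omega) (by omega)
  refine ⟨.seq P (.seq W (.seq L (.seq E (.clearRange d r)))),
    p + pw + (l * (qt.comp q + qf.comp q + 3) + 1) + pe.comp (q + Polynomial.X)
      + (2 * q + (r : Polynomial ℕ) + 1), fun S hS => ?_⟩
  set a : Input m := fun i => S (σ i) with ha
  have h1 := hP S (fun i hi => hS i (by omega))
  have h2 := hW (place d S fun i => init a i) (fun i hi => by
    rw [place_of_ge (by omega)]; exact hS i (by omega))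
  have e1 : (fun i : Fin m => place d S (fun i => init a i) (σ i)) = a := by
    ext1 i; rw [place_of_lt (hσ i)]
  rw [e1, place_of_ge le_rfl, hS (d + r) (by omega)] at h2
  have h3 := hloop S (q.eval (size a)) hS (w a) (init a) (fun v hv => hq a v hv)
  set s := (w a).foldl (fun s b => g b s) (init a) with hs
  have e2 : update (place d S s) (d + r) [] = place d S s := by
    rw [update_eq_self_iff, place_of_ge le_rfl, hS _ (by omega)]
  rw [e2] at h3
  have h4 := hE (place d S s) (fun i hi => by rw [place_of_ge hi, hS i (by omega)])
  simp only [place_apply_add] at h4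
  rw [place_of_lt hτ] at h4
  change Exec E _ (pe.eval (size s + _)) _ at h4
  have h5 := exec_clearRange d r (update (place d S s) τ (s j))
  have e3 : (fun i : Fin r => update (place d S s) τ (s j) (d + i)) = s := by
    ext1 i; rw [update_of_ne (by omega), place_apply_add]
  have e4 : place d (update (place d S s) τ (s j)) (fun _ : Fin r => []) = update S τ (s j) := by
    ext1 i
    by_cases hi : i = τ
    · subst hi; rw [place_of_lt hτ]; simp
    · rw [update_of_ne hi]
      by_cases hid : i < d
      · rw [place_of_lt hid, update_of_ne hi, place_of_lt hid]
      · by_cases hin : i < d + r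
        · rw [hS _ (by omega)]; simp [place]; omega
        · rw [place_of_ge (by omega), update_of_ne hi, place_of_ge (by omega)]
  rw [e3, e4] at h5
  refine (h1.seq (h2.seq (h3.seq (h4.seq h5)))).mono ?_
  have h9 : size (fun i : Fin r => S (d + i)) = 0 := by
    simp only [size]; exact Finset.sum_eq_zero fun i _ => by rw [hS _ (by omega)]; rfl
  rw [h9]
  simp only [Polynomial.eval_add, Polynomial.eval_mul, Polynomial.eval_ofNat, Polynomial.eval_X,
    Polynomial.eval_natCast, Nat.cast_id, Polynomial.eval_one, Polynomial.eval_comp,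
    List.length_nil, add_zero]
  change p.eval (size a) + _ ≤ _
  have hsz : size s ≤ _ := hq a (w a) List.prefix_rfl
  set N := size a + (S τ).length with hN
  have hle : size a ≤ N := by omega
  have m1 := eval_mono p hle
  have m2 := eval_mono pw hle
  have m3 := eval_mono q hle
  have m4 := eval_mono qt m3
  have m5 := eval_mono qf m3
  have m6 := (hl a).trans (eval_mono l hle)
  have m7 : (w a).length * (qt.eval (q.eval (size a)) + qf.eval (q.eval (size a)) + 3)
      ≤ l.eval N * (qt.eval (q.eval N) + qf.eval (q.eval N) + 3) := by gcongr
  have m8 : pe.eval (size s + (S τ).length) ≤ pe.eval (q.eval N + N) := eval_mono pe (by omega)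
  omega

/-! ### Elementary polynomial-time functions and predicates -/

theorem size_initStore_zero_le {m : ℕ} (a : Input m) : (initStore a 0).length ≤ size a := by
  simp only [initStore]; split_ifs with h
  · exact length_le_size a _
  · simp

theorem polyTime_nil {m : ℕ} : PolyTime fun _ : Input m => [] := by
  refine ⟨.clear 0, 2 * Polynomial.X + 1, fun a => ?_⟩
  obtain ⟨t, ht, hr⟩ := exec_clear (initStore a) 0
  have := size_initStore_zero_le a
  exact ⟨t, _, ht.trans (by simp; omega), hr, by simp⟩

theorem PolyTime.of_vec {m n : ℕ} {φ : Input n → Word} (hφ : PolyTime φ) {ψ : Input m → Input n}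
    (hψ : ∀ i, PolyTime fun a => ψ a i) : PolyTime fun a => φ (ψ a) :=
  PolyTime.comp (ψ := fun i a => ψ a i) hφ hψ

theorem polyVec_nil {m : ℕ} {ψ : Input m → Input 0} : ∀ i, PolyTime fun a => ψ a i :=
  fun i => i.elim0

theorem polyVec_cons {m n : ℕ} {f : Input m → Word} {ψ : Input m → Input n} (hf : PolyTime f)
    (hψ : ∀ i, PolyTime fun a => ψ a i) :
    ∀ i, PolyTime fun a => (Matrix.vecCons (f a) (ψ a) : Input (n + 1)) i :=
  Fin.cases (by simpa using hf) (by simpa using hψ)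

theorem PolyTime.cons {m : ℕ} {f : Input m → Word} (b : Bool) (hf : PolyTime f) :
    PolyTime fun a => b :: f a := by
  have : PolyTime fun a : Input 1 => b :: a 0 :=
    ⟨.push 0 b, 1, fun a => ⟨1, _, by simp, .push _ _ _, by simp [initStore]⟩⟩
  exact this.of_vec (ψ := fun a => ![f a]) (polyVec_cons hf polyVec_nil)

theorem PolyTime.tail {m : ℕ} {f : Input m → Word} (hf : PolyTime f) :
    PolyTime fun a => (f a).tail := by
  have : PolyTime fun a : Input 1 => (a 0).tail :=
    ⟨.pop 0, 1, fun a => ⟨1, _, by simp, .pop _ _, by simp [initStore]⟩⟩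
  exact this.of_vec (ψ := fun a => ![f a]) (polyVec_cons hf polyVec_nil)

theorem polyTime_const {m : ℕ} (w : Word) : PolyTime fun _ : Input m => w := by
  induction w with
  | nil => exact polyTime_nil
  | cons b w ih => exact ih.cons b

/-- Case distinction on the first letter of `c`. -/
def headCases (c x y z : Word) : Word :=
  match c with
  | true :: _ => x
  | false :: _ => y
  | [] => z

theorem PolyTime.headCases {m : ℕ} {c x y z : Input m → Word} (hc : PolyTime c) (hx : PolyTime x)
    (hy : PolyTime y) (hz : PolyTime z) :
    PolyTime fun a => headCases (c a) (x a) (y a) (z a) := by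
  have : PolyTime fun a : Input 4 => NearOptBilevel.headCases (a 0) (a 1) (a 2) (a 3) := by
    set mv : ℕ → Prog := fun i => .seq (.clear 0) (.move i 0 4) with hmv
    have key : ∀ (a : Input 4) (i : ℕ) (h0 : 0 < i) (hi : i < 4),
        ∃ S, Exec (mv i) (initStore a) (10 * size a + 3) S ∧ S 0 = a ⟨i, hi⟩ := by
      intro a i h0 hi
      have h1 := exec_clear (initStore a) 0
      have h2 := exec_move (i := i) (j := 0) (k := 4) h0.ne' hi.ne (by omega)
        (update (initStore a) 0 []) (by simp [initStore])
      rw [update_of_ne h0.ne'] at h2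
      have e : initStore a i = a ⟨i, hi⟩ := by simp [initStore, hi]
      have h3 := length_le_size a ⟨i, hi⟩
      have h4 := size_initStore_zero_le a
      exact ⟨_, (h1.seq h2).mono (by rw [e]; omega), by simp [e]⟩
    refine ⟨.branch 0 (mv 1) (mv 2) (mv 3), 10 * Polynomial.X + 4, fun a => ?_⟩
    have e0 : initStore a 0 = a 0 := by simp [initStore]
    suffices h : ∃ S, Exec (.branch 0 (mv 1) (mv 2) (mv 3)) (initStore a) (10 * size a + 3 + 1) S ∧
        S 0 = NearOptBilevel.headCases (a 0) (a 1) (a 2) (a 3) by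
      obtain ⟨S, ⟨t, ht, hr⟩, hS⟩ := h
      exact ⟨t, S, ht.trans (by simp), hr, hS⟩
    rcases h0 : a 0 with _ | ⟨b, l⟩
    · obtain ⟨S, hS, e⟩ := key a 3 (by omega) (by omega)
      exact ⟨S, Exec.branch_empty (by rw [e0, h0]) hS, e⟩
    · cases b
      · obtain ⟨S, hS, e⟩ := key a 2 (by omega) (by omega)
        exact ⟨S, Exec.branch_false (by rw [e0, h0]; rfl) hS, e⟩
      · obtain ⟨S, hS, e⟩ := key a 1 (by omega) (by omega)
        exact ⟨S, Exec.branch_true (by rw [e0, h0]; rfl) hS, e⟩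
  exact this.of_vec (ψ := fun a => ![c a, x a, y a, z a])
    (polyVec_cons hc (polyVec_cons hx (polyVec_cons hy (polyVec_cons hz polyVec_nil))))

/-- The predicate `P` on tuples of words is decidable in polynomial time. -/
def PolyDec {m : ℕ} (P : Input m → Prop) : Prop := {a | P a} ∈ ClassP m

theorem PolyDec.congr {m : ℕ} {P Q : Input m → Prop} (hP : PolyDec P) (h : ∀ a, Q a ↔ P a) :
    PolyDec Q := by
  have : Q = P := funext fun a => propext (h a)
  rwa [this]

theorem PolyTime.ite {m : ℕ} {P : Input m → Prop} [DecidablePred P] {f g : Input m → Word}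
    (hP : PolyDec P) (hf : PolyTime f) (hg : PolyTime g) :
    PolyTime fun a => if P a then f a else g a := by
  obtain ⟨φ, hφ, h⟩ := hP
  convert hφ.headCases (hφ.tail.headCases hg hg hf) hg hg using 2 with a
  have := h a
  simp only [Set.mem_ofPred_eq] at this
  simp only [this]
  rcases φ a with _ | ⟨_ | _, _ | ⟨_ | _, l⟩⟩ <;> simp [NearOptBilevel.headCases]

theorem polyDec_head {m : ℕ} {f : Input m → Word} (hf : PolyTime f) :
    PolyDec fun a => (f a).head? = some true := by
  refine ⟨_, hf.headCases (polyTime_const [true]) polyTime_nil polyTime_nil, fun a => ?_⟩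
  simp only [Set.mem_ofPred_eq]
  rcases f a with _ | ⟨_ | _, l⟩ <;> simp [headCases]

theorem polyDec_head_false {m : ℕ} {f : Input m → Word} (hf : PolyTime f) :
    PolyDec fun a => (f a).head? = some false := by
  refine ⟨_, hf.headCases polyTime_nil (polyTime_const [true]) polyTime_nil, fun a => ?_⟩
  simp only [Set.mem_ofPred_eq]
  rcases f a with _ | ⟨_ | _, l⟩ <;> simp [headCases]

theorem polyDec_eq_nil {m : ℕ} {f : Input m → Word} (hf : PolyTime f) :
    PolyDec fun a => f a = [] := by
  refine ⟨_, hf.headCases polyTime_nil polyTime_nil (polyTime_const [true]), fun a => ?_⟩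
  simp only [Set.mem_ofPred_eq]
  rcases f a with _ | ⟨_ | _, l⟩ <;> simp [headCases]

theorem polyDec_const {m : ℕ} (P : Prop) : PolyDec fun _ : Input m => P := by
  by_cases h : P
  · exact ⟨_, polyTime_const [true], by simp [h]⟩
  · exact ⟨_, polyTime_nil, by simp [h]⟩

open Classical in
theorem PolyDec.ite {m : ℕ} {P Q R : Input m → Prop} (hP : PolyDec P) (hQ : PolyDec Q)
    (hR : PolyDec R) : PolyDec fun a => if P a then Q a else R a := by
  obtain ⟨φ, hφ, h⟩ := hQ
  obtain ⟨χ, hχ, h'⟩ := hR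
  refine ⟨_, PolyTime.ite hP hφ hχ, fun a => ?_⟩
  have h1 := h a
  have h2 := h' a
  simp only [Set.mem_ofPred_eq] at *
  split_ifs <;> assumption

theorem PolyDec.and {m : ℕ} {P Q : Input m → Prop} (hP : PolyDec P) (hQ : PolyDec Q) :
    PolyDec fun a => P a ∧ Q a :=
  (hP.ite hQ (polyDec_const False)).congr fun a => by by_cases h : P a <;> simp [h]

theorem PolyDec.or {m : ℕ} {P Q : Input m → Prop} (hP : PolyDec P) (hQ : PolyDec Q) :
    PolyDec fun a => P a ∨ Q a :=
  (hP.ite (polyDec_const True) hQ).congr fun a => by by_cases h : P a <;> simp [h]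

theorem PolyDec.not {m : ℕ} {P : Input m → Prop} (hP : PolyDec P) : PolyDec fun a => ¬ P a :=
  (hP.ite (polyDec_const False) (polyDec_const True)).congr fun a => by
    by_cases h : P a <;> simp [h]

theorem PolyDec.iff {m : ℕ} {P Q : Input m → Prop} (hP : PolyDec P) (hQ : PolyDec Q) :
    PolyDec fun a => (P a ↔ Q a) :=
  (hP.ite hQ hQ.not).congr fun a => by by_cases h : P a <;> simp [h]

theorem PolyDec.of_vec {m n : ℕ} {P : Input n → Prop} (hP : PolyDec P) {ψ : Input m → Input n}
    (hψ : ∀ i, PolyTime fun a => ψ a i) : PolyDec fun a => P (ψ a) := by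
  obtain ⟨φ, hφ, h⟩ := hP
  exact ⟨_, hφ.of_vec hψ, fun a => h (ψ a)⟩

/-- Recursion along a word, for a state whose size grows by at most `C` in every step. -/
theorem PolyTime.foldl_of_growth {m r : ℕ} {g : Bool → Input r → Input r}
    (hg : ∀ b i, PolyTime fun s => g b s i) {init : Input m → Input r}
    (hinit : ∀ i, PolyTime fun a => init a i) {w : Input m → Word} (hw : PolyTime w)
    (C : ℕ) (hC : ∀ b s, size (g b s) ≤ size s + C) (j : Fin r) :
    PolyTime fun a => (w a).foldl (fun s b => g b s) (init a) j := by
  obtain ⟨p, hp⟩ := size_le_of_polyTime hinit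
  obtain ⟨l, hl⟩ := hw.length_le
  refine PolyTime.foldl hg hinit hw (p + (C : Polynomial ℕ) * l) (fun a u hu => ?_) j
  have key : ∀ (u : Word) (s : Input r),
      size (u.foldl (fun s b => g b s) s) ≤ size s + C * u.length := by
    intro u
    induction u with
    | nil => intro s; simp
    | cons b u ih =>
      intro s
      have := hC b s
      refine (ih (g b s)).trans ?_
      simp only [List.length_cons, Nat.mul_add]; omega
  refine (key u _).trans ?_
  simp only [Polynomial.eval_add, Polynomial.eval_mul, Polynomial.eval_natCast, Nat.cast_id]
  exact Nat.add_le_add (hp a) (Nat.mul_le_mul_left _ (hu.length_le.trans (hl a)))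

theorem PolyTime.foldl_word {m : ℕ} {g : Bool → Word → Word}
    (hg : ∀ b, PolyTime fun s : Input 1 => g b (s 0)) {init : Input m → Word}
    (hinit : PolyTime init) {w : Input m → Word} (hw : PolyTime w)
    (C : ℕ) (hC : ∀ b s, (g b s).length ≤ s.length + C) :
    PolyTime fun a => (w a).foldl (fun s b => g b s) (init a) := by
  have := PolyTime.foldl_of_growth (g := fun b s => ![g b (s 0)]) (init := fun a => ![init a])
    (fun b => polyVec_cons (hg b) polyVec_nil) (polyVec_cons hinit polyVec_nil) hw C
    (fun b s => by simpa [size] using hC b (s 0)) 0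
  convert this using 2 with a
  have key : ∀ (u : Word) (s : Word), ![u.foldl (fun s b => g b s) s]
      = u.foldl (fun (s : Input 1) b => ![g b (s 0)]) ![s] := by
    intro u
    induction u with
    | nil => intro s; rfl
    | cons b u ih => intro s; exact ih (g b s)
  rw [← key]; rfl

theorem PolyTime.reverse {m : ℕ} {f : Input m → Word} (hf : PolyTime f) :
    PolyTime fun a => (f a).reverse := by
  have := PolyTime.foldl_word (g := fun b s => b :: s) (fun b => (polyTime_proj 0).cons b)
    (polyTime_nil) hf 1 (fun b s => by simp)
  convert this using 2 with a
  simp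

theorem PolyTime.foldr_word {m : ℕ} {g : Bool → Word → Word}
    (hg : ∀ b, PolyTime fun s : Input 1 => g b (s 0)) {init : Input m → Word}
    (hinit : PolyTime init) {w : Input m → Word} (hw : PolyTime w)
    (C : ℕ) (hC : ∀ b s, (g b s).length ≤ s.length + C) :
    PolyTime fun a => (w a).foldr g (init a) := by
  have := PolyTime.foldl_word hg hinit hw.reverse C hC
  convert this using 2 with a
  simp

theorem PolyTime.append {m : ℕ} {f g : Input m → Word} (hf : PolyTime f) (hg : PolyTime g) :
    PolyTime fun a => f a ++ g a := by
  have := PolyTime.foldr_word (g := fun b s => b :: s) (fun b => (polyTime_proj 0).cons b)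
    hg hf 1 (fun b s => by simp)
  convert this using 2 with a
  simp

theorem PolyTime.drop {m : ℕ} {f g : Input m → Word} (hf : PolyTime f) (hg : PolyTime g) :
    PolyTime fun a => (f a).drop (g a).length := by
  have := PolyTime.foldl_word (g := fun _ s => s.tail) (fun b => (polyTime_proj 0).tail)
    hf hg 0 (fun b s => by simp)
  convert this using 2 with a
  have key : ∀ (u : Word) (s : Word), s.drop u.length = u.foldl (fun s _ => s.tail) s := by
    intro u
    induction u with
    | nil => intro s; rfl
    | cons b u ih => intro s; rw [List.foldl_cons, ← ih]; simp
  exact key _ _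

theorem PolyTime.unary_length {m : ℕ} {f : Input m → Word} (hf : PolyTime f) :
    PolyTime fun a => unary (f a).length := by
  have := PolyTime.foldr_word (g := fun _ s => true :: s) (fun b => (polyTime_proj 0).cons true)
    polyTime_nil hf 1 (fun b s => by simp)
  convert this using 2 with a
  induction f a with
  | nil => rfl
  | cons b u ih => rw [List.foldr_cons, ← ih]; rfl

theorem polyDec_length_le {m : ℕ} {f g : Input m → Word} (hf : PolyTime f) (hg : PolyTime g) :
    PolyDec fun a => (f a).length ≤ (g a).length :=
  (polyDec_eq_nil (hf.drop hg)).congr fun a => by simp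

theorem polyDec_eq {m : ℕ} {f g : Input m → Word} (hf : PolyTime f) (hg : PolyTime g) :
    PolyDec fun a => f a = g a := by
  -- the state consists of the unread part of `g a` and of a word that is empty as long as no
  -- difference has been found
  have hG : ∀ (b : Bool) (i : Fin 2), PolyTime fun s : Input 2 =>
      (![(s 0).tail, if (s 0).head? = some b then s 1 else [true]] : Input 2) i := by
    intro b
    refine polyVec_cons (polyTime_proj 0).tail (polyVec_cons ?_ polyVec_nil)
    refine PolyTime.ite ?_ (polyTime_proj 1) (polyTime_const _)
    cases b
    · exact polyDec_head_false (polyTime_proj 0)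
    · exact polyDec_head (polyTime_proj 0)
  have h := PolyTime.foldl_of_growth (m := m) hG (init := fun a => ![g a, []])
    (polyVec_cons hg (polyVec_cons polyTime_nil polyVec_nil)) hf 1 (fun b s => by
      simp only [size, Fin.sum_univ_two, Matrix.cons_val_zero, Matrix.cons_val_one]
      split_ifs <;> simp <;> omega)
  have key : ∀ (u v e : Word),
      ((u.foldl (fun (s : Input 2) b =>
        ![(s 0).tail, if (s 0).head? = some b then s 1 else [true]]) ![v, e]) 0 = [] ∧
      (u.foldl (fun (s : Input 2) b =>
        ![(s 0).tail, if (s 0).head? = some b then s 1 else [true]]) ![v, e]) 1 = []) ↔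
      u = v ∧ e = [] := by
    intro u
    induction u with
    | nil => intro v e; simp [eq_comm]
    | cons b u ih =>
      intro v e
      rw [List.foldl_cons]
      simp only [Matrix.cons_val_zero, Matrix.cons_val_one]
      rw [ih]
      rcases v with _ | ⟨c, v⟩
      · simp
      · simp only [List.tail_cons, List.head?_cons, Option.some.injEq, List.cons.injEq]
        by_cases h : c = b
        · simp [h]
        · simp [h, Ne.symm h]
  exact ((polyDec_eq_nil (h 0)).and (polyDec_eq_nil (h 1))).congr fun a => by
    rw [key]; simp

theorem polyDec_isUnary {m : ℕ} {f : Input m → Word} (hf : PolyTime f) :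
    PolyDec fun a => f a = unary (f a).length := polyDec_eq hf hf.unary_length

theorem PolyTime.unary_mul {m : ℕ} {f g : Input m → Word} (hf : PolyTime f) (hg : PolyTime g) :
    PolyTime fun a => unary ((f a).length * (g a).length) := by
  obtain ⟨p, hp⟩ := hf.length_le
  obtain ⟨q, hq⟩ := hg.length_le
  have key : ∀ (u : Word) (v e : Word),
      u.foldl (fun (s : Input 2) _ => ![s 0, s 0 ++ s 1]) ![v, e]
        = ![v, (List.replicate u.length v).flatten ++ e] := by
    intro u
    induction u with
    | nil => intro v e; simp
    | cons b u ih =>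
      intro v e
      rw [List.foldl_cons]
      simp only [Matrix.cons_val_zero, Matrix.cons_val_one]
      rw [ih]
      simp only [List.length_cons, List.replicate_succ', List.flatten_append,
        List.flatten_singleton, List.append_assoc]
  have := PolyTime.foldl (m := m) (g := fun _ s => ![s 0, s 0 ++ s 1])
    (init := fun a => ![g a, []])
    (fun b => polyVec_cons (polyTime_proj 0) (polyVec_cons
      ((polyTime_proj 0).append (polyTime_proj 1)) polyVec_nil))
    (polyVec_cons hg (polyVec_cons polyTime_nil polyVec_nil)) hf (q + p * q)
    (fun a u hu => by
      rw [key]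
      simp only [size, Fin.sum_univ_two, Matrix.cons_val_zero, Matrix.cons_val_one,
        List.append_nil, List.length_flatten, List.map_replicate, List.sum_replicate, smul_eq_mul,
        Polynomial.eval_add, Polynomial.eval_mul]
      exact Nat.add_le_add (hq a) (Nat.mul_le_mul (hu.length_le.trans (hp a)) (hq a))) 1
  convert this.unary_length using 2 with a
  rw [key]
  simp

theorem PolyTime.unary_eval {m : ℕ} {f : Input m → Word} (hf : PolyTime f) (p : Polynomial ℕ) :
    PolyTime fun a => unary (p.eval (f a).length) := by
  induction p using Polynomial.induction_on with
  | C c => simpa using polyTime_const (unary c)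
  | add p q hp hq =>
    convert hp.append hq using 2 with a
    simp [unary]
  | monomial n c ih =>
    convert ih.unary_mul hf using 2 with a
    simp [unary, pow_succ, mul_assoc]

/-! ### Arithmetic of natural numbers in binary -/

/-- The number with the given binary digits, least significant digit first. -/
def bitsVal : Word → ℕ
  | [] => 0
  | b :: l => b.toNat + 2 * bitsVal l

theorem bitsVal_bits (n : ℕ) : bitsVal n.bits = n := by
  induction n using Nat.binaryRec' with
  | zero => simp [bitsVal]
  | bit b n h ih => rw [Nat.bits_append_bit n b h, bitsVal, ih, Nat.bit_val]; omega

theorem bitsVal_append (l l' : Word) :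
    bitsVal (l ++ l') = bitsVal l + 2 ^ l.length * bitsVal l' := by
  induction l with
  | nil => simp [bitsVal]
  | cons b l ih => simp only [List.cons_append, bitsVal, ih, List.length_cons]; ring

theorem bitsVal_lt (l : Word) : bitsVal l < 2 ^ l.length := by
  induction l with
  | nil => simp [bitsVal]
  | cons b l ih =>
    simp only [bitsVal, List.length_cons, pow_succ]
    have := b.toNat_le
    omega

theorem bitsVal_head_tail (l : Word) :
    bitsVal l = (if l.head? = some true then 1 else 0) + 2 * bitsVal l.tail := by
  rcases l with _ | ⟨_ | _, l⟩ <;> simp [bitsVal]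

theorem length_bits_le_iff {n k : ℕ} : n.bits.length ≤ k ↔ n < 2 ^ k := by
  rw [Nat.size_eq_bits_len, Nat.size_le]

/-- Remove leading zeros. -/
def trim (l : Word) : Word := l.foldr (fun b s => if b = false ∧ s = [] then [] else b :: s) []

theorem trim_eq (l : Word) : trim l = (bitsVal l).bits := by
  induction l with
  | nil => simp [trim, bitsVal]
  | cons b l ih =>
    change (if b = false ∧ trim l = [] then [] else b :: trim l) = _
    rw [ih, bitsVal]
    by_cases h : bitsVal l = 0
    · rw [h]; cases b <;> simp
    · have h' : b.toNat + 2 * bitsVal l = Nat.bit b (bitsVal l) := by rw [Nat.bit_val]; omega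
      rw [h', Nat.bits_append_bit _ _ (fun h0 => absurd h0 h), if_neg]
      rintro ⟨-, h1⟩
      apply h
      rw [← bitsVal_bits (bitsVal l), h1, bitsVal]

theorem PolyTime.trim {m : ℕ} {f : Input m → Word} (hf : PolyTime f) :
    PolyTime fun a => trim (f a) := by
  refine PolyTime.foldr_word (g := fun b s => if b = false ∧ s = [] then [] else b :: s)
    (fun b => ?_) polyTime_nil hf 1 (fun b s => by split_ifs <;> simp)
  exact PolyTime.ite ((polyDec_const _).and (polyDec_eq_nil (polyTime_proj 0))) polyTime_nil
    ((polyTime_proj 0).cons b)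

/-- A number-valued function is computable in polynomial time, with its value in binary. -/
def PolyNat {m : ℕ} (f : Input m → ℕ) : Prop := PolyTime fun a => (f a).bits

theorem PolyTime.polyNat {m : ℕ} {φ : Input m → Word} (hφ : PolyTime φ) :
    PolyNat fun a => bitsVal (φ a) := by
  have := hφ.trim
  simp only [trim_eq] at this
  exact this

theorem PolyTime.polyNat_of_eq {m : ℕ} {φ : Input m → Word} (hφ : PolyTime φ) {f : Input m → ℕ}
    (h : ∀ a, bitsVal (φ a) = f a) : PolyNat f := by
  have := hφ.polyNat
  simpa only [h] using this

theorem PolyNat.congr {m : ℕ} {f g : Input m → ℕ} (hf : PolyNat f) (h : ∀ a, g a = f a) :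
    PolyNat g := by
  rwa [show g = f from funext h]

theorem polyNat_const {m : ℕ} (n : ℕ) : PolyNat fun _ : Input m => n := polyTime_const _

theorem PolyNat.ite {m : ℕ} {P : Input m → Prop} [DecidablePred P] {f g : Input m → ℕ}
    (hP : PolyDec P) (hf : PolyNat f) (hg : PolyNat g) :
    PolyNat fun a => if P a then f a else g a := by
  have := PolyTime.ite hP hf hg
  unfold PolyNat
  convert this using 2 with a
  by_cases h : P a <;> simp [h]

/-- One step of the addition with carry: the state holds the remaining digits of the summands, the
carry and the digits of the sum found so far, in reverse order. -/
def addStep (s : Input 4) : Input 4 :=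
  ![(s 0).tail, (s 1).tail,
    if ((s 0).head? = some true ∧ (s 1).head? = some true) ∨
      (((s 0).head? = some true ∨ (s 1).head? = some true) ∧ (s 2).head? = some true)
    then [true] else [],
    if ((s 0).head? = some true ↔ ((s 1).head? = some true ↔ (s 2).head? = some true))
    then true :: s 3 else false :: s 3]

/-- One step of the subtraction with borrow, organized like `addStep`. -/
def subStep (s : Input 4) : Input 4 :=
  ![(s 0).tail, (s 1).tail,
    if ((s 1).head? = some true ∧ (s 2).head? = some true) ∨
      (((s 1).head? = some true ∨ (s 2).head? = some true) ∧ ¬ (s 0).head? = some true)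
    then [true] else [],
    if ((s 0).head? = some true ↔ ((s 1).head? = some true ↔ (s 2).head? = some true))
    then true :: s 3 else false :: s 3]

theorem polyVec_addStep : ∀ i, PolyTime fun s => addStep s i := by
  have h0 := polyDec_head (polyTime_proj (m := 4) 0)
  have h1 := polyDec_head (polyTime_proj (m := 4) 1)
  have h2 := polyDec_head (polyTime_proj (m := 4) 2)
  exact polyVec_cons (polyTime_proj 0).tail (polyVec_cons (polyTime_proj 1).tail (polyVec_cons
    (PolyTime.ite ((h0.and h1).or ((h0.or h1).and h2)) (polyTime_const _) polyTime_nil)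
    (polyVec_cons (PolyTime.ite (h0.iff (h1.iff h2)) ((polyTime_proj 3).cons true)
      ((polyTime_proj 3).cons false)) polyVec_nil)))

theorem polyVec_subStep : ∀ i, PolyTime fun s => subStep s i := by
  have h0 := polyDec_head (polyTime_proj (m := 4) 0)
  have h1 := polyDec_head (polyTime_proj (m := 4) 1)
  have h2 := polyDec_head (polyTime_proj (m := 4) 2)
  exact polyVec_cons (polyTime_proj 0).tail (polyVec_cons (polyTime_proj 1).tail (polyVec_cons
    (PolyTime.ite ((h1.and h2).or ((h1.or h2).and h0.not)) (polyTime_const _) polyTime_nil)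
    (polyVec_cons (PolyTime.ite (h0.iff (h1.iff h2)) ((polyTime_proj 3).cons true)
      ((polyTime_proj 3).cons false)) polyVec_nil)))

theorem size_addStep_le (s : Input 4) : size (addStep s) ≤ size s + 2 := by
  simp only [size, Fin.sum_univ_four, addStep, Matrix.cons_val]
  split_ifs <;> simp <;> omega

theorem size_subStep_le (s : Input 4) : size (subStep s) ≤ size s + 2 := by
  simp only [size, Fin.sum_univ_four, subStep, Matrix.cons_val]
  split_ifs <;> simp <;> omega

theorem foldl_const {α : Type*} (f : α → α) (u : Word) (s : α) :
    u.foldl (fun s _ => f s) s = f^[u.length] s := by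
  induction u generalizing s with
  | nil => rfl
  | cons b u ih => rw [List.foldl_cons, ih]; rfl

/-- The quantity preserved by `addStep`. -/
def addInv (s : Input 4) : ℕ :=
  bitsVal (s 3).reverse + 2 ^ (s 3).length *
    ((if (s 2).head? = some true then 1 else 0) + bitsVal (s 0) + bitsVal (s 1))

theorem addInv_addStep (s : Input 4) : addInv (addStep s) = addInv s := by
  simp only [addInv, addStep, Matrix.cons_val]
  rw [bitsVal_head_tail (s 0), bitsVal_head_tail (s 1)]
  by_cases h0 : (s 0).head? = some true <;> by_cases h1 : (s 1).head? = some true <;>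
    by_cases h2 : (s 2).head? = some true <;>
    simp [h0, h1, h2, bitsVal_append, bitsVal] <;> ring

/-- The quantity preserved by `subStep`. -/
def subInv (s : Input 4) : ℤ :=
  bitsVal (s 3).reverse + 2 ^ (s 3).length *
    ((bitsVal (s 0) : ℤ) - bitsVal (s 1) - (if (s 2).head? = some true then 1 else 0))

theorem subInv_subStep (s : Input 4) : subInv (subStep s) = subInv s := by
  simp only [subInv, subStep, Matrix.cons_val]
  rw [bitsVal_head_tail (s 0), bitsVal_head_tail (s 1)]
  by_cases h0 : (s 0).head? = some true <;> by_cases h1 : (s 1).head? = some true <;>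
    by_cases h2 : (s 2).head? = some true <;>
    simp [h0, h1, h2, bitsVal_append, bitsVal] <;> ring

theorem iterate_addStep_zero (k : ℕ) (s : Input 4) :
    (addStep^[k] s) 0 = (s 0).drop k ∧ (addStep^[k] s) 1 = (s 1).drop k := by
  induction k generalizing s with
  | zero => simp
  | succ k ih => rw [Function.iterate_succ_apply]; simp [ih, addStep]

theorem iterate_subStep_zero (k : ℕ) (s : Input 4) :
    (subStep^[k] s) 0 = (s 0).drop k ∧ (subStep^[k] s) 1 = (s 1).drop k := by
  induction k generalizing s with
  | zero => simp
  | succ k ih => rw [Function.iterate_succ_apply]; simp [ih, subStep]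

theorem addInv_iterate (k : ℕ) (s : Input 4) : addInv (addStep^[k] s) = addInv s := by
  induction k generalizing s with
  | zero => rfl
  | succ k ih => rw [Function.iterate_succ_apply, ih, addInv_addStep]

theorem subInv_iterate (k : ℕ) (s : Input 4) : subInv (subStep^[k] s) = subInv s := by
  induction k generalizing s with
  | zero => rfl
  | succ k ih => rw [Function.iterate_succ_apply, ih, subInv_subStep]

theorem PolyNat.add {m : ℕ} {f g : Input m → ℕ} (hf : PolyNat f) (hg : PolyNat g) :
    PolyNat fun a => f a + g a := by
  have h := PolyTime.foldl_of_growth (m := m) (g := fun _ => addStep)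
    (init := fun a => ![(f a).bits, (g a).bits, [], []]) (fun _ => polyVec_addStep)
    (polyVec_cons hf (polyVec_cons hg (polyVec_cons polyTime_nil (polyVec_cons polyTime_nil
      polyVec_nil)))) (PolyTime.append hf hg) 2 (fun _ => size_addStep_le)
  simp only [foldl_const] at h
  -- the pending carry is the leading digit of the sum
  have h' := (h 3).reverse.append (h 2)
  refine h'.polyNat_of_eq fun a => ?_
  set k := ((f a).bits ++ (g a).bits).length with hk
  have e1 := addInv_iterate k ![(f a).bits, (g a).bits, [], []]
  obtain ⟨e2, e3⟩ := iterate_addStep_zero k ![(f a).bits, (g a).bits, [], []]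
  have e4 : ((addStep^[k] ![(f a).bits, (g a).bits, [], []]) 2 = [true]) ∨
      ((addStep^[k] ![(f a).bits, (g a).bits, [], []]) 2 = []) := by
    rcases k with _ | k
    · right; rfl
    · rw [Function.iterate_succ_apply', addStep]
      simp only [Matrix.cons_val]
      split_ifs
      · left; rfl
      · right; rfl
  set s := addStep^[k] ![(f a).bits, (g a).bits, [], []] with hs
  rw [List.length_append] at hk
  have e5 : s 0 = [] := by rw [e2]; simp; omega
  have e6 : s 1 = [] := by rw [e3]; simp; omega
  simp only [addInv, e5, e6] at e1
  simp only [Matrix.cons_val, bitsVal_bits, List.reverse_nil, bitsVal, List.length_nil, pow_zero,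
    List.head?_nil] at e1
  rw [bitsVal_append, List.length_reverse]
  rcases e4 with e4 | e4 <;> rw [e4] at e1 ⊢ <;> simp [bitsVal] at e1 ⊢ <;> omega

/-- Subtraction with borrow decides the order and computes the difference. -/
theorem PolyNat.sub_aux {m : ℕ} {f g : Input m → ℕ} (hf : PolyNat f) (hg : PolyNat g) :
    PolyDec (fun a => f a < g a) ∧ PolyNat fun a => f a - g a := by
  have h := PolyTime.foldl_of_growth (m := m) (g := fun _ => subStep)
    (init := fun a => ![(f a).bits, (g a).bits, [], []]) (fun _ => polyVec_subStep)
    (polyVec_cons hf (polyVec_cons hg (polyVec_cons polyTime_nil (polyVec_cons polyTime_nil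
      polyVec_nil)))) (PolyTime.append hf hg) 2 (fun _ => size_subStep_le)
  simp only [foldl_const] at h
  have key : ∀ a, ∃ s, s = subStep^[((f a).bits ++ (g a).bits).length]
      ![(f a).bits, (g a).bits, [], []] ∧ (bitsVal (s 3).reverse : ℤ) + 2 ^ (s 3).length *
      (- (if (s 2).head? = some true then 1 else 0)) = f a - g a := by
    intro a
    refine ⟨_, rfl, ?_⟩
    set k := ((f a).bits ++ (g a).bits).length with hk
    have e1 := subInv_iterate k ![(f a).bits, (g a).bits, [], []]
    obtain ⟨e2, e3⟩ := iterate_subStep_zero k ![(f a).bits, (g a).bits, [], []]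
    set s := subStep^[k] ![(f a).bits, (g a).bits, [], []] with hs
    rw [List.length_append] at hk
    have e5 : s 0 = [] := by rw [e2]; simp; omega
    have e6 : s 1 = [] := by rw [e3]; simp; omega
    simp only [subInv, e5, e6] at e1
    simp only [Matrix.cons_val, bitsVal_bits, List.reverse_nil, bitsVal, List.length_nil, pow_zero,
      List.head?_nil] at e1
    simpa using e1
  have hlt : ∀ s : Input 4, (bitsVal (s 3).reverse : ℤ) < 2 ^ (s 3).length := fun s => by
    have := bitsVal_lt (s 3).reverse
    rw [List.length_reverse] at this
    exact_mod_cast this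
  refine ⟨(polyDec_head (h 2)).congr fun a => ?_,
    (PolyNat.ite (polyDec_head (h 2)) (polyNat_const 0) (h 3).reverse.polyNat).congr fun a => ?_⟩
  · obtain ⟨s, hs, e⟩ := key a
    rw [← hs]
    have := hlt s
    split_ifs at e with hc
    · simp only [hc, iff_true]; omega
    · simp only [hc, iff_false]; omega
  · obtain ⟨s, hs, e⟩ := key a
    rw [← hs]
    have := hlt s
    split_ifs at e ⊢ with hc
    · omega
    · omega

theorem PolyNat.sub {m : ℕ} {f g : Input m → ℕ} (hf : PolyNat f) (hg : PolyNat g) :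
    PolyNat fun a => f a - g a := (hf.sub_aux hg).2

theorem PolyNat.lt {m : ℕ} {f g : Input m → ℕ} (hf : PolyNat f) (hg : PolyNat g) :
    PolyDec fun a => f a < g a := (hf.sub_aux hg).1

theorem PolyNat.le {m : ℕ} {f g : Input m → ℕ} (hf : PolyNat f) (hg : PolyNat g) :
    PolyDec fun a => f a ≤ g a :=
  (hg.lt hf).not.congr fun a => by rw [not_lt]

theorem PolyNat.add_bit {m : ℕ} {f : Input m → ℕ} (hf : PolyNat f) (b : Bool) :
    PolyNat fun a => b.toNat + 2 * f a :=
  (PolyTime.cons b hf).polyNat_of_eq fun a => by simp [bitsVal, bitsVal_bits]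

theorem size_vec_two (x y : Word) : size ![x, y] = x.length + y.length := by
  simp [size, Fin.sum_univ_two]

theorem size_vec_three (x y z : Word) : size ![x, y, z] = x.length + y.length + z.length := by
  simp [size, Fin.sum_univ_three]

theorem PolyNat.mul {m : ℕ} {f g : Input m → ℕ} (hf : PolyNat f) (hg : PolyNat g) :
    PolyNat fun a => f a * g a := by
  -- Horner's rule for the digits of `g a`; the state holds `f a` and the partial result
  set G : Bool → Input 2 → Input 2 := fun b s =>
    ![s 0, ((false.toNat + 2 * bitsVal (s 1)) + if b then bitsVal (s 0) else 0).bits] with hG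
  have hGp : ∀ b i, PolyTime fun s => G b s i := by
    intro b
    refine polyVec_cons (polyTime_proj 0) (polyVec_cons ?_ polyVec_nil)
    refine PolyNat.add ((polyTime_proj 1).polyNat.add_bit false) ?_
    exact PolyNat.ite (polyDec_const _) (polyTime_proj 0).polyNat (polyNat_const 0)
  have key : ∀ (x : ℕ) (u : Word), u.foldr (fun b s => G b s) ![x.bits, []]
      = ![x.bits, (x * bitsVal u).bits] := by
    intro x u
    induction u with
    | nil => simp [bitsVal]
    | cons b u ih =>
      rw [List.foldr_cons, ih]
      simp only [hG, Matrix.cons_val, bitsVal_bits, bitsVal]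
      congr 3
      cases b <;> simp <;> ring
  have h := PolyTime.foldl (m := m) hGp (init := fun a => ![(f a).bits, []])
    (w := fun a => (g a).bits.reverse)
    (polyVec_cons hf (polyVec_cons polyTime_nil polyVec_nil)) (PolyTime.reverse hg)
  obtain ⟨p, hp⟩ := PolyTime.length_le hf
  obtain ⟨q, hq⟩ := PolyTime.length_le hg
  have h' := h (2 * p + q) (fun a u hu => by
    rw [← List.reverse_reverse u, List.foldl_reverse, key]
    rw [size_vec_two]
    have h1 : (f a * bitsVal u.reverse).bits.length ≤ (f a).bits.length + u.length := by
      rw [length_bits_le_iff, pow_add]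
      have h2 : f a < 2 ^ (f a).bits.length := length_bits_le_iff.1 le_rfl
      have h3 := bitsVal_lt u.reverse
      rw [List.length_reverse] at h3
      exact Nat.mul_lt_mul'' h2 h3
    have h2 := hu.length_le
    rw [List.length_reverse] at h2
    have h3 := hp a
    have h4 := hq a
    simp only [Polynomial.eval_add, Polynomial.eval_mul, Polynomial.eval_ofNat]
    omega) 1
  refine h'.polyNat_of_eq fun a => ?_
  rw [List.foldl_reverse, key]
  simp [bitsVal_bits]

theorem PolyNat.div {m : ℕ} {f g : Input m → ℕ} (hf : PolyNat f) (hg : PolyNat g) :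
    PolyNat fun a => f a / g a := by
  -- long division; the state holds the divisor, the remainder and the quotient found so far
  set G : Bool → Input 3 → Input 3 := fun b s =>
    ![s 0,
      (if bitsVal (s 0) ≤ b.toNat + 2 * bitsVal (s 1)
        then b.toNat + 2 * bitsVal (s 1) - bitsVal (s 0) else b.toNat + 2 * bitsVal (s 1)).bits,
      if bitsVal (s 0) ≤ b.toNat + 2 * bitsVal (s 1) then true :: s 2 else false :: s 2] with hG
  have hGp : ∀ b i, PolyTime fun s => G b s i := by
    intro b
    have h0 := (polyTime_proj (m := 3) 0).polyNat
    have h1 := (polyTime_proj (m := 3) 1).polyNat.add_bit b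
    exact polyVec_cons (polyTime_proj 0) (polyVec_cons (PolyNat.ite (h0.le h1) (h1.sub h0) h1)
      (polyVec_cons (PolyTime.ite (h0.le h1) ((polyTime_proj 2).cons true)
        ((polyTime_proj 2).cons false)) polyVec_nil))
  have key : ∀ (d : ℕ), 0 < d → ∀ u : Word, ∃ (r : ℕ) (v : Word),
      u.foldr (fun b s => G b s) ![d.bits, [], []] = ![d.bits, r.bits, v] ∧
      r < d ∧ v.length = u.length ∧ bitsVal u = d * bitsVal v + r := by
    intro d hd u
    induction u with
    | nil => exact ⟨0, [], by simp, hd, rfl, by simp [bitsVal]⟩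
    | cons b u ih =>
      obtain ⟨r, v, h1, h2, h3, h4⟩ := ih
      rw [List.foldr_cons, h1]
      simp only [hG, Matrix.cons_val, bitsVal_bits, bitsVal]
      have hb := b.toNat_le
      by_cases h : d ≤ b.toNat + 2 * r
      · refine ⟨b.toNat + 2 * r - d, true :: v, by simp [h], by omega, by simp [h3], ?_⟩
        simp only [bitsVal, Bool.toNat_true, mul_add, mul_one]
        rw [h4, mul_left_comm d]; omega
      · refine ⟨b.toNat + 2 * r, false :: v, by simp [h], by omega, by simp [h3], ?_⟩
        simp only [bitsVal, Bool.toNat_false]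
        rw [h4, zero_add, mul_left_comm d]; omega
  -- division by zero is replaced by division by one
  set d : Input m → ℕ := fun a => if g a ≤ 0 then 1 else g a with hd
  have hdp : PolyNat d := PolyNat.ite (hg.le (polyNat_const 0)) (polyNat_const 1) hg
  have hd0 : ∀ a, 0 < d a := fun a => by simp only [hd]; split_ifs <;> omega
  have h := PolyTime.foldl (m := m) hGp (init := fun a => ![(d a).bits, [], []])
    (w := fun a => (f a).bits.reverse)
    (polyVec_cons hdp (polyVec_cons polyTime_nil (polyVec_cons polyTime_nil polyVec_nil)))
    (PolyTime.reverse hf)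
  obtain ⟨p, hp⟩ := PolyTime.length_le hf
  obtain ⟨q, hq⟩ := PolyTime.length_le hdp
  have h' := h (2 * q + p) (fun a u hu => by
    rw [← List.reverse_reverse u, List.foldl_reverse]
    obtain ⟨r, v, h1, h2, h3, h4⟩ := key (d a) (hd0 a) u.reverse
    rw [h1]
    rw [size_vec_three]
    have h5 : r.bits.length ≤ (d a).bits.length := by
      rw [length_bits_le_iff]
      exact h2.trans (length_bits_le_iff.1 le_rfl)
    have h6 := hu.length_le
    rw [List.length_reverse] at h6 h3
    have h7 := hp a
    have h8 := hq a
    simp only [Polynomial.eval_add, Polynomial.eval_mul, Polynomial.eval_ofNat]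
    omega) 2
  refine (PolyNat.ite (hg.le (polyNat_const 0)) (polyNat_const 0) h'.polyNat).congr fun a => ?_
  split_ifs with h0
  · rw [Nat.le_zero.1 h0, Nat.div_zero]
  · rw [List.foldl_reverse]
    obtain ⟨r, v, h1, h2, h3, h4⟩ := key (d a) (hd0 a) (f a).bits
    rw [h1]
    have hda : d a = g a := if_neg h0
    rw [bitsVal_bits] at h4
    simp only [Matrix.cons_val]
    rw [h4, hda, Nat.mul_add_div (by omega), Nat.div_eq_of_lt (hda ▸ h2), add_zero]

/-! ### Arithmetic of integers and fractions -/

/-- An integer-valued function is the difference of two number-valued functions computable in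
polynomial time. -/
def PolyInt {m : ℕ} (f : Input m → ℤ) : Prop :=
  ∃ p n : Input m → ℕ, PolyNat p ∧ PolyNat n ∧ ∀ a, f a = p a - n a

theorem PolyInt.congr {m : ℕ} {f g : Input m → ℤ} (hf : PolyInt f) (h : ∀ a, g a = f a) :
    PolyInt g := by
  rwa [show g = f from funext h]

theorem PolyNat.polyInt {m : ℕ} {f : Input m → ℕ} (hf : PolyNat f) :
    PolyInt fun a => (f a : ℤ) :=
  ⟨f, fun _ => 0, hf, polyNat_const 0, by simp⟩

theorem PolyInt.neg {m : ℕ} {f : Input m → ℤ} (hf : PolyInt f) : PolyInt fun a => - f a := by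
  obtain ⟨p, n, hp, hn, h⟩ := hf
  exact ⟨n, p, hn, hp, fun a => by simp only [h]; ring⟩

theorem PolyInt.add {m : ℕ} {f g : Input m → ℤ} (hf : PolyInt f) (hg : PolyInt g) :
    PolyInt fun a => f a + g a := by
  obtain ⟨p, n, hp, hn, h⟩ := hf
  obtain ⟨p', n', hp', hn', h'⟩ := hg
  exact ⟨_, _, hp.add hp', hn.add hn', fun a => by simp only [h, h']; push_cast; ring⟩

theorem PolyInt.mul {m : ℕ} {f g : Input m → ℤ} (hf : PolyInt f) (hg : PolyInt g) :
    PolyInt fun a => f a * g a := by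
  obtain ⟨p, n, hp, hn, h⟩ := hf
  obtain ⟨p', n', hp', hn', h'⟩ := hg
  exact ⟨_, _, (hp.mul hp').add (hn.mul hn'), (hp.mul hn').add (hn.mul hp'),
    fun a => by simp only [h, h']; push_cast; ring⟩

theorem polyInt_const {m : ℕ} (n : ℤ) : PolyInt fun _ : Input m => n :=
  ⟨fun _ => n.toNat, fun _ => (-n).toNat, polyNat_const _, polyNat_const _,
    fun _ => by simp only; omega⟩

theorem PolyInt.ite {m : ℕ} {P : Input m → Prop} [DecidablePred P] {f g : Input m → ℤ}
    (hP : PolyDec P) (hf : PolyInt f) (hg : PolyInt g) :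
    PolyInt fun a => if P a then f a else g a := by
  obtain ⟨p, n, hp, hn, h⟩ := hf
  obtain ⟨p', n', hp', hn', h'⟩ := hg
  refine ⟨_, _, PolyNat.ite hP hp hp', PolyNat.ite hP hn hn', fun a => ?_⟩
  by_cases hPa : P a <;> simp [hPa, h, h']

theorem PolyInt.le {m : ℕ} {f g : Input m → ℤ} (hf : PolyInt f) (hg : PolyInt g) :
    PolyDec fun a => f a ≤ g a := by
  obtain ⟨p, n, hp, hn, h⟩ := hf
  obtain ⟨p', n', hp', hn', h'⟩ := hg
  exact ((hp.add hn').le (hp'.add hn)).congr fun a => by rw [h, h']; omega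

theorem PolyInt.lt {m : ℕ} {f g : Input m → ℤ} (hf : PolyInt f) (hg : PolyInt g) :
    PolyDec fun a => f a < g a :=
  (hg.le hf).not.congr fun a => by rw [not_le]

theorem PolyInt.natAbs {m : ℕ} {f : Input m → ℤ} (hf : PolyInt f) :
    PolyNat fun a => (f a).natAbs := by
  obtain ⟨p, n, hp, hn, h⟩ := hf
  exact ((hp.sub hn).add (hn.sub hp)).congr fun a => by rw [h]; omega

theorem PolyInt.toNat {m : ℕ} {f : Input m → ℤ} (hf : PolyInt f) :
    PolyNat fun a => (f a).toNat := by
  obtain ⟨p, n, hp, hn, h⟩ := hf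
  exact (hp.sub hn).congr fun a => by rw [h]; omega

/-- Self-delimiting code of a word: every letter is preceded by `true`, the end is marked by
`false`. -/
def flag (l : Word) : Word := (l.flatMap fun b => [true, b]) ++ [false]

theorem length_flag (l : Word) : (flag l).length = 2 * l.length + 1 := by
  induction l with
  | nil => rfl
  | cons b l ih =>
    simp only [flag, List.flatMap_cons, List.append_assoc, List.length_append] at ih ⊢
    simp only [List.length_cons, List.length_nil] at ih ⊢
    omega

theorem PolyTime.flag {m : ℕ} {f : Input m → Word} (hf : PolyTime f) :
    PolyTime fun a => flag (f a) := by
  have := PolyTime.foldr_word (g := fun b s => true :: b :: s)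
    (fun b => ((polyTime_proj 0).cons b).cons true) (polyTime_const [false]) hf 2
    (fun b s => by simp)
  convert this using 2 with a
  induction f a with
  | nil => rfl
  | cons b l ih => rw [List.foldr_cons, ← ih]; rfl

/-- One step of the decoding of a self-delimiting code. The first component of the state tells what
comes next (`true`: a flag, `false`: a letter, empty: the remainder), the others hold the letters
and the remainder read so far, in reverse order. -/
def unflagStep (b : Bool) (s : Input 3) : Input 3 :=
  ![headCases (s 0) (if b then [false] else []) [true] [],
    headCases (s 0) (s 1) (b :: s 1) (s 1),
    headCases (s 0) (s 2) (s 2) (b :: s 2)]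

/-- The word at the beginning of `w`, given by its self-delimiting code. -/
def unflagFst (w : Word) : Word := (w.foldl (fun s b => unflagStep b s) ![[true], [], []] 1).reverse

/-- The part of `w` that follows a self-delimiting code. -/
def unflagSnd (w : Word) : Word := (w.foldl (fun s b => unflagStep b s) ![[true], [], []] 2).reverse

theorem foldl_unflagStep_nil (r x y : Word) :
    r.foldl (fun s b => unflagStep b s) ![[], x, y] = ![[], x, r.reverse ++ y] := by
  induction r generalizing y with
  | nil => simp
  | cons b r ih =>
    rw [List.foldl_cons]
    have : unflagStep b ![[], x, y] = ![[], x, b :: y] := by simp [unflagStep, headCases]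
    rw [this, ih]; simp

theorem foldl_unflagStep_flag (l r x : Word) :
    (flag l ++ r).foldl (fun s b => unflagStep b s) ![[true], x, []]
      = ![[], l.reverse ++ x, r.reverse] := by
  induction l generalizing x with
  | nil =>
    have : unflagStep false ![[true], x, []] = ![[], x, []] := by simp [unflagStep, headCases]
    simp only [flag, List.flatMap_nil, List.nil_append, List.cons_append, List.foldl_cons, this,
      foldl_unflagStep_nil, List.append_nil, List.reverse_nil]
  | cons b l ih =>
    have h1 : flag (b :: l) ++ r = true :: b :: (flag l ++ r) := rfl
    have h2 : unflagStep true ![[true], x, []] = ![[false], x, []] := by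
      simp [unflagStep, headCases]
    have h3 : unflagStep b ![[false], x, []] = ![[true], b :: x, []] := by
      simp [unflagStep, headCases]
    rw [h1, List.foldl_cons, List.foldl_cons, h2, h3, ih]
    simp

theorem unflagFst_flag (l r : Word) : unflagFst (flag l ++ r) = l := by
  rw [unflagFst, foldl_unflagStep_flag]; simp

theorem unflagSnd_flag (l r : Word) : unflagSnd (flag l ++ r) = r := by
  rw [unflagSnd, foldl_unflagStep_flag]; simp

theorem length_unflagSnd_le (w : Word) : (unflagSnd w).length ≤ w.length := by
  have key : ∀ (w : Word) (s : Input 3),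
      (w.foldl (fun s b => unflagStep b s) s 2).length ≤ (s 2).length + w.length := by
    intro w
    induction w with
    | nil => intro s; simp
    | cons b w ih =>
      intro s
      refine (ih (unflagStep b s)).trans ?_
      have : (unflagStep b s 2).length ≤ (s 2).length + 1 := by
        simp only [unflagStep, Matrix.cons_val]
        rcases s 0 with _ | ⟨_ | _, l⟩ <;> simp [headCases]
      simp only [List.length_cons]; omega
  simpa [unflagSnd] using key w ![[true], [], []]

theorem PolyTime.foldl_unflagStep {m : ℕ} {f : Input m → Word} (hf : PolyTime f) (j : Fin 3) :
    PolyTime fun a => (f a).foldl (fun s b => unflagStep b s) ![[true], [], []] j := by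
  refine PolyTime.foldl_of_growth (init := fun _ => ![[true], [], []]) (fun b => ?_)
    (polyVec_cons (polyTime_const _) (polyVec_cons polyTime_nil
    (polyVec_cons polyTime_nil polyVec_nil))) hf 3 (fun b s => ?_) j
  · have h0 := polyTime_proj (m := 3) 0
    have h1 := polyTime_proj (m := 3) 1
    have h2 := polyTime_proj (m := 3) 2
    exact polyVec_cons (h0.headCases (polyTime_const _) (polyTime_const _) polyTime_nil)
      (polyVec_cons (h0.headCases h1 (h1.cons b) h1) (polyVec_cons (h0.headCases h2 h2 (h2.cons b))
      polyVec_nil))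
  · simp only [size, Fin.sum_univ_three, unflagStep, Matrix.cons_val]
    rcases s 0 with _ | ⟨_ | _, l⟩ <;> cases b <;> simp [NearOptBilevel.headCases] <;> omega

theorem PolyTime.unflagFst {m : ℕ} {f : Input m → Word} (hf : PolyTime f) :
    PolyTime fun a => unflagFst (f a) := (hf.foldl_unflagStep 1).reverse

theorem PolyTime.unflagSnd {m : ℕ} {f : Input m → Word} (hf : PolyTime f) :
    PolyTime fun a => unflagSnd (f a) := (hf.foldl_unflagStep 2).reverse

theorem encNat_eq_flag (n : ℕ) : encNat n = flag n.bits := rfl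

/-- The fraction whose code is at the beginning of `w` (some fraction if there is none). -/
def decFrac (w : Word) : Frac :=
  (if w.head? = some true then -(bitsVal (unflagFst w.tail) : ℤ) else bitsVal (unflagFst w.tail),
    ⟨max 1 (bitsVal (unflagFst (unflagSnd w.tail))), by omega⟩)

/-- The part of `w` that follows the code of a fraction. -/
def restFrac (w : Word) : Word := unflagSnd (unflagSnd w.tail)

theorem decFrac_encFrac_append (r : Frac) (l : Word) : decFrac (encFrac r ++ l) = r := by
  obtain ⟨n, d⟩ := r
  simp only [decFrac, encFrac, encNat_eq_flag, List.cons_append, List.append_assoc, List.tail_cons,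
    List.head?_cons, unflagFst_flag, unflagSnd_flag, bitsVal_bits, Option.some.injEq,
    decide_eq_true_eq]
  refine Prod.ext ?_ ?_
  · simp only; split_ifs <;> omega
  · have := d.pos
    exact PNat.eq (by simp only [PNat.mk_coe]; omega)

theorem decFrac_encFrac (r : Frac) : decFrac (encFrac r) = r := by
  simpa using decFrac_encFrac_append r []

theorem restFrac_encFrac_append (r : Frac) (l : Word) : restFrac (encFrac r ++ l) = l := by
  obtain ⟨n, d⟩ := r
  simp only [restFrac, encFrac, encNat_eq_flag, List.cons_append, List.append_assoc, List.tail_cons,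
    unflagSnd_flag]

theorem encFrac_injective : Function.Injective encFrac := fun r s h => by
  rw [← decFrac_encFrac r, h, decFrac_encFrac]

theorem encVec_succ {n : ℕ} (x : Fin (n + 1) → Frac) :
    encVec x = encFrac (x 0) ++ encVec (fun i => x i.succ) := by
  simp [encVec, List.ofFn_succ]

theorem encVec_zero (x : Fin 0 → Frac) : encVec x = [] := by simp [encVec]

theorem encVec_injective {n : ℕ} : Function.Injective (encVec (n := n)) := by
  induction n with
  | zero => intro x y _; exact Subsingleton.elim _ _
  | succ n ih =>
    intro x y h
    rw [encVec_succ, encVec_succ] at h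
    have h0 : x 0 = y 0 := by
      rw [← decFrac_encFrac_append (x 0) (encVec fun i => x i.succ), h, decFrac_encFrac_append]
    have h1 : encVec (fun i => x i.succ) = encVec (fun i => y i.succ) := by
      rw [← restFrac_encFrac_append (x 0) (encVec fun i => x i.succ), h, restFrac_encFrac_append]
    have h2 := ih h1
    funext i
    refine Fin.cases h0 (fun j => congrFun h2 j) i

/-- A function with values in the fractions is computable in polynomial time. -/
structure PolyFrac {m : ℕ} (f : Input m → Frac) : Prop where
  num : PolyInt fun a => (f a).1
  den : PolyNat fun a => ((f a).2 : ℕ)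

theorem PolyFrac.polyTime {m : ℕ} {f : Input m → Frac} (hf : PolyFrac f) :
    PolyTime fun a => encFrac (f a) := by
  have h := PolyTime.append (PolyTime.flag hf.num.natAbs) (PolyTime.flag hf.den)
  have := PolyTime.ite (hf.num.lt (polyInt_const 0)) (h.cons true) (h.cons false)
  convert this using 2 with a
  by_cases h : (f a).1 < 0 <;> simp [encFrac, h, encNat_eq_flag]

theorem PolyTime.decFrac {m : ℕ} {f : Input m → Word} (hf : PolyTime f) :
    PolyFrac fun a => decFrac (f a) where
  num := by
    have := hf.tail.unflagFst.polyNat.polyInt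
    exact PolyInt.ite (polyDec_head hf) this.neg this
  den := by
    have := hf.tail.unflagSnd.unflagFst.polyNat
    refine (PolyNat.ite (this.le (polyNat_const 1)) (polyNat_const 1) this).congr fun a => ?_
    simp only [NearOptBilevel.decFrac, PNat.mk_coe]
    split_ifs <;> omega

theorem PolyTime.restFrac {m : ℕ} {f : Input m → Word} (hf : PolyTime f) :
    PolyTime fun a => restFrac (f a) := hf.tail.unflagSnd.unflagSnd

theorem PolyFrac.ite {m : ℕ} {P : Input m → Prop} [DecidablePred P] {f g : Input m → Frac}
    (hP : PolyDec P) (hf : PolyFrac f) (hg : PolyFrac g) :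
    PolyFrac fun a => if P a then f a else g a where
  num := (PolyInt.ite hP hf.num hg.num).congr fun a => by by_cases h : P a <;> simp [h]
  den := (PolyNat.ite hP hf.den hg.den).congr fun a => by by_cases h : P a <;> simp [h]

theorem polyDec_isFrac {m : ℕ} {f : Input m → Word} (hf : PolyTime f) :
    PolyDec fun a => ∃ r, f a = encFrac r :=
  (polyDec_eq hf hf.decFrac.polyTime).congr fun a =>
    ⟨by rintro ⟨r, hr⟩; rw [hr, decFrac_encFrac], fun h => ⟨_, h⟩⟩

theorem Frac.den_pos (r : Frac) : (0 : ℝ) < ((r.2 : ℕ) : ℝ) := by exact_mod_cast r.2.pos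

/-- Sum of fractions. -/
def Frac.add (r s : Frac) : Frac := (r.1 * (s.2 : ℕ) + s.1 * (r.2 : ℕ), r.2 * s.2)

/-- Product of fractions. -/
def Frac.mul (r s : Frac) : Frac := (r.1 * s.1, r.2 * s.2)

/-- Negative of a fraction. -/
def Frac.neg (r : Frac) : Frac := (-r.1, r.2)

/-- An integer as a fraction. -/
def Frac.ofInt (n : ℤ) : Frac := (n, 1)

@[simp] theorem Frac.val_add (r s : Frac) : (r.add s).val = r.val + s.val := by
  have := r.den_pos.ne'
  have := s.den_pos.ne'
  simp only [Frac.val, Frac.add, PNat.mul_coe]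
  push_cast
  field_simp

@[simp] theorem Frac.val_mul (r s : Frac) : (r.mul s).val = r.val * s.val := by
  simp only [Frac.val, Frac.mul, PNat.mul_coe]
  push_cast
  rw [div_mul_div_comm]

@[simp] theorem Frac.val_neg (r : Frac) : r.neg.val = - r.val := by
  simp only [Frac.val, Frac.neg]
  push_cast
  rw [neg_div]

@[simp] theorem Frac.val_ofInt (n : ℤ) : (Frac.ofInt n).val = n := by
  simp [Frac.val, Frac.ofInt]

theorem Frac.val_le_iff (r s : Frac) : r.val ≤ s.val ↔ r.1 * (s.2 : ℕ) ≤ s.1 * (r.2 : ℕ) := by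
  rw [Frac.val, Frac.val, div_le_div_iff₀ r.den_pos s.den_pos]
  exact_mod_cast Iff.rfl

theorem PolyFrac.add {m : ℕ} {f g : Input m → Frac} (hf : PolyFrac f) (hg : PolyFrac g) :
    PolyFrac fun a => (f a).add (g a) where
  num := (hf.num.mul hg.den.polyInt).add (hg.num.mul hf.den.polyInt)
  den := (hf.den.mul hg.den).congr fun a => by simp [Frac.add]

theorem PolyFrac.mul {m : ℕ} {f g : Input m → Frac} (hf : PolyFrac f) (hg : PolyFrac g) :
    PolyFrac fun a => (f a).mul (g a) where
  num := hf.num.mul hg.num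
  den := (hf.den.mul hg.den).congr fun a => by simp [Frac.mul]

theorem PolyFrac.neg {m : ℕ} {f : Input m → Frac} (hf : PolyFrac f) :
    PolyFrac fun a => (f a).neg where
  num := hf.num.neg
  den := hf.den

theorem PolyInt.ofInt {m : ℕ} {f : Input m → ℤ} (hf : PolyInt f) :
    PolyFrac fun a => Frac.ofInt (f a) where
  num := hf
  den := polyNat_const 1

theorem PolyFrac.le {m : ℕ} {f g : Input m → Frac} (hf : PolyFrac f) (hg : PolyFrac g) :
    PolyDec fun a => (f a).val ≤ (g a).val :=
  ((hf.num.mul hg.den.polyInt).le (hg.num.mul hf.den.polyInt)).congr fun _ => Frac.val_le_iff _ _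

/-! ### The adversarial problems and the verification problem -/

/-- The code of the zero vector with as many entries as the vector with code `w`. -/
def zeroVec (w : Word) : Word :=
  w.foldl (fun (s : Input 2) _ => ![if s 0 = [] then [] else restFrac (s 0),
    if s 0 = [] then s 1 else s 1 ++ encFrac (0, 1)]) ![w, []] 1

theorem PolyTime.zeroVec {m : ℕ} {f : Input m → Word} (hf : PolyTime f) :
    PolyTime fun a => zeroVec (f a) := by
  have h0 := polyTime_proj (m := 2) 0
  have h1 := polyTime_proj (m := 2) 1
  refine PolyTime.foldl_of_growth (init := fun a => ![f a, []]) (fun b => ?_)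
    (polyVec_cons hf (polyVec_cons polyTime_nil polyVec_nil)) hf (encFrac (0, 1)).length
    (fun b s => ?_) 1
  · exact polyVec_cons (PolyTime.ite (polyDec_eq_nil h0) polyTime_nil h0.restFrac)
      (polyVec_cons (PolyTime.ite (polyDec_eq_nil h0) h1 (h1.append (polyTime_const _)))
        polyVec_nil)
  · have h2 : (NearOptBilevel.restFrac (s 0)).length ≤ (s 0).length := by
      refine (length_unflagSnd_le _).trans ((length_unflagSnd_le _).trans ?_)
      simp
    rw [size_vec_two]
    have h3 : size s = (s 0).length + (s 1).length := by simp [size, Fin.sum_univ_two]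
    rw [h3]
    split_ifs
    · simp only [List.length_nil]; omega
    · rw [List.length_append]; omega

theorem length_le_length_encVec {n : ℕ} (x : Fin n → Frac) : n ≤ (encVec x).length := by
  induction n with
  | zero => simp
  | succ n ih =>
    rw [encVec_succ, List.length_append]
    have := ih fun i => x i.succ
    have : 1 ≤ (encFrac (x 0)).length := by simp [encFrac]
    omega

theorem zeroVec_encVec {n : ℕ} (x : Fin n → Frac) :
    zeroVec (encVec x) = encVec fun _ : Fin n => ((0, 1) : Frac) := by
  set g : Input 2 → Input 2 := fun s => ![if s 0 = [] then [] else restFrac (s 0),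
    if s 0 = [] then s 1 else s 1 ++ encFrac (0, 1)] with hg
  have key : ∀ (k n : ℕ) (x : Fin n → Frac) (e : Word), n ≤ k →
      (g^[k] ![encVec x, e]) 1 = e ++ encVec fun _ : Fin n => ((0, 1) : Frac) := by
    intro k
    induction k with
    | zero =>
      intro n x e hn
      obtain rfl : n = 0 := by omega
      simp [encVec_zero]
    | succ k ih =>
      intro n x e hn
      rw [Function.iterate_succ_apply]
      rcases n with _ | n
      · have : g ![encVec x, e] = ![encVec x, e] := by simp [hg, encVec_zero]
        rw [this, ih 0 x e (by omega)]
      · have h1 : encVec x ≠ [] := by rw [encVec_succ]; simp [encFrac]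
        have : g ![encVec x, e] = ![encVec fun i => x i.succ, e ++ encFrac (0, 1)] := by
          simp [hg, encVec_succ x, restFrac_encFrac_append]
          intro h; simp [encFrac] at h
        rw [this, ih n _ _ (by omega), encVec_succ, List.append_assoc]
  have h := key (encVec x).length n x [] (length_le_length_encVec x)
  rw [← foldl_const g] at h
  exact h

/-- Change the sign of a fraction given by its code. The code of `0`, in which the sign bit must not
be set, stays as it is. On all words this is an involution, so that only codes of fractions are
mapped to codes of fractions. -/
def negWord (w : Word) : Word :=
  match w with
  | b :: true :: l => (!b) :: true :: l
  | w => w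

theorem negWord_negWord (w : Word) : negWord (negWord w) = w := by
  rcases w with _ | ⟨b, _ | ⟨_ | _, l⟩⟩ <;> simp [negWord]

theorem PolyTime.negWord {m : ℕ} {f : Input m → Word} (hf : PolyTime f) :
    PolyTime fun a => negWord (f a) := by
  convert PolyTime.ite (polyDec_head hf.tail)
    (hf.headCases (hf.tail.cons false) (hf.tail.cons true) hf) hf using 2 with a
  rcases f a with _ | ⟨_ | _, _ | ⟨_ | _, l⟩⟩ <;>
    simp [NearOptBilevel.negWord, NearOptBilevel.headCases]

theorem negWord_encFrac (r : Frac) : negWord (encFrac r) = encFrac r.neg := by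
  obtain ⟨n, d⟩ := r
  simp only [encFrac, Frac.neg, Int.natAbs_neg]
  by_cases h : n = 0
  · subst h; simp [encNat, negWord]
  · obtain ⟨b, l, hl⟩ : ∃ b l, n.natAbs.bits = b :: l := by
      rcases h' : n.natAbs.bits with _ | ⟨b, l⟩
      · have := bitsVal_bits n.natAbs
        rw [h', bitsVal] at this
        omega
      · exact ⟨b, l, rfl⟩
    simp only [encNat, hl, List.flatMap_cons, List.cons_append, negWord]
    congr 1
    rw [← decide_not]
    refine decide_eq_decide.2 ?_
    omega

theorem negWord_eq_encFrac {w : Word} {r : Frac} (h : negWord w = encFrac r) :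
    w = encFrac r.neg := by
  rw [← negWord_negWord w, h, negWord_encFrac]

theorem polyVec_two {m : ℕ} {f g : Input m → Word} (hf : PolyTime f) (hg : PolyTime g) :
    ∀ i, PolyTime fun a => (![f a, g a] : Input 2) i :=
  polyVec_cons hf (polyVec_cons hg polyVec_nil)

theorem polyVec_three {m : ℕ} {f g h : Input m → Word} (hf : PolyTime f) (hg : PolyTime g)
    (hh : PolyTime h) : ∀ i, PolyTime fun a => (![f a, g a, h a] : Input 3) i :=
  polyVec_cons hf (polyVec_two hg hh)

theorem polyDec_mem {m n : ℕ} {L : Set (Input n)} (hL : L ∈ ClassP n) {ψ : Input m → Input n}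
    (hψ : ∀ i, PolyTime fun a => ψ a i) : PolyDec fun a => ψ a ∈ L := by
  obtain ⟨φ, hφ, h⟩ := hL
  exact ⟨_, hφ.of_vec hψ, fun a => h (ψ a)⟩

namespace BilevelProblem

variable {B : BilevelProblem}

/-- Maximizing `G k (x, ·)` over the near-optimal set is the same as minimizing `- G k (x, ·)` over
the lower-level feasible set in epigraph form, with the additional constraint `u ≤ f (x, v) + δ`. -/
theorem adversarialDecision_mem_classP {H : B.FunctionClass} (hB : B.PolyPresented)
    (hG : B.NegUpperIn H) {rel : ℝ → ℝ → Prop} (hrel : ∀ r s, rel (-r) (-s) ↔ rel s r)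
    (hstar : B.lowerStarDecision H rel ∈ ClassP 7) : B.adversarialDecision rel ∈ ClassP 5 := by
  obtain ⟨φδ, hδp, hδ⟩ := hB.delta_comp
  obtain ⟨φf, hfp, hf⟩ := hB.f_comp
  obtain ⟨φH, hHp, hH⟩ := hG
  have p0 := polyTime_proj (m := 5) 0
  have p1 := polyTime_proj (m := 5) 1
  have p2 := polyTime_proj (m := 5) 2
  have p3 := polyTime_proj (m := 5) 3
  have p4 := polyTime_proj (m := 5) 4
  have hmu := hB.mu_comp.of_vec (ψ := fun a : Input 5 => ![a 0]) (polyVec_cons p0 polyVec_nil)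
  have d1 := polyDec_mem hB.feasible_dec
    (ψ := fun a : Input 5 => ![a 0, a 1, a 2]) (polyVec_three p0 p1 p2)
  have d3 := polyDec_length_le (p3.cons true) hmu
  have hc := (hfp.of_vec (ψ := fun a : Input 5 => ![a 0, a 1, a 2])
    (polyVec_three p0 p1 p2)).decFrac.add (hδp.of_vec (ψ := fun a : Input 5 => ![a 0])
    (polyVec_cons p0 polyVec_nil)).decFrac
  have hh := hHp.of_vec (ψ := fun a : Input 5 => ![a 0, a 1, a 3]) (polyVec_three p0 p1 p3)
  have d4 := polyDec_mem hstar (ψ := fun a : Input 5 =>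
    ![a 0, a 1, zeroVec (a 2), encFrac (1, 1),
      encFrac ((decFrac (φf ![a 0, a 1, a 2])).add (decFrac (φδ ![a 0]))), φH ![a 0, a 1, a 3],
      negWord (a 4)])
    (polyVec_cons p0 (polyVec_cons p1 (polyVec_cons p2.zeroVec (polyVec_cons (polyTime_const _)
      (polyVec_three hc.polyTime hh p4.negWord)))))
  refine (d1.and ((polyDec_isUnary p3).and (d3.and d4))).congr fun a => ?_
  constructor
  · rintro ⟨w, x, v, k, γ, rfl, hx, hv, z, ⟨hz, hzf⟩, hr⟩
    refine ⟨⟨w, x, v, rfl, hx, hv⟩, by simp [unary], ?_, ?_⟩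
    · simp [unary]
    · obtain ⟨r, hr1, hr2⟩ := hf w x v hx hv.1
      obtain ⟨e, he1, he2⟩ := hδ w
      refine ⟨w, x, fun _ => (0, 1), (1, 1), r.add e, φH ![w, encVec x, unary k], γ.neg, ?_, hx, z,
        hz, B.f w (vecVal x) z, le_rfl, ?_, ?_⟩
      · simp only [Matrix.cons_val, zeroVec_encVec, negWord_encFrac, hr1, he1, decFrac_encFrac]
      · rw [Frac.val_add, hr2, he2]
        simpa [Frac.val] using hzf
      · rw [hH w x k hx z hz.1, Frac.val_neg, hrel]
        exact hr
  · rintro ⟨⟨w, x, v, h1, hx, hv⟩, h2, h3, h4⟩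
    simp only [Matrix.vecCons_inj, and_true] at h1
    obtain ⟨e0, e1, e2⟩ := h1
    obtain ⟨w', x', α, β, c, h, γ, h5, hx', z, hz, u, hu, huc, hr⟩ := h4
    simp only [Matrix.vecCons_inj, and_true] at h5
    obtain ⟨f0, f1, f2, f3, f4, f5, f6⟩ := h5
    obtain rfl : w' = w := by rw [← f0, e0]
    obtain rfl : x' = x := encVec_injective (by rw [← f1, e1])
    rw [e2, zeroVec_encVec] at f2
    obtain rfl := encVec_injective f2
    obtain rfl := encFrac_injective f3
    obtain ⟨r, hr1, hr2⟩ := hf w' x' v hx hv.1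
    obtain ⟨e, he1, he2⟩ := hδ w'
    rw [e0, e1, e2, hr1, he1, decFrac_encFrac, decFrac_encFrac] at f4
    obtain rfl := encFrac_injective f4
    have hk : (a 3).length < B.mu w' := by
      have : (true :: a 3).length ≤ (unary (B.mu (a 0))).length := h3
      rw [e0] at this
      simpa [unary] using this
    have f6' := negWord_eq_encFrac f6
    refine ⟨w', x', v, ⟨(a 3).length, hk⟩, γ.neg, ?_, hx, hv, z, ⟨hz, ?_⟩, ?_⟩
    · ext1 i
      fin_cases i
      exacts [e0, e1, e2, h2, f6']
    · rw [Frac.val_add, hr2, he2] at huc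
      simp [Frac.val] at huc
      linarith
    · have e3 : h = φH ![w', encVec x', unary (⟨(a 3).length, hk⟩ : Fin (B.mu w'))] := by
        rw [← f5, e0, e1]
        simp only [← h2]
      rw [e3, hH w' x' ⟨_, hk⟩ hx z hz.1] at hr
      rw [Frac.val_neg, ← hrel, neg_neg]
      exact hr

end BilevelProblem

/-- A predicate decidable in polynomial time may be quantified over numbers bounded in unary. -/
theorem PolyDec.forall_lt {m : ℕ} {P : Input (m + 1) → Prop} (hP : PolyDec P)
    {w : Input m → Word} (hw : PolyTime w) :
    PolyDec fun a : Input m => ∀ k < (w a).length, P (Matrix.vecCons (unary k) a) := by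
  classical
  -- the state holds the counter, the parameters and a word that becomes nonempty on failure
  set g : Input (m + 2) → Input (m + 2) := fun s =>
    Matrix.vecCons (if P (fun i => s i.succ) then s 0 else [true])
      (Matrix.vecCons (true :: s 1) fun i => s i.succ.succ) with hg
  have hgp : ∀ i, PolyTime fun s => g s i := by
    refine polyVec_cons (PolyTime.ite (hP.of_vec fun i => polyTime_proj i.succ) (polyTime_proj 0)
      (polyTime_const _)) (polyVec_cons ((polyTime_proj 1).cons true) fun i => polyTime_proj _)
  have hgrow : ∀ s, size (g s) ≤ size s + 2 := by
    intro s
    simp only [size, Fin.sum_univ_succ, hg, Matrix.cons_val_zero, Matrix.cons_val_succ,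
      Fin.succ_zero_eq_one, List.length_cons]
    have : (if P (fun i => s i.succ) then s 0 else [true]).length ≤ (s 0).length + 1 := by
      split_ifs <;> simp
    omega
  have h := PolyTime.foldl_of_growth (m := m) (g := fun _ => g)
    (init := fun a => Matrix.vecCons [] (Matrix.vecCons [] a))
    (fun _ => hgp) (polyVec_cons polyTime_nil (polyVec_cons polyTime_nil fun i => polyTime_proj i))
    hw 2 (fun _ => hgrow) 0
  refine (polyDec_eq_nil h).congr fun a => ?_
  rw [foldl_const]
  have key : ∀ n : ℕ, ∃ e : Word, g^[n] (Matrix.vecCons [] (Matrix.vecCons [] a))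
      = Matrix.vecCons e (Matrix.vecCons (unary n) a) ∧
      (e = [] ↔ ∀ k < n, P (Matrix.vecCons (unary k) a)) := by
    intro n
    induction n with
    | zero => exact ⟨[], rfl, by simp⟩
    | succ n ih =>
      obtain ⟨e, h1, h2⟩ := ih
      rw [Function.iterate_succ_apply', h1]
      refine ⟨if P (Matrix.vecCons (unary n) a) then e else [true], rfl, ?_⟩
      rw [Nat.forall_lt_succ_right, ← h2]
      split_ifs with h3 <;> simp [h3]
  obtain ⟨e, h1, h2⟩ := key (w a).length
  rw [h1, Matrix.cons_val_zero, h2]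

namespace BilevelProblem

variable {B : BilevelProblem}

theorem norVerification_mem_classP (hB : B.PolyPresented)
    (hlow : B.lowerDecision (· < ·) ∈ ClassP 3)
    (hadv : B.adversarialDecision (· < ·) ∈ ClassP 5) : B.norVerification ∈ ClassP 4 := by
  obtain ⟨φf, hfp, hf⟩ := hB.f_comp
  obtain ⟨φF, hFp, hF⟩ := hB.F_comp
  have p0 := polyTime_proj (m := 4) 0
  have p1 := polyTime_proj (m := 4) 1
  have p2 := polyTime_proj (m := 4) 2
  have p3 := polyTime_proj (m := 4) 3
  have hmu := hB.mu_comp.of_vec (ψ := fun a : Input 4 => ![a 0]) (polyVec_cons p0 polyVec_nil)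
  have d1 := polyDec_mem hB.feasible_dec
    (ψ := fun a : Input 4 => ![a 0, a 2, a 3]) (polyVec_three p0 p2 p3)
  have d2 := polyDec_mem hlow
    (ψ := fun a : Input 4 => ![a 0, a 2, φf ![a 0, a 2, a 3]])
    (polyVec_three p0 p2 (hfp.of_vec (polyVec_three p0 p2 p3)))
  have d3 := PolyDec.forall_lt (P := fun b : Input 5 =>
      ¬ ![b 1, b 3, b 4, b 0, encFrac (0, 1)] ∈ B.adversarialDecision (· < ·))
    (PolyDec.not (polyDec_mem hadv
      (ψ := fun b : Input 5 => ![b 1, b 3, b 4, b 0, encFrac (0, 1)])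
      (polyVec_cons (polyTime_proj 1) (polyVec_cons (polyTime_proj 3) (polyVec_three
        (polyTime_proj 4) (polyTime_proj 0) (polyTime_const _)))))) hmu
  have d4 := polyDec_isFrac p1
  have d5 := (hFp.of_vec (ψ := fun a : Input 4 => ![a 0, a 2, a 3])
    (polyVec_three p0 p2 p3)).decFrac.le p1.decFrac
  refine (d1.and (d2.not.and (d3.and (d4.and d5)))).congr fun a => ?_
  constructor
  · rintro ⟨w, Γ, x, v, rfl, ⟨hx, hGv, ⟨hv, hopt⟩, hnear⟩, hΓ⟩
    obtain ⟨r, hr1, hr2⟩ := hf w x v hx hv.1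
    obtain ⟨s, hs1, hs2⟩ := hF w x v hx hv.1
    refine ⟨⟨w, x, v, rfl, hx, hv⟩, ?_, ?_, ⟨Γ, rfl⟩, ?_⟩
    · rintro ⟨w', x', γ, h, -, y, hy, hlt⟩
      simp only [Matrix.cons_val, Matrix.vecCons_inj, and_true] at h
      obtain ⟨rfl, h1, h2⟩ := h
      obtain rfl := encVec_injective h1
      rw [hr1] at h2
      obtain rfl := encFrac_injective h2
      have := hopt y hy
      rw [hr2] at hlt
      exact absurd hlt (not_lt.2 this)
    · rintro k - ⟨w', x', v', k', γ, h, -, -, z, hz, hlt⟩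
      simp only [Matrix.cons_val, Matrix.vecCons_inj, and_true] at h
      obtain ⟨h0, h1, h2, -, h4⟩ := h
      obtain rfl : w = w' := h0
      obtain rfl := encVec_injective h1
      obtain rfl := encVec_injective h2
      obtain rfl := encFrac_injective h4
      have := hnear k' z hz
      simp only [Frac.val, Int.cast_zero, zero_div] at hlt
      exact absurd hlt (not_lt.2 this)
    · simp only [Matrix.cons_val, hs1, decFrac_encFrac, hs2]
      exact hΓ
  · rintro ⟨⟨w, x, v, h1, hx, hv⟩, h2, h3, ⟨Γ, h4⟩, h5⟩
    simp only [Matrix.vecCons_inj, and_true] at h1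
    obtain ⟨e0, e1, e2⟩ := h1
    obtain ⟨r, hr1, hr2⟩ := hf w x v hx hv.1
    obtain ⟨s, hs1, hs2⟩ := hF w x v hx hv.1
    have hnear : ∀ k, ∀ z ∈ B.nearOptimal w (vecVal x) (vecVal v), B.G w k (vecVal x) z ≤ 0 := by
      intro k z hz
      by_contra! hlt
      refine h3 k (by rw [e0]; simp [unary]) ?_
      refine ⟨w, x, v, k, (0, 1), ?_, hx, hv, z, hz, by simpa [Frac.val] using hlt⟩
      have c1 : (Matrix.vecCons (unary k) a : Input 5) 1 = a 0 := rfl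
      have c2 : (Matrix.vecCons (unary k) a : Input 5) 3 = a 2 := rfl
      have c3 : (Matrix.vecCons (unary k) a : Input 5) 4 = a 3 := rfl
      rw [c1, c2, c3, e0, e1, e2]; rfl
    refine ⟨w, Γ, x, v, ?_, ⟨hx, fun k => hnear k _ ⟨hv, by linarith [B.δ_nonneg w]⟩, ⟨hv, ?_⟩,
      hnear⟩, ?_⟩
    · ext1 i
      fin_cases i
      exacts [e0, h4, e1, e2]
    · intro y hy
      by_contra! hlt
      refine h2 ⟨w, x, r, ?_, hx, y, hy, by rwa [hr2]⟩
      rw [e0, e1, e2, hr1]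
    · rw [e0, e1, e2, hs1, decFrac_encFrac, hs2, h4, decFrac_encFrac] at h5
      exact h5

/-- A certificate for a yes-instance is the pair of the codes of a rational solution `(x, v)`,
that of `x` being made self-delimiting. -/
theorem norDecision_mem_classNP (hver : B.norVerification ∈ ClassP 4)
    (hsize : B.HasPolySizeSolutions) : B.norDecision ∈ ClassNP 2 := by
  obtain ⟨p, hp⟩ := hsize
  have p0 := polyTime_proj (m := 3) 0
  have p1 := polyTime_proj (m := 3) 1
  have p2 := polyTime_proj (m := 3) 2
  have d := polyDec_mem hver
    (ψ := fun a : Input 3 => ![a 0, a 1, unflagFst (a 2), unflagSnd (a 2)])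
    (polyVec_cons p0 (polyVec_three p1 p2.unflagFst p2.unflagSnd))
  refine ⟨_, d, 2 * p + 1, fun a => ?_⟩
  have hsnoc : ∀ c : Word, (Fin.snoc (α := fun _ => Word) a c ∈ {a : Input 3 |
      ![a 0, a 1, unflagFst (a 2), unflagSnd (a 2)] ∈ B.norVerification}) ↔
      ![a 0, a 1, unflagFst c, unflagSnd c] ∈ B.norVerification := fun c => Iff.rfl
  simp only [hsnoc]
  constructor
  · rintro ⟨w, Γ, rfl, hsol⟩
    obtain ⟨x, v, h1, h2, h3⟩ := hp w Γ hsol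
    refine ⟨flag (encVec x) ++ encVec v, ?_, w, Γ, x, v, ?_, h1, h2⟩
    · rw [List.length_append, length_flag]
      simp only [Polynomial.eval_add, Polynomial.eval_mul, Polynomial.eval_ofNat,
        Polynomial.eval_one]
      omega
    · rw [unflagFst_flag, unflagSnd_flag]; rfl
  · rintro ⟨c, -, w, Γ, x, v, h, h1, h2⟩
    simp only [Matrix.vecCons_inj, and_true] at h
    refine ⟨w, Γ, ?_, _, _, h1, h2⟩
    ext1 i
    fin_cases i
    exacts [h.1, h.2.1]

end BilevelProblem

/-! ### Two linear inequalities on the epigraph of a parabola -/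

/-- The relation is `≤` or `<`; both kinds of bounds on an optimal value are treated together. -/
def IsOrd (rel : ℝ → ℝ → Prop) : Prop := rel = (· ≤ ·) ∨ rel = (· < ·)

theorem IsOrd.of_le {rel : ℝ → ℝ → Prop} (h : IsOrd rel) {x y z : ℝ} (hxy : x ≤ y)
    (hyz : rel y z) : rel x z := by
  rcases h with rfl | rfl
  · exact hxy.trans hyz
  · exact hxy.trans_lt hyz

theorem IsOrd.of_lt {rel : ℝ → ℝ → Prop} (h : IsOrd rel) {x y : ℝ} (hxy : x < y) : rel x y := by
  rcases h with rfl | rfl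
  · exact hxy.le
  · exact hxy

theorem IsOrd.le {rel : ℝ → ℝ → Prop} (h : IsOrd rel) {x y : ℝ} (hxy : rel x y) : x ≤ y := by
  rcases h with rfl | rfl
  · exact hxy
  · exact le_of_lt hxy

theorem IsOrd.congr {rel : ℝ → ℝ → Prop} (h : IsOrd rel) {x y x' y' k : ℝ} (hk : 0 < k)
    (e : y' - x' = k * (y - x)) : rel x y ↔ rel x' y' := by
  rcases h with rfl | rfl
  · exact ⟨fun h => by
      have : 0 ≤ k * (y - x) := mul_nonneg hk.le (sub_nonneg.2 h)
      show x' ≤ y'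
      linarith, fun h => by
      have h' : x' ≤ y' := h
      have : 0 ≤ k * (y - x) := by linarith
      show x ≤ y
      linarith [nonneg_of_mul_nonneg_right this hk]⟩
  · exact ⟨fun h => by
      have : 0 < k * (y - x) := mul_pos hk (sub_pos.2 h)
      show x' < y'
      linarith, fun h => by
      have h' : x' < y' := h
      have : 0 < k * (y - x) := by linarith
      show x < y
      linarith [pos_of_mul_pos_right this hk.le]⟩

/-- Comparison of `E` with a nonnegative number `r` of which only the square is known. -/
theorem IsOrd.sqrt_iff {rel : ℝ → ℝ → Prop} (h : IsOrd rel) {E r : ℝ} (hr : 0 ≤ r) :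
    rel E r ↔ rel E 0 ∨ rel (E ^ 2) (r ^ 2) := by
  rcases h with rfl | rfl
  · show E ≤ r ↔ E ≤ 0 ∨ E ^ 2 ≤ r ^ 2
    constructor
    · intro h
      rcases le_or_gt E 0 with h0 | h0
      · exact Or.inl h0
      · exact Or.inr (pow_le_pow_left₀ h0.le h 2)
    · rintro (h | h)
      · exact h.trans hr
      · exact le_of_sq_le_sq h hr
  · show E < r ↔ E < 0 ∨ E ^ 2 < r ^ 2
    constructor
    · intro h
      rcases lt_or_ge E 0 with h0 | h0
      · exact Or.inl h0
      · exact Or.inr (pow_lt_pow_left₀ h h0 (by norm_num))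
    · rintro (h | h)
      · exact h.trans_le hr
      · exact lt_of_pow_lt_pow_left₀ 2 hr h

/-- The linear inequality `e * t ≤ g` (or `<`) has a solution in the interval
`b * t ^ 2 + a * t ≤ c`, for `b > 0`; this is expressed without square roots. -/
def ChordCond (rel : ℝ → ℝ → Prop) (a b c e g : ℝ) : Prop :=
  0 ≤ a ^ 2 + 4 * b * c ∧ (rel (-(a * e) - 2 * b * g) 0 ∨
    rel ((-(a * e) - 2 * b * g) ^ 2) (e ^ 2 * (a ^ 2 + 4 * b * c)))

theorem chordCond_iff {rel : ℝ → ℝ → Prop} (h : IsOrd rel) {a b c e g : ℝ} (hb : 0 < b) :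
    ChordCond rel a b c e g ↔ ∃ t, b * t ^ 2 + a * t ≤ c ∧ rel (e * t) g := by
  set D := a ^ 2 + 4 * b * c with hD
  constructor
  · rintro ⟨hD0, hE⟩
    have hsq : √D ^ 2 = D := Real.sq_sqrt hD0
    have hF : e ^ 2 * D = (|e| * √D) ^ 2 := by rw [mul_pow, sq_abs, hsq]
    rw [hF, ← h.sqrt_iff (by positivity)] at hE
    -- the end of the interval at which `e * t` is smallest
    obtain ⟨σ, hσ, hσe⟩ : ∃ σ : ℝ, σ ^ 2 = 1 ∧ σ * e = |e| := by
      rcases le_total 0 e with he | he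
      · exact ⟨1, by norm_num, by rw [abs_of_nonneg he, one_mul]⟩
      · exact ⟨-1, by norm_num, by rw [abs_of_nonpos he]; ring⟩
    refine ⟨(-a - σ * √D) / (2 * b), le_of_eq ?_, ?_⟩
    · field_simp
      linear_combination (√D ^ 2) * hσ + hsq + hD
    · refine (h.congr (k := 1 / (2 * b)) (by positivity) ?_).1 hE
      rw [← hσe]; field_simp; ring
  · rintro ⟨t, ht, hg⟩
    have h1 : (2 * b * t + a) ^ 2 ≤ D := by
      have := mul_le_mul_of_nonneg_left ht (by linarith : (0 : ℝ) ≤ 4 * b)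
      rw [hD]; nlinarith
    have hD0 : 0 ≤ D := (sq_nonneg _).trans h1
    refine ⟨hD0, ?_⟩
    have hF : e ^ 2 * D = (|e| * √D) ^ 2 := by rw [mul_pow, sq_abs, Real.sq_sqrt hD0]
    rw [hF, ← h.sqrt_iff (by positivity)]
    have h2 : -(e * (2 * b * t + a)) ≤ |e| * √D := by
      refine (neg_le_abs _).trans ?_
      rw [abs_mul]
      exact mul_le_mul_of_nonneg_left (Real.abs_le_sqrt h1) (abs_nonneg e)
    have h3 : rel (-(a * e) - 2 * b * g) (-(e * (2 * b * t + a))) :=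
      (h.congr (k := 2 * b) (by positivity) (by ring)).1 hg
    rcases h with rfl | rfl
    · exact le_trans h3 h2
    · exact lt_of_lt_of_le h3 h2

/-- On the segment between two points of the epigraph of `t ^ 2`, at which a linear form has a value
`≤ c` and a value `> c`, there is a point at which its value is `c`. -/
theorem exists_segment {a b c t s t' s' : ℝ} (hs : t ^ 2 ≤ s) (hs' : t' ^ 2 ≤ s')
    (h : a * t + b * s ≤ c) (h' : c < a * t' + b * s') :
    ∃ l : ℝ, 0 ≤ l ∧ l < 1 ∧ (a * t + b * s < c → 0 < l) ∧
      (t + l * (t' - t)) ^ 2 ≤ s + l * (s' - s) ∧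
      a * (t + l * (t' - t)) + b * (s + l * (s' - s)) = c := by
  set p := a * t + b * s with hp
  set p' := a * t' + b * s' with hp'
  have hpos : 0 < p' - p := by linarith
  refine ⟨(c - p) / (p' - p), div_nonneg (by linarith) hpos.le, by rw [div_lt_one hpos]; linarith,
    fun h => div_pos (by linarith) hpos, ?_, ?_⟩
  · set l := (c - p) / (p' - p) with hl
    have h0 : 0 ≤ l := div_nonneg (by linarith) hpos.le
    have h1 : l ≤ 1 := by rw [hl, div_le_one hpos]; linarith
    nlinarith [mul_nonneg h0 (sub_nonneg.2 hs'), mul_nonneg (sub_nonneg.2 h1) (sub_nonneg.2 hs),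
      mul_nonneg (mul_nonneg h0 (sub_nonneg.2 h1)) (sq_nonneg (t' - t))]
  · have : (c - p) / (p' - p) * (p' - p) = c - p := div_mul_cancel₀ _ hpos.ne'
    have e : a * (t + (c - p) / (p' - p) * (t' - t)) + b * (s + (c - p) / (p' - p) * (s' - s))
        = p + (c - p) / (p' - p) * (p' - p) := by rw [hp, hp']; ring
    rw [e, this]; ring

/-- For `e₂ > 0`: the minimizer `t = -e₁ / (2 e₂)` of `e₁ t + e₂ t ^ 2` satisfies
`a t + b t ^ 2 ≤ c`. -/
def VertexCond (a b c e₁ e₂ : ℝ) : Prop := -2 * a * e₁ * e₂ + b * e₁ ^ 2 ≤ 4 * e₂ ^ 2 * c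

theorem vertexCond_iff {a b c e₁ e₂ : ℝ} (he : 0 < e₂) :
    VertexCond a b c e₁ e₂ ↔ a * (-e₁ / (2 * e₂)) + b * (-e₁ / (2 * e₂)) ^ 2 ≤ c := by
  have h : a * (-e₁ / (2 * e₂)) + b * (-e₁ / (2 * e₂)) ^ 2
      = (-2 * a * e₁ * e₂ + b * e₁ ^ 2) / (4 * e₂ ^ 2) := by field_simp; ring
  rw [h, div_le_iff₀ (by positivity), VertexCond, mul_comm c]

theorem vertex_value {e₁ e₂ : ℝ} (he : 0 < e₂) :
    e₁ * (-e₁ / (2 * e₂)) + e₂ * (-e₁ / (2 * e₂)) ^ 2 = -e₁ ^ 2 / (4 * e₂) := by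
  field_simp; ring

theorem vertex_value_le {e₁ e₂ t s : ℝ} (he : 0 < e₂) (hs : t ^ 2 ≤ s) :
    -e₁ ^ 2 / (4 * e₂) ≤ e₁ * t + e₂ * s := by
  rw [div_le_iff₀ (by positivity)]
  nlinarith [sq_nonneg (2 * e₂ * t + e₁), mul_le_mul_of_nonneg_left hs (sq_nonneg e₂)]

theorem vertex_rel_iff {rel : ℝ → ℝ → Prop} (h : IsOrd rel) {e₁ e₂ g : ℝ} (he : 0 < e₂) :
    rel (-e₁ ^ 2 / (4 * e₂)) g ↔ rel (-e₁ ^ 2) (4 * e₂ * g) :=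
  h.congr (k := 4 * e₂) (by positivity) (by field_simp)

/-- There is a point `(t, s)` with `t ^ 2 ≤ s`, `a t + b s ≤ c` and `e₁ t + e₂ s ≤ g` (or `< g`). -/
def ParabolaFeasible (rel : ℝ → ℝ → Prop) (a b c e₁ e₂ g : ℝ) : Prop :=
  ∃ t s : ℝ, t ^ 2 ≤ s ∧ a * t + b * s ≤ c ∧ rel (e₁ * t + e₂ * s) g

/-- For `b > 0`, a point of least value of the second form is the vertex or lies on the line
`a t + b s = c`. -/
theorem parabolaFeasible_of_pos {rel : ℝ → ℝ → Prop} (h : IsOrd rel) {a b c e₁ e₂ g : ℝ}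
    (hb : 0 < b) : ParabolaFeasible rel a b c e₁ e₂ g ↔
      (0 < e₂ ∧ VertexCond a b c e₁ e₂ ∧ rel (-e₁ ^ 2) (4 * e₂ * g)) ∨
      ChordCond rel a b c (b * e₁ - a * e₂) (b * g - e₂ * c) := by
  rw [chordCond_iff h hb]
  -- points on the line `a t + b s = c`
  have chord : ∀ t s : ℝ, t ^ 2 ≤ s → a * t + b * s = c → rel (e₁ * t + e₂ * s) g →
      ∃ t, b * t ^ 2 + a * t ≤ c ∧ rel ((b * e₁ - a * e₂) * t) (b * g - e₂ * c) := by
    intro t s hs hc hg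
    refine ⟨t, by nlinarith, (h.congr hb ?_).1 hg⟩
    rw [← hc]; ring
  constructor
  · rintro ⟨t, s, hs, hc, hg⟩
    rcases le_or_gt e₂ 0 with he | he
    · right
      have h1 : s ≤ (c - a * t) / b := by rw [le_div_iff₀ hb]; linarith
      refine chord t ((c - a * t) / b) (hs.trans h1) (by field_simp; ring) (h.of_le ?_ hg)
      linarith [mul_le_mul_of_nonpos_left h1 he]
    · by_cases hv : VertexCond a b c e₁ e₂
      · exact Or.inl ⟨he, hv, (vertex_rel_iff h he).1 (h.of_le (vertex_value_le he hs) hg)⟩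
      · right
        rw [vertexCond_iff he, not_le] at hv
        obtain ⟨l, h0, h1, -, h2, h3⟩ := exists_segment hs le_rfl hc hv
        refine chord _ _ h2 h3 (h.of_le ?_ hg)
        have h4 := vertex_value_le he hs (e₁ := e₁)
        rw [← vertex_value he] at h4
        linarith [mul_nonneg h0 (sub_nonneg.2 h4)]
  · rintro (⟨he, hv, hg⟩ | ⟨t, ht, hg⟩)
    · refine ⟨-e₁ / (2 * e₂), _, le_rfl, (vertexCond_iff he).1 hv, ?_⟩
      rw [vertex_value he]
      exact (vertex_rel_iff h he).2 hg
    · refine ⟨t, (c - a * t) / b, by rw [le_div_iff₀ hb]; linarith, ?_, (h.congr hb ?_).2 hg⟩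
      · rw [mul_div_cancel₀ _ hb.ne']; linarith
      · field_simp; ring

theorem parabolaFeasible_of_nonpos_of_neg {rel : ℝ → ℝ → Prop} (h : IsOrd rel)
    {a b c e₁ e₂ g : ℝ} (hb : b ≤ 0) (he : e₂ < 0) :
    ParabolaFeasible rel a b c e₁ e₂ g ↔ b < 0 ∨ (a < 0 ∨ 0 < a) ∨ 0 ≤ c := by
  constructor
  · rintro ⟨t, s, hs, hc, -⟩
    by_contra! h1
    obtain ⟨h2, ⟨h3, h4⟩, h5⟩ := h1
    obtain rfl : a = 0 := le_antisymm h4 h3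
    obtain rfl : b = 0 := le_antisymm hb h2
    linarith
  · intro hcase
    -- it suffices to satisfy the first inequality: the second one holds for all large `s`
    have key : ∀ t s : ℝ, t ^ 2 ≤ s → a * t + b * s ≤ c → ParabolaFeasible rel a b c e₁ e₂ g := by
      intro t s hs hc
      have h1 : 0 < (|g| + |e₁ * t + e₂ * s| + 1) / (-e₂) := by
        have : 0 < -e₂ := by linarith
        positivity
      refine ⟨t, s + (|g| + |e₁ * t + e₂ * s| + 1) / (-e₂), by linarith, ?_, h.of_lt ?_⟩
      · nlinarith [mul_nonneg (neg_nonneg.2 hb) h1.le]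
      · have h2 : e₂ * ((|g| + |e₁ * t + e₂ * s| + 1) / (-e₂))
            = -(|g| + |e₁ * t + e₂ * s| + 1) := by
          have := he.ne
          field_simp
        rw [mul_add, h2]
        linarith [neg_abs_le g, le_abs_self (e₁ * t + e₂ * s)]
    rcases hcase with hb' | ha | hc
    · refine key 0 (|c| / (-b)) ?_ ?_
      · have : 0 < -b := by linarith
        rw [zero_pow two_ne_zero]; positivity
      · have : b * (|c| / (-b)) = -|c| := by rw [div_neg, mul_neg, mul_div_cancel₀ _ hb'.ne]
        rw [this, mul_zero, zero_add]; exact neg_abs_le c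
    · have ha' : a ≠ 0 := ha.elim ne_of_lt ne_of_gt
      refine key (c / a) _ le_rfl ?_
      rw [mul_div_cancel₀ _ ha']
      nlinarith [mul_nonneg (neg_nonneg.2 hb) (sq_nonneg (c / a))]
    · exact key 0 0 (by norm_num) (by simpa using hc)

theorem parabolaFeasible_of_neg_of_zero {rel : ℝ → ℝ → Prop} (h : IsOrd rel)
    {a b c e₁ g : ℝ} (hb : b < 0) :
    ParabolaFeasible rel a b c e₁ 0 g ↔ (e₁ < 0 ∨ 0 < e₁) ∨ rel 0 g := by
  constructor
  · rintro ⟨t, s, hs, hc, hg⟩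
    by_cases he : e₁ = 0
    · right; simpa [he] using hg
    · exact Or.inl (lt_or_gt_of_ne he)
  · intro hcase
    have key : ∀ t : ℝ, rel (e₁ * t) g → ParabolaFeasible rel a b c e₁ 0 g := by
      intro t hg
      have h0 : 0 < -b := by linarith
      have h1 : 0 ≤ |a * t - c| / (-b) := by positivity
      refine ⟨t, t ^ 2 + |a * t - c| / (-b), by linarith, ?_, by simpa using hg⟩
      have h2 : b * (|a * t - c| / (-b)) = -|a * t - c| := by
        have := hb.ne
        field_simp
      rw [mul_add, h2]
      nlinarith [le_abs_self (a * t - c), mul_nonneg h0.le (sq_nonneg t)]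
    rcases hcase with he | h0
    · have he' : e₁ ≠ 0 := he.elim ne_of_lt ne_of_gt
      refine key ((g - 1) / e₁) (h.of_lt ?_)
      rw [mul_div_cancel₀ _ he']; linarith
    · exact key 0 (by simpa using h0)

theorem parabolaFeasible_of_zero_of_zero {rel : ℝ → ℝ → Prop} (h : IsOrd rel)
    {a c e₁ g : ℝ} :
    ParabolaFeasible rel a 0 c e₁ 0 g ↔
      (0 < a * e₁) ∨ (a * e₁ < 0 ∧ rel (a * e₁ * c) (a ^ 2 * g)) ∨
      (a * e₁ = 0 ∧ (a ≠ 0 ∨ 0 ≤ c) ∧ (e₁ ≠ 0 ∨ rel 0 g)) := by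
  have hred : ParabolaFeasible rel a 0 c e₁ 0 g ↔ ∃ t, a * t ≤ c ∧ rel (e₁ * t) g := by
    constructor
    · rintro ⟨t, s, -, hc, hg⟩
      exact ⟨t, by simpa using hc, by simpa using hg⟩
    · rintro ⟨t, hc, hg⟩
      exact ⟨t, t ^ 2, le_rfl, by simpa using hc, by simpa using hg⟩
  rw [hred]
  constructor
  · rintro ⟨t, hc, hg⟩
    rcases lt_trichotomy (a * e₁) 0 with h0 | h0 | h0
    · refine Or.inr (Or.inl ⟨h0, ?_⟩)
      have ha : 0 < a ^ 2 := by have := left_ne_zero_of_mul h0.ne; positivity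
      have h1 : rel (a ^ 2 * (e₁ * t)) (a ^ 2 * g) := (h.congr ha (by ring)).1 hg
      refine h.of_le ?_ h1
      nlinarith [mul_le_mul_of_nonpos_left hc h0.le]
    · refine Or.inr (Or.inr ⟨h0, ?_, ?_⟩)
      · by_cases ha : a = 0
        · right; simpa [ha] using hc
        · exact Or.inl ha
      · by_cases he : e₁ = 0
        · right; simpa [he] using hg
        · exact Or.inl he
    · exact Or.inl h0
  · rintro (h0 | ⟨h0, h1⟩ | ⟨h0, h1, h2⟩)
    · -- both forms tend to `-∞` in the same direction
      have ha := left_ne_zero_of_mul h0.ne'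
      have he := right_ne_zero_of_mul h0.ne'
      rcases lt_or_gt_of_ne ha with ha' | ha'
      · have he' : e₁ < 0 := by nlinarith
        refine ⟨|c| / (-a) + (|g| + 1) / (-e₁), ?_, h.of_lt ?_⟩
        · have h3 : a * (|c| / (-a)) = -|c| := by field_simp
          have h4 : 0 ≤ (|g| + 1) / (-e₁) := div_nonneg (by positivity) (by linarith)
          rw [mul_add, h3]
          nlinarith [neg_abs_le c]
        · have h3 : e₁ * ((|g| + 1) / (-e₁)) = -(|g| + 1) := by field_simp
          have h4 : 0 ≤ |c| / (-a) := div_nonneg (by positivity) (by linarith)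
          rw [mul_add, h3]
          nlinarith [neg_abs_le g]
      · have he' : 0 < e₁ := pos_of_mul_pos_right h0 ha'.le
        refine ⟨-(|c| / a + (|g| + 1) / e₁), ?_, h.of_lt ?_⟩
        · have h3 : a * (|c| / a) = |c| := by field_simp
          have h4 : 0 ≤ (|g| + 1) / e₁ := by positivity
          rw [mul_neg, mul_add, h3]
          nlinarith [neg_abs_le c]
        · have h3 : e₁ * ((|g| + 1) / e₁) = |g| + 1 := by field_simp
          have h4 : 0 ≤ |c| / a := by positivity
          rw [mul_neg, mul_add, h3]
          nlinarith [neg_abs_le g]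
    · have ha := left_ne_zero_of_mul h0.ne
      refine ⟨c / a, by rw [mul_div_cancel₀ _ ha], ?_⟩
      exact (h.congr (k := a ^ 2) (by positivity) (by field_simp)).2 h1
    · rcases h1 with ha | hc
      · have he : e₁ = 0 := (mul_eq_zero.1 h0).resolve_left ha
        refine ⟨c / a, by rw [mul_div_cancel₀ _ ha], ?_⟩
        have : rel 0 g := h2.resolve_left (not_not.2 he)
        simpa [he] using this
      · rcases h2 with he | hg
        · have ha : a = 0 := (mul_eq_zero.1 h0).resolve_right he
          refine ⟨(g - 1) / e₁, by simpa [ha] using hc, h.of_lt ?_⟩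
          rw [mul_div_cancel₀ _ he]; linarith
        · exact ⟨0, by simpa using hc, by simpa using hg⟩

/-- For `b ≤ 0` and `e₂ > 0`, the vertex satisfies the first inequality, or else one may take a
point on the line `e₁ t + e₂ s = g` (for a strict bound, move it towards the vertex). -/
theorem parabolaFeasible_of_nonpos_of_pos {rel : ℝ → ℝ → Prop} (h : IsOrd rel)
    {a b c e₁ e₂ g : ℝ} (hb : b ≤ 0) (he : 0 < e₂) :
    ParabolaFeasible rel a b c e₁ e₂ g ↔
      (VertexCond a b c e₁ e₂ ∧ rel (-e₁ ^ 2) (4 * e₂ * g)) ∨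
      (¬ VertexCond a b c e₁ e₂ ∧
        ChordCond rel e₁ e₂ g (e₂ * a - b * e₁) (e₂ * c - b * g)) := by
  constructor
  · rintro ⟨t, s, hs, hc, hg⟩
    by_cases hv : VertexCond a b c e₁ e₂
    · exact Or.inl ⟨hv, (vertex_rel_iff h he).1 (h.of_le (vertex_value_le he hs) hg)⟩
    · refine Or.inr ⟨hv, ?_⟩
      have h1 : s ≤ (g - e₁ * t) / e₂ := by rw [le_div_iff₀ he]; linarith [h.le hg]
      have h2 : e₂ * t ^ 2 + e₁ * t ≤ g := by nlinarith [h.le hg]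
      -- raising `s` to the line `e₁ t + e₂ s = g` does not violate the other inequality
      have key : rel (a * t + b * ((g - e₁ * t) / e₂)) c →
          ChordCond rel e₁ e₂ g (e₂ * a - b * e₁) (e₂ * c - b * g) := fun h3 =>
        (chordCond_iff h he).2 ⟨t, h2, (h.congr he (by field_simp; ring)).1 h3⟩
      rcases h with rfl | rfl
      · refine key ?_
        show a * t + b * ((g - e₁ * t) / e₂) ≤ c
        linarith [mul_le_mul_of_nonpos_left h1 hb]
      · have hg' : e₁ * t + e₂ * s < g := hg
        have h1' : s < (g - e₁ * t) / e₂ := by rw [lt_div_iff₀ he]; linarith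
        rcases lt_or_eq_of_le hb with hb' | rfl
        · refine key ?_
          show a * t + b * ((g - e₁ * t) / e₂) < c
          linarith [mul_lt_mul_of_neg_left h1' hb']
        · -- the first inequality does not involve `s`; `t` lies in the interior of an interval
          rw [VertexCond, not_le] at hv
          have h4 : (2 * e₂ * t + e₁) ^ 2 < e₁ ^ 2 + 4 * e₂ * g := by nlinarith
          have hc' : a * t ≤ c := by linarith
          have hpos : 0 < -(e₁ * a) - 2 * e₂ * c := by
            have : 0 < 2 * e₂ * (-(e₁ * a) - 2 * e₂ * c) := by nlinarith
            exact pos_of_mul_pos_right this (by positivity)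
          have hle : -(e₁ * a) - 2 * e₂ * c ≤ -a * (2 * e₂ * t + e₁) := by
            nlinarith [mul_le_mul_of_nonneg_left hc' he.le]
          have ha : a ≠ 0 := by
            rintro rfl
            have := hpos.trans_le hle
            simp at this
          refine ⟨((sq_nonneg _).trans_lt h4).le, Or.inr ?_⟩
          show (-(e₁ * (e₂ * a - 0 * e₁)) - 2 * e₂ * (e₂ * c - 0 * g)) ^ 2
            < (e₂ * a - 0 * e₁) ^ 2 * (e₁ ^ 2 + 4 * e₂ * g)
          have e1 : (-(e₁ * (e₂ * a - 0 * e₁)) - 2 * e₂ * (e₂ * c - 0 * g)) ^ 2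
              = e₂ ^ 2 * (-(e₁ * a) - 2 * e₂ * c) ^ 2 := by ring
          have e2 : (e₂ * a - 0 * e₁) ^ 2 * (e₁ ^ 2 + 4 * e₂ * g)
              = e₂ ^ 2 * (a ^ 2 * (e₁ ^ 2 + 4 * e₂ * g)) := by ring
          rw [e1, e2]
          refine mul_lt_mul_of_pos_left ?_ (by positivity)
          have h5 := pow_le_pow_left₀ hpos.le hle 2
          have h6 : a ^ 2 * (2 * e₂ * t + e₁) ^ 2 < a ^ 2 * (e₁ ^ 2 + 4 * e₂ * g) :=
            mul_lt_mul_of_pos_left h4 (by positivity)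
          nlinarith
  · rintro (⟨hv, hg⟩ | ⟨hv, hch⟩)
    · refine ⟨-e₁ / (2 * e₂), _, le_rfl, (vertexCond_iff he).1 hv, ?_⟩
      rw [vertex_value he]
      exact (vertex_rel_iff h he).2 hg
    · obtain ⟨t, ht, hr⟩ := (chordCond_iff h he).1 hch
      rw [vertexCond_iff he, not_le] at hv
      have hs : t ^ 2 ≤ (g - e₁ * t) / e₂ := by rw [le_div_iff₀ he]; linarith
      have hr' : rel (a * t + b * ((g - e₁ * t) / e₂)) c := (h.congr he (by field_simp; ring)).2 hr
      have hval : e₁ * t + e₂ * ((g - e₁ * t) / e₂) = g := by field_simp; ring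
      have hvle := vertex_value_le he hs (e₁ := e₁)
      rw [hval] at hvle
      rcases h with rfl | rfl
      · exact ⟨t, _, hs, hr', hval.le⟩
      · obtain ⟨l, h0, h1, h2, h3, h4⟩ := exists_segment hs le_rfl (le_of_lt hr') hv
        refine ⟨_, _, h3, h4.le, ?_⟩
        show _ < g
        have hlt : -e₁ ^ 2 / (4 * e₂) < g := by
          refine lt_of_le_of_ne hvle fun heq => ?_
          -- otherwise the point is the vertex
          have h5 : (2 * e₂ * t + e₁) ^ 2 = 0 := by
            have h6 : -e₁ ^ 2 = g * (4 * e₂) := by rw [← heq]; field_simp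
            nlinarith [sq_nonneg (2 * e₂ * t + e₁)]
          have h7 : t = -e₁ / (2 * e₂) := by
            rw [eq_div_iff (by positivity)]
            linarith [pow_eq_zero_iff (two_ne_zero) |>.1 h5]
          have h8 : (g - e₁ * t) / e₂ = t ^ 2 := by
            rw [div_eq_iff he.ne', ← heq, h7]; field_simp; ring
          have h9 : a * t + b * ((g - e₁ * t) / e₂) < c := hr'
          rw [h8, h7] at h9
          linarith
        have h10 := vertex_value (e₁ := e₁) he
        have h11 := mul_pos (h2 hr') (sub_pos.2 hlt)
        nlinarith

/-! ### Real-valued functions with rational values -/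

/-- A real-valued function has rational values, which are computable in polynomial time. -/
def PolyReal {m : ℕ} (f : Input m → ℝ) : Prop :=
  ∃ r : Input m → Frac, PolyFrac r ∧ ∀ a, (r a).val = f a

theorem PolyFrac.polyReal {m : ℕ} {r : Input m → Frac} (hr : PolyFrac r) :
    PolyReal fun a => (r a).val := ⟨r, hr, fun _ => rfl⟩

theorem PolyReal.congr {m : ℕ} {f g : Input m → ℝ} (hf : PolyReal f) (h : ∀ a, g a = f a) :
    PolyReal g := by
  rwa [show g = f from funext h]

theorem PolyInt.polyReal {m : ℕ} {f : Input m → ℤ} (hf : PolyInt f) :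
    PolyReal fun a => (f a : ℝ) := ⟨_, hf.ofInt, fun _ => Frac.val_ofInt _⟩

theorem PolyNat.polyReal {m : ℕ} {f : Input m → ℕ} (hf : PolyNat f) :
    PolyReal fun a => (f a : ℝ) := hf.polyInt.polyReal.congr fun a => by simp

theorem polyReal_const {m : ℕ} (n : ℤ) : PolyReal fun _ : Input m => (n : ℝ) :=
  (polyInt_const n).polyReal

theorem polyReal_ofNat {m : ℕ} (n : ℕ) [n.AtLeastTwo] :
    PolyReal fun _ : Input m => (OfNat.ofNat n : ℝ) :=
  (polyReal_const (OfNat.ofNat n)).congr fun _ => by simp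

theorem polyReal_zero {m : ℕ} : PolyReal fun _ : Input m => (0 : ℝ) :=
  (polyReal_const 0).congr fun _ => by simp

theorem polyReal_one {m : ℕ} : PolyReal fun _ : Input m => (1 : ℝ) :=
  (polyReal_const 1).congr fun _ => by simp

theorem PolyReal.add {m : ℕ} {f g : Input m → ℝ} (hf : PolyReal f) (hg : PolyReal g) :
    PolyReal fun a => f a + g a := by
  obtain ⟨r, hr, h⟩ := hf
  obtain ⟨s, hs, h'⟩ := hg
  exact ⟨_, hr.add hs, fun a => by rw [Frac.val_add, h, h']⟩

theorem PolyReal.mul {m : ℕ} {f g : Input m → ℝ} (hf : PolyReal f) (hg : PolyReal g) :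
    PolyReal fun a => f a * g a := by
  obtain ⟨r, hr, h⟩ := hf
  obtain ⟨s, hs, h'⟩ := hg
  exact ⟨_, hr.mul hs, fun a => by rw [Frac.val_mul, h, h']⟩

theorem PolyReal.neg {m : ℕ} {f : Input m → ℝ} (hf : PolyReal f) : PolyReal fun a => - f a := by
  obtain ⟨r, hr, h⟩ := hf
  exact ⟨_, hr.neg, fun a => by rw [Frac.val_neg, h]⟩

theorem PolyReal.sub {m : ℕ} {f g : Input m → ℝ} (hf : PolyReal f) (hg : PolyReal g) :
    PolyReal fun a => f a - g a :=
  (hf.add hg.neg).congr fun _ => sub_eq_add_neg _ _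

theorem PolyReal.sq {m : ℕ} {f : Input m → ℝ} (hf : PolyReal f) : PolyReal fun a => f a ^ 2 :=
  (hf.mul hf).congr fun _ => pow_two _

theorem PolyReal.ite {m : ℕ} {P : Input m → Prop} [DecidablePred P] {f g : Input m → ℝ}
    (hP : PolyDec P) (hf : PolyReal f) (hg : PolyReal g) :
    PolyReal fun a => if P a then f a else g a := by
  obtain ⟨r, hr, h⟩ := hf
  obtain ⟨s, hs, h'⟩ := hg
  exact ⟨_, PolyFrac.ite hP hr hs, fun a => by by_cases hPa : P a <;> simp [hPa, h, h']⟩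

theorem PolyReal.le {m : ℕ} {f g : Input m → ℝ} (hf : PolyReal f) (hg : PolyReal g) :
    PolyDec fun a => f a ≤ g a := by
  obtain ⟨r, hr, h⟩ := hf
  obtain ⟨s, hs, h'⟩ := hg
  exact (hr.le hs).congr fun a => by rw [h, h']

theorem PolyReal.lt {m : ℕ} {f g : Input m → ℝ} (hf : PolyReal f) (hg : PolyReal g) :
    PolyDec fun a => f a < g a :=
  (hg.le hf).not.congr fun a => by rw [not_le]

theorem PolyReal.max {m : ℕ} {f g : Input m → ℝ} (hf : PolyReal f) (hg : PolyReal g) :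
    PolyReal fun a => max (f a) (g a) := by
  classical
  exact (PolyReal.ite (hf.le hg) hg hf).congr fun a => max_def _ _

theorem PolyReal.rel {m : ℕ} {f g : Input m → ℝ} {rel : ℝ → ℝ → Prop} (h : IsOrd rel)
    (hf : PolyReal f) (hg : PolyReal g) : PolyDec fun a => rel (f a) (g a) := by
  rcases h with rfl | rfl
  · exact hf.le hg
  · exact hf.lt hg

theorem PolyReal.eq_zero {m : ℕ} {f : Input m → ℝ} (hf : PolyReal f) :
    PolyDec fun a => f a = 0 :=
  ((hf.le polyReal_zero).and (polyReal_zero.le hf)).congr fun _ => le_antisymm_iff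

theorem polyDec_chordCond {m : ℕ} {rel : ℝ → ℝ → Prop} (h : IsOrd rel)
    {a b c e g : Input m → ℝ} (ha : PolyReal a) (hb : PolyReal b) (hc : PolyReal c)
    (he : PolyReal e) (hg : PolyReal g) :
    PolyDec fun x => ChordCond rel (a x) (b x) (c x) (e x) (g x) := by
  have hD := ha.sq.add (((polyReal_ofNat 4).mul hb).mul hc)
  have hE := (ha.mul he).neg.sub (((polyReal_ofNat 2).mul hb).mul hg)
  exact (polyReal_zero.le hD).and ((PolyReal.rel h hE polyReal_zero).or
    (PolyReal.rel h hE.sq (he.sq.mul hD)))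

theorem polyDec_vertexCond {m : ℕ} {a b c e₁ e₂ : Input m → ℝ} (ha : PolyReal a) (hb : PolyReal b)
    (hc : PolyReal c) (he₁ : PolyReal e₁) (he₂ : PolyReal e₂) :
    PolyDec fun x => VertexCond (a x) (b x) (c x) (e₁ x) (e₂ x) :=
  ((((polyReal_ofNat 2).neg.mul ha).mul he₁).mul he₂ |>.add (hb.mul he₁.sq)).le
    (((polyReal_ofNat 4).mul he₂.sq).mul hc)

theorem polyDec_parabolaFeasible {m : ℕ} {rel : ℝ → ℝ → Prop} (h : IsOrd rel)
    {a b c e₁ e₂ g : Input m → ℝ} (ha : PolyReal a) (hb : PolyReal b) (hc : PolyReal c)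
    (he₁ : PolyReal e₁) (he₂ : PolyReal e₂) (hg : PolyReal g) :
    PolyDec fun x => ParabolaFeasible rel (a x) (b x) (c x) (e₁ x) (e₂ x) (g x) := by
  have z : PolyReal fun _ : Input m => (0 : ℝ) := polyReal_zero
  have hv := polyDec_vertexCond ha hb hc he₁ he₂
  have hval := PolyReal.rel h he₁.sq.neg (((polyReal_ofNat 4).mul he₂).mul hg)
  have d₁ := ((z.lt he₂).and (hv.and hval)).or (polyDec_chordCond h ha hb hc
    ((hb.mul he₁).sub (ha.mul he₂)) ((hb.mul hg).sub (he₂.mul hc)))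
  have d₂ := (hb.lt z).or (((ha.lt z).or (z.lt ha)).or (z.le hc))
  have d₃ := (hv.and hval).or (hv.not.and (polyDec_chordCond h he₁ he₂ hg
    ((he₂.mul ha).sub (hb.mul he₁)) ((he₂.mul hc).sub (hb.mul hg))))
  have d₄ := ((he₁.lt z).or (z.lt he₁)).or (PolyReal.rel h z hg)
  have hp := ha.mul he₁
  have d₅ := (z.lt hp).or (((hp.lt z).and (PolyReal.rel h (hp.mul hc) (ha.sq.mul hg))).or
    (hp.eq_zero.and ((ha.eq_zero.not.or (z.le hc)).and
      (he₁.eq_zero.not.or (PolyReal.rel h z hg)))))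
  refine ((z.lt hb).ite d₁ ((he₂.lt z).ite d₂ ((z.lt he₂).ite d₃ ((hb.lt z).ite d₄ d₅)))).congr
    fun x => ?_
  split_ifs with h1 h2 h3 h4
  · exact parabolaFeasible_of_pos h h1
  · exact parabolaFeasible_of_nonpos_of_neg h (not_lt.1 h1) h2
  · exact parabolaFeasible_of_nonpos_of_pos h (not_lt.1 h1) h3
  · rw [le_antisymm (not_lt.1 h3) (not_lt.1 h2)]
    exact parabolaFeasible_of_neg_of_zero h h4
  · rw [le_antisymm (not_lt.1 h3) (not_lt.1 h2), le_antisymm (not_lt.1 h1) (not_lt.1 h4)]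
    exact parabolaFeasible_of_zero_of_zero h

theorem PolyFrac.floor_add_half {m : ℕ} {r : Input m → Frac} (hr : PolyFrac r) :
    PolyNat fun a => ⌊(r a).val + 1 / 2⌋₊ := by
  have h2 : PolyNat fun _ : Input m => 2 := polyNat_const 2
  refine (((h2.polyInt.mul hr.num).add hr.den.polyInt).toNat.div (h2.mul hr.den)).congr
    fun a => ?_
  obtain ⟨n, d⟩ := r a
  have hd : (0 : ℝ) < (d : ℕ) := by exact_mod_cast d.pos
  have e : Frac.val (n, d) + 1 / 2 = ((2 * n + (d : ℕ) : ℤ) : ℝ) / ((2 * (d : ℕ) : ℕ) : ℝ) := by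
    simp only [Frac.val]; push_cast; field_simp
  simp only [e, Nat.cast_ofNat]
  rcases le_total 0 (2 * n + ((d : ℕ) : ℤ)) with h | h
  · obtain ⟨k, hk⟩ := Int.eq_ofNat_of_zero_le h
    rw [hk, Int.cast_natCast, Nat.floor_div_eq_div, Int.toNat_natCast]
  · rw [Int.toNat_of_nonpos h, Nat.zero_div, Nat.floor_of_nonpos]
    refine div_nonpos_of_nonpos_of_nonneg (by exact_mod_cast h) (Nat.cast_nonneg _)

theorem polyNat_two_pow {m : ℕ} {f : Input m → Word} (hf : PolyTime f) :
    PolyNat fun a => 2 ^ (f a).length := by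
  have := PolyTime.foldr_word (g := fun _ s => false :: s) (init := fun _ => [true])
    (fun b => (polyTime_proj 0).cons false) (polyTime_const _) hf 1 (fun b s => by simp)
  refine this.polyNat_of_eq fun a => ?_
  induction f a with
  | nil => simp [bitsVal]
  | cons b l ih =>
    rw [List.foldr_cons, bitsVal, ih, List.length_cons, pow_succ]
    simp [mul_comm]

/-- The vector of `n` fractions whose code is at the beginning of `w` (some vector if there is
none). -/
def decVec : (n : ℕ) → Word → Fin n → Frac
  | 0, _ => Fin.elim0
  | n + 1, w => Fin.cons (decFrac w) (decVec n (restFrac w))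

theorem decVec_encVec {n : ℕ} (x : Fin n → Frac) : decVec n (encVec x) = x := by
  induction n with
  | zero => exact Subsingleton.elim _ _
  | succ n ih =>
    rw [decVec, encVec_succ, decFrac_encFrac_append, restFrac_encFrac_append, ih]
    exact Fin.cons_self_tail x

theorem PolyTime.decVec {m : ℕ} {f : Input m → Word} (hf : PolyTime f) {n : ℕ} (i : Fin n) :
    PolyFrac fun a => decVec n (f a) i := by
  induction n generalizing f with
  | zero => exact i.elim0
  | succ n ih =>
    refine Fin.cases ?_ (fun j => ?_) i
    · exact hf.decFrac
    · exact ih hf.restFrac j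

theorem PolyTime.encVec_decVec {m : ℕ} {f : Input m → Word} (hf : PolyTime f) (n : ℕ) :
    PolyTime fun a => encVec (NearOptBilevel.decVec n (f a)) := by
  induction n generalizing f with
  | zero => simpa only [encVec_zero] using polyTime_nil
  | succ n ih =>
    simp only [encVec_succ]
    exact hf.decFrac.polyTime.append (ih hf.restFrac)

theorem polyDec_isVec {m : ℕ} {f : Input m → Word} (hf : PolyTime f) (n : ℕ) :
    PolyDec fun a => ∃ x : Fin n → Frac, f a = encVec x :=
  (polyDec_eq hf (hf.encVec_decVec n)).congr fun a =>
    ⟨by rintro ⟨x, hx⟩; rw [hx, decVec_encVec], fun h => ⟨_, h⟩⟩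

/-! ### Maximizing a convex function that encodes an NP verifier -/

theorem trim_append_true (c : Word) : trim (c ++ [true]) = c ++ [true] := by
  induction c with
  | nil => simp [trim]
  | cons b c ih =>
    have : trim (b :: c ++ [true]) = if b = false ∧ trim (c ++ [true]) = [] then []
      else b :: trim (c ++ [true]) := rfl
    rw [this, ih]; simp

/-- The number `n` codes a certificate for `w`, namely its binary digits without the leading
one. -/
def Accepts (V : Set (Input 2)) (p : Polynomial ℕ) (w : Word) (n : ℕ) : Prop :=
  n.bits.dropLast.length ≤ p.eval w.length ∧ ![w, n.bits.dropLast] ∈ V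

open Classical in
/-- A convex function on the epigraph of `t ^ 2`: the maximum of `-1`, `-s` and the affine functions
`1 - 8 * (s - 2 * n * t + n ^ 2)` for all numbers `n` that code a certificate for `w`. The `n`-th of
these is at most `-1` unless `n` is the integer nearest to `t`, so that only this one has to be
considered. -/
def peaks (V : Set (Input 2)) (p : Polynomial ℕ) (w : Word) (t s : ℝ) : ℝ :=
  max (max (-1) (-s)) (if Accepts V p w ⌊t + 1 / 2⌋₊
    then 1 - 8 * (s - 2 * (⌊t + 1 / 2⌋₊ : ℝ) * t + (⌊t + 1 / 2⌋₊ : ℝ) ^ 2) else -1)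

variable {V : Set (Input 2)} {p : Polynomial ℕ} {w : Word}

theorem exists_accepts_iff :
    (∃ n, Accepts V p w n) ↔ ∃ c : Word, c.length ≤ p.eval w.length ∧ ![w, c] ∈ V := by
  constructor
  · rintro ⟨n, h⟩
    exact ⟨_, h⟩
  · rintro ⟨c, h⟩
    refine ⟨bitsVal (c ++ [true]), ?_⟩
    rw [Accepts, ← trim_eq, trim_append_true]
    simpa using h

theorem Accepts.sq_le {n : ℕ} (h : Accepts V p w n) :
    (n : ℝ) ^ 2 ≤ ((2 ^ (2 * (p.eval w.length + 1)) : ℕ) : ℝ) := by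
  have h1 : n < 2 ^ (p.eval w.length + 1) := by
    rw [← length_bits_le_iff]
    have := h.1
    rw [List.length_dropLast] at this
    omega
  have h2 : n ^ 2 ≤ 2 ^ (2 * (p.eval w.length + 1)) := by
    rw [mul_comm 2, pow_mul]
    exact Nat.pow_le_pow_left h1.le 2
  exact_mod_cast h2

theorem neg_le_peaks (t s : ℝ) : -s ≤ peaks V p w t s :=
  le_max_of_le_left (le_max_right _ _)

theorem neg_one_le_peaks (t s : ℝ) : -1 ≤ peaks V p w t s :=
  le_max_of_le_left (le_max_left _ _)

theorem tangent_le_peaks {n : ℕ} (h : Accepts V p w n) {t s : ℝ} (hs : t ^ 2 ≤ s) :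
    1 - 8 * (s - 2 * n * t + n ^ 2) ≤ peaks V p w t s := by
  by_cases hn : ⌊t + 1 / 2⌋₊ = n
  · rw [peaks, hn, if_pos h]
    exact le_max_right _ _
  · -- the distance of `t` from `n` is at least `1 / 2`
    refine le_trans ?_ (neg_one_le_peaks t s)
    have h1 : (1 : ℝ) / 4 ≤ (t - n) ^ 2 := by
      rcases lt_or_gt_of_ne hn with hlt | hgt
      · have h2 : t + 1 / 2 < n := Nat.lt_of_floor_lt hlt
        nlinarith
      · have h2 : ((n + 1 : ℕ) : ℝ) ≤ t + 1 / 2 :=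
          (Nat.le_floor_iff' (Nat.succ_ne_zero n)).1 hgt
        push_cast at h2
        nlinarith
    nlinarith

theorem peaks_eq_one {n : ℕ} (h : Accepts V p w n) : peaks V p w n (n ^ 2) = 1 := by
  have hn : ⌊(n : ℝ) + 1 / 2⌋₊ = n := by
    rw [Nat.floor_eq_iff (by positivity)]
    constructor <;> linarith
  rw [peaks, hn, if_pos h]
  have : (1 : ℝ) - 8 * ((n : ℝ) ^ 2 - 2 * n * n + (n : ℝ) ^ 2) = 1 := by ring
  rw [this]
  refine max_eq_right (max_le (by norm_num) ?_)
  nlinarith [sq_nonneg (n : ℝ)]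

theorem peaks_le_one {t s : ℝ} (hs : t ^ 2 ≤ s) : peaks V p w t s ≤ 1 := by
  refine max_le (max_le (by norm_num) (by nlinarith [sq_nonneg t])) ?_
  split_ifs
  · nlinarith [sq_nonneg (t - (⌊t + 1 / 2⌋₊ : ℝ))]
  · norm_num

theorem peaks_nonpos (h : ¬ ∃ n, Accepts V p w n) {t s : ℝ} (hs : t ^ 2 ≤ s) :
    peaks V p w t s ≤ 0 := by
  push Not at h
  rw [peaks, if_neg (h _)]
  exact max_le (max_le (by norm_num) (by nlinarith [sq_nonneg t])) (by norm_num)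

theorem peaks_convex {t s t' s' a b : ℝ} (hs : t ^ 2 ≤ s) (hs' : t' ^ 2 ≤ s') (ha : 0 ≤ a)
    (hb : 0 ≤ b) (hab : a + b = 1) :
    peaks V p w (a * t + b * t') (a * s + b * s')
      ≤ a * peaks V p w t s + b * peaks V p w t' s' := by
  have key : ∀ L : ℝ → ℝ → ℝ, (L (a * t + b * t') (a * s + b * s') = a * L t s + b * L t' s') →
      (∀ t s, t ^ 2 ≤ s → L t s ≤ peaks V p w t s) →
      L (a * t + b * t') (a * s + b * s') ≤ a * peaks V p w t s + b * peaks V p w t' s' := by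
    intro L h1 h2
    rw [h1]
    exact add_le_add (mul_le_mul_of_nonneg_left (h2 t s hs) ha)
      (mul_le_mul_of_nonneg_left (h2 t' s' hs') hb)
  have h1 := key (fun _ _ => -1) (by linear_combination hab) (fun t s _ => neg_one_le_peaks t s)
  have h2 := key (fun _ s => -s) (by ring) (fun t s _ => neg_le_peaks t s)
  rw [peaks]
  generalize ⌊a * t + b * t' + 1 / 2⌋₊ = n
  refine max_le (max_le h1 h2) ?_
  split_ifs with h
  · exact key (fun t s => 1 - 8 * (s - 2 * (n : ℝ) * t + (n : ℝ) ^ 2))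
      (by linear_combination (8 * (n : ℝ) ^ 2 - 1) * hab) (fun t s hs => tangent_le_peaks h hs)
  · exact h1

theorem polyDec_accepts (hV : V ∈ ClassP 2) {m : ℕ} {f : Input m → Word} {g : Input m → ℕ}
    (hf : PolyTime f) (hg : PolyNat g) : PolyDec fun a => Accepts V p (f a) (g a) := by
  have hc : PolyTime fun a => (g a).bits.dropLast := by
    have := (PolyTime.reverse hg).tail.reverse
    convert this using 2 with a
    simp
  refine PolyDec.and ?_ (polyDec_mem hV (polyVec_two hf hc))
  exact (polyDec_length_le hc (hf.unary_eval p)).congr fun a => by simp [unary]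

theorem polyReal_peaks (hV : V ∈ ClassP 2) {m : ℕ} {f : Input m → Word} {r s : Input m → Frac}
    (hf : PolyTime f) (hr : PolyFrac r) (hs : PolyFrac s) :
    PolyReal fun a => peaks V p (f a) (r a).val (s a).val := by
  classical
  have hn := hr.floor_add_half
  have h1 := (polyReal_const (-1)).max hs.polyReal.neg (m := m)
  have h2 := polyReal_one.sub ((polyReal_ofNat 8).mul ((hs.polyReal.sub
    (((polyReal_ofNat 2).mul hn.polyReal).mul hr.polyReal)).add hn.polyReal.sq))
  refine (h1.max (PolyReal.ite (polyDec_accepts (p := p) hV hf hn) h2 (polyReal_const (-1)))).congr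
    fun a => ?_
  simp only [peaks, Int.cast_neg, Int.cast_one]

variable (V p) in
/-- A bilevel problem with one upper-level variable `x ≥ 0`, which is minimized. The lower level is
to minimize `s` over the points `(t, s)` with `t ^ 2 ≤ s`; within the tolerance, its near-optimal
solutions include the points `(n, n ^ 2)` for all `n` that might code a certificate for `w`. The
upper-level constraint requires `peaks` to be nonpositive. -/
abbrev peakProblem : BilevelProblem where
  nx _ := 1
  ny _ := 2
  mu _ := 1
  ml _ := 0
  X _ := {x | 0 ≤ x 0}
  Y _ := {y | y 0 ^ 2 ≤ y 1}
  F _ x _ := x 0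
  G w _ _ y := peaks V p w (y 0) (y 1)
  f _ _ y := y 1
  g _ i := i.elim0
  δ w := ((2 ^ (2 * (p.eval w.length + 1)) : ℕ) : ℝ)
  δ_nonneg _ := Nat.cast_nonneg _

variable (V p) in
/-- All affine functions with rational coefficients; the code is the vector of the coefficients. -/
def affineClass : (peakProblem V p).FunctionClass := fun _ c y =>
  (decVec 3 c 0).val + (decVec 3 c 1).val * y 0 + (decVec 3 c 2).val * y 1

theorem mem_lowerFeasible {x : Fin 1 → ℝ} {y : Fin 2 → ℝ} :
    y ∈ (peakProblem V p).lowerFeasible w x ↔ y 0 ^ 2 ≤ y 1 :=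
  ⟨fun h => h.1, fun h => ⟨h, fun i => i.elim0⟩⟩

theorem mem_nearOptimal {x : Fin 1 → ℝ} {v z : Fin 2 → ℝ} :
    z ∈ (peakProblem V p).nearOptimal w x v ↔
      z 0 ^ 2 ≤ z 1 ∧ z 1 ≤ v 1 + ((2 ^ (2 * (p.eval w.length + 1)) : ℕ) : ℝ) :=
  and_congr_left fun _ => mem_lowerFeasible (w := w) (x := x)

theorem exists_nearOptimal_le_iff {x : Fin 1 → ℝ} {v : Fin 2 → ℝ} (hv : v 0 ^ 2 ≤ v 1) {γ : ℝ} :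
    (∃ z ∈ (peakProblem V p).nearOptimal w x v, γ ≤ peaks V p w (z 0) (z 1)) ↔
      γ ≤ 0 ∨ γ ≤ 1 ∧ ∃ n, Accepts V p w n := by
  have hv1 : 0 ≤ v 1 := (sq_nonneg _).trans hv
  constructor
  · rintro ⟨z, hz, h⟩
    rw [mem_nearOptimal] at hz
    by_cases hn : ∃ n, Accepts V p w n
    · exact Or.inr ⟨h.trans (peaks_le_one hz.1), hn⟩
    · exact Or.inl (h.trans (peaks_nonpos hn hz.1))
  · rintro (h | ⟨h, n, hn⟩)
    · refine ⟨![0, 0], mem_nearOptimal.2 ⟨by simp, ?_⟩, h.trans ?_⟩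
      · simp only [Matrix.cons_val_one, Matrix.cons_val_zero]; positivity
      · simpa using neg_le_peaks (V := V) (p := p) (w := w) 0 0
    · refine ⟨![n, n ^ 2], mem_nearOptimal.2 ⟨by simp, ?_⟩, h.trans ?_⟩
      · have := hn.sq_le
        simp only [Matrix.cons_val_one, Matrix.cons_val_zero]
        linarith
      · simpa using (peaks_eq_one hn).ge

theorem norFeasible_peakProblem_iff {x : Fin 1 → ℝ} {v : Fin 2 → ℝ} :
    (peakProblem V p).NORFeasible w x v ↔
      0 ≤ x 0 ∧ v 0 = 0 ∧ v 1 = 0 ∧ ¬ ∃ n, Accepts V p w n := by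
  constructor
  · rintro ⟨hx, -, ⟨hv, hopt⟩, hG⟩
    rw [mem_lowerFeasible] at hv
    have h1 : v 1 ≤ 0 := by
      simpa using hopt ![0, 0] (mem_lowerFeasible.2 (by simp))
    have h0 : v 0 = 0 := by
      have : v 0 ^ 2 = 0 := le_antisymm (hv.trans h1) (sq_nonneg _)
      simpa using this
    refine ⟨hx, h0, le_antisymm h1 ((sq_nonneg _).trans hv), fun hn => ?_⟩
    obtain ⟨z, hz, h⟩ := (exists_nearOptimal_le_iff (x := x) hv (γ := 1)).2 (Or.inr ⟨le_rfl, hn⟩)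
    exact absurd (hG 0 z hz) (not_le.2 (by linarith : (0 : ℝ) < peaks V p w (z 0) (z 1)))
  · rintro ⟨hx, h0, h1, hn⟩
    have hv : v 0 ^ 2 ≤ v 1 := by rw [h0, h1]; norm_num
    refine ⟨hx, fun _ => peaks_nonpos hn hv, ⟨mem_lowerFeasible.2 hv, fun y hy => ?_⟩,
      fun _ z hz => peaks_nonpos hn (mem_nearOptimal.1 hz).1⟩
    rw [mem_lowerFeasible] at hy
    change v 1 ≤ y 1
    rw [h1]
    exact (sq_nonneg _).trans hy

theorem encVec_one (x : Fin 1 → Frac) : encVec x = encFrac (x 0) := by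
  rw [encVec_succ, encVec_zero, List.append_nil]

theorem polyPresented_peakProblem (hV : V ∈ ClassP 2) : (peakProblem V p).PolyPresented where
  mu_comp := polyTime_const _
  delta_comp := by
    have h : PolyTime fun a : Input 1 => unary (2 * (p.eval (a 0).length + 1)) := by
      convert (polyTime_proj (m := 1) 0).unary_eval (2 * (p + 1)) using 2 with a
      simp
    refine ⟨_, (polyNat_two_pow h).polyInt.ofInt.polyTime, fun w => ⟨_, rfl, ?_⟩⟩
    simp [unary]
  F_comp := by
    refine ⟨_, polyTime_proj 1, fun w x y _ _ => ⟨x 0, ?_, rfl⟩⟩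
    exact encVec_one x
  f_comp := by
    refine ⟨_, ((polyTime_proj (m := 3) 2).decVec (n := 2) 1).polyTime, fun w x y _ _ =>
      ⟨y 1, ?_, rfl⟩⟩
    change encFrac (decVec 2 (encVec y) 1) = _
    rw [decVec_encVec]
  G_comp := by
    have h := polyTime_proj (m := 4) 2
    obtain ⟨r, hr, hv⟩ := polyReal_peaks (p := p) hV (polyTime_proj (m := 4) 0)
      (h.decVec (n := 2) 0) (h.decVec (n := 2) 1)
    refine ⟨_, hr.polyTime, fun w x y k _ _ => ⟨_, rfl, ?_⟩⟩
    rw [hv]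
    change peaks V p w (decVec 2 (encVec y) 0).val (decVec 2 (encVec y) 1).val = _
    rw [decVec_encVec]
    rfl
  feasible_dec := by
    have p1 := polyTime_proj (m := 3) 1
    have p2 := polyTime_proj (m := 3) 2
    have d1 := polyReal_zero.le (p1.decVec (n := 1) 0).polyReal
    have d2 := (p2.decVec (n := 2) 0).polyReal.sq.le (p2.decVec (n := 2) 1).polyReal
    refine ((polyDec_isVec p1 1).and ((polyDec_isVec p2 2).and (d1.and d2))).congr fun a => ?_
    constructor
    · rintro ⟨w, x, y, rfl, hx, hy⟩
      refine ⟨⟨x, rfl⟩, ⟨y, rfl⟩, ?_, ?_⟩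
      · change 0 ≤ (decVec 1 (encVec x) 0).val
        rw [decVec_encVec]; exact hx
      · change (decVec 2 (encVec y) 0).val ^ 2 ≤ (decVec 2 (encVec y) 1).val
        rw [decVec_encVec]; exact mem_lowerFeasible.1 hy
    · rintro ⟨⟨x, hx⟩, ⟨y, hy⟩, h1, h2⟩
      rw [hx, decVec_encVec] at h1
      rw [hy, decVec_encVec] at h2
      refine ⟨a 0, x, y, ?_, h1, mem_lowerFeasible.2 h2⟩
      ext1 i
      fin_cases i
      exacts [rfl, hx, hy]

theorem hasPolySizeSolutions_peakProblem : (peakProblem V p).HasPolySizeSolutions := by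
  refine ⟨Polynomial.C ((encVec fun _ : Fin 1 => ((0, 1) : Frac)).length +
    (encVec fun _ : Fin 2 => ((0, 1) : Frac)).length), fun w Γ => ?_⟩
  rintro ⟨x, v, hf, hΓ⟩
  obtain ⟨hx, -, -, hn⟩ := norFeasible_peakProblem_iff.1 hf
  have h0 : Frac.val (0, 1) = 0 := by simp [Frac.val]
  refine ⟨fun _ => (0, 1), fun _ => (0, 1), norFeasible_peakProblem_iff.2
    ⟨h0.ge, h0, h0, hn⟩, ?_, by simp⟩
  exact h0.le.trans (hx.trans hΓ)

theorem convex_epigraph : Convex ℝ {y : Fin 2 → ℝ | y 0 ^ 2 ≤ y 1} := by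
  intro y hy z hz a b ha hb hab
  simp only [Set.mem_ofPred_eq, Pi.add_apply, Pi.smul_apply, smul_eq_mul] at *
  obtain rfl : b = 1 - a := by linarith
  nlinarith [mul_le_mul_of_nonneg_left hy ha, mul_le_mul_of_nonneg_left hz hb,
    mul_nonneg (mul_nonneg ha hb) (sq_nonneg (y 0 - z 0))]

theorem lowerConvex_peakProblem : (peakProblem V p).LowerConvex where
  convex_Y _ := convex_epigraph
  convex_f _ _ _ := ⟨convex_epigraph, fun _ _ _ _ _ _ _ _ _ => le_rfl⟩
  convex_g _ _ _ i := i.elim0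

theorem convexClass_affineClass : (peakProblem V p).ConvexClass (affineClass V p) := by
  intro w c
  refine ⟨convex_epigraph, fun y _ z _ a b _ _ hab => le_of_eq ?_⟩
  simp only [affineClass, smul_eq_mul]
  change _ + _ * (a * y 0 + b * z 0) + _ * (a * y 1 + b * z 1) = _
  linear_combination -(decVec 3 c 0).val * hab

theorem upperConvexNonaffine_peakProblem : (peakProblem V p).UpperConvexNonaffine := by
  rintro w x - -
  refine ⟨⟨convex_epigraph, fun y hy z hz a b ha hb hab => peaks_convex hy hz ha hb hab⟩, ?_⟩
  rintro ⟨A, hA⟩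
  -- on the line `t = 0`, the values at `s = 1` and `s = 2` are `-1`, but the value at `s = 0` is
  -- nonnegative
  have hmid : A ![0, 2] - A ![0, 1] = A ![0, 1] - A ![0, 0] := by
    have h1 := A.linearMap_vsub ![0, 2] ![0, 1]
    have h2 := A.linearMap_vsub ![0, 1] ![0, 0]
    have h3 : (![0, 2] : Fin 2 → ℝ) -ᵥ ![0, 1] = (![0, 1] : Fin 2 → ℝ) -ᵥ ![0, 0] := by
      ext i; fin_cases i <;> norm_num
    rw [h3, h2] at h1
    exact h1.symm
  have hG : ∀ s : ℝ, 0 ≤ s → peaks V p w 0 s = A ![0, s] := fun s hs =>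
    hA ![0, s] (by simpa using hs)
  have hn : ⌊(0 : ℝ) + 1 / 2⌋₊ = 0 := by norm_num
  have hval : ∀ s : ℝ, 1 ≤ s → peaks V p w 0 s = -1 := fun s hs => by
    rw [peaks, hn, max_eq_left (by linarith : -s ≤ -1)]
    refine max_eq_left ?_
    split_ifs
    · simp; linarith
    · exact le_rfl
  have h0 : 0 ≤ peaks V p w 0 0 := by simpa using neg_le_peaks (V := V) (p := p) (w := w) 0 0
  rw [← hG 2 (by norm_num), ← hG 1 (by norm_num), ← hG 0 le_rfl, hval 1 le_rfl,
    hval 2 (by norm_num)] at hmid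
  linarith

/-! ### Complexity of the parabola problem -/

theorem lowerDecision_peakProblem_mem {rel : ℝ → ℝ → Prop} (h : IsOrd rel) :
    (peakProblem V p).lowerDecision rel ∈ ClassP 3 := by
  have p1 := polyTime_proj (m := 3) 1
  have p2 := polyTime_proj (m := 3) 2
  have d1 := polyReal_zero.le (p1.decVec (n := 1) 0).polyReal
  have d2 := PolyReal.rel h polyReal_zero p2.decFrac.polyReal
  refine ((polyDec_isVec p1 1).and ((polyDec_isFrac p2).and (d1.and d2))).congr fun a => ?_
  constructor
  · rintro ⟨w, x, γ, rfl, hx, y, hy, hr⟩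
    refine ⟨⟨x, rfl⟩, ⟨γ, rfl⟩, ?_, ?_⟩
    · change 0 ≤ (decVec 1 (encVec x) 0).val
      rw [decVec_encVec]; exact hx
    · change rel 0 (decFrac (encFrac γ)).val
      rw [decFrac_encFrac]
      exact h.of_le ((sq_nonneg _).trans (mem_lowerFeasible.1 hy)) hr
  · rintro ⟨⟨x, hx⟩, ⟨γ, hγ⟩, h1, h2⟩
    rw [hx, decVec_encVec] at h1
    rw [hγ, decFrac_encFrac] at h2
    refine ⟨a 0, x, γ, ?_, h1, ![0, 0], mem_lowerFeasible.2 (by simp), by simpa using h2⟩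
    ext1 i
    fin_cases i
    exacts [rfl, hx, hγ]

/-- Elimination of `u`: if its coefficient is negative, the linear constraint can always be
satisfied; otherwise the least possible value `u = s` is the best one. -/
theorem exists_epigraph_iff {rel : ℝ → ℝ → Prop} {α₀ α₁ β c e₁ e₂ g : ℝ} :
    (∃ y : Fin 2 → ℝ, y 0 ^ 2 ≤ y 1 ∧ ∃ u, y 1 ≤ u ∧ α₀ * y 0 + α₁ * y 1 + β * u ≤ c ∧
      rel (e₁ * y 0 + e₂ * y 1) g) ↔
    if β < 0 then ParabolaFeasible rel 0 0 0 e₁ e₂ g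
    else ParabolaFeasible rel α₀ (α₁ + β) c e₁ e₂ g := by
  split_ifs with hβ
  · constructor
    · rintro ⟨y, hy, -, -, -, hr⟩
      exact ⟨y 0, y 1, hy, by simp, hr⟩
    · rintro ⟨t, s, hs, -, hr⟩
      refine ⟨![t, s], hs, max s ((α₀ * t + α₁ * s - c) / (-β)), le_max_left _ _, ?_, hr⟩
      have h1 := le_max_right s ((α₀ * t + α₁ * s - c) / (-β))
      rw [div_le_iff₀ (by linarith)] at h1
      simp only [Matrix.cons_val_one, Matrix.cons_val_zero]
      linarith
  · rw [not_lt] at hβ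
    constructor
    · rintro ⟨y, hy, u, hu, hc, hr⟩
      exact ⟨y 0, y 1, hy, by nlinarith [mul_le_mul_of_nonneg_left hu hβ], hr⟩
    · rintro ⟨t, s, hs, hc, hr⟩
      refine ⟨![t, s], hs, s, le_rfl, ?_, hr⟩
      simp only [Matrix.cons_val_one, Matrix.cons_val_zero]
      linarith

theorem lowerStarDecision_peakProblem_mem {rel : ℝ → ℝ → Prop} (h : IsOrd rel) :
    (peakProblem V p).lowerStarDecision (affineClass V p) rel ∈ ClassP 7 := by
  have p1 := polyTime_proj (m := 7) 1
  have p2 := polyTime_proj (m := 7) 2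
  have p3 := polyTime_proj (m := 7) 3
  have p4 := polyTime_proj (m := 7) 4
  have p5 := polyTime_proj (m := 7) 5
  have p6 := polyTime_proj (m := 7) 6
  have d1 := polyReal_zero.le (p1.decVec (n := 1) 0).polyReal
  have a0 := (p2.decVec (n := 2) 0).polyReal
  have a1 := (p2.decVec (n := 2) 1).polyReal
  have hβ := p3.decFrac.polyReal
  have e0 := (p5.decVec (n := 3) 0).polyReal
  have e1 := (p5.decVec (n := 3) 1).polyReal
  have e2 := (p5.decVec (n := 3) 2).polyReal
  have hg := p6.decFrac.polyReal.sub e0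
  have z : PolyReal fun _ : Input 7 => (0 : ℝ) := polyReal_zero
  have d2 := (hβ.lt z).ite (polyDec_parabolaFeasible h z z z e1 e2 hg)
    (polyDec_parabolaFeasible h a0 (a1.add hβ) p4.decFrac.polyReal e1 e2 hg)
  have hrel : ∀ e₀ r g, rel (e₀ + r) g ↔ rel r (g - e₀) := fun e₀ r g =>
    h.congr one_pos (by ring)
  refine ((polyDec_isVec p1 1).and ((polyDec_isVec p2 2).and ((polyDec_isFrac p3).and
    ((polyDec_isFrac p4).and ((polyDec_isFrac p6).and (d1.and d2)))))).congr fun a => ?_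
  constructor
  · rintro ⟨w, x, α, β, c, hc, γ, rfl, hx, y, hy, u, hu, huc, hr⟩
    refine ⟨⟨x, rfl⟩, ⟨α, rfl⟩, ⟨β, rfl⟩, ⟨c, rfl⟩, ⟨γ, rfl⟩, ?_, ?_⟩
    · change 0 ≤ (decVec 1 (encVec x) 0).val
      rw [decVec_encVec]; exact hx
    · simp only [Matrix.cons_val, decVec_encVec, decFrac_encFrac]
      rw [← exists_epigraph_iff]
      refine ⟨y, mem_lowerFeasible.1 hy, u, hu, ?_, ?_⟩
      · rw [Fin.sum_univ_two] at huc; exact huc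
      · rw [← hrel, ← add_assoc]; exact hr
  · rintro ⟨⟨x, hx⟩, ⟨α, hα⟩, ⟨β, hβ⟩, ⟨c, hc⟩, ⟨γ, hγ⟩, h1, h2⟩
    rw [hx, decVec_encVec] at h1
    simp only [hα, hβ, hc, hγ, decVec_encVec, decFrac_encFrac] at h2
    rw [← exists_epigraph_iff] at h2
    obtain ⟨y, hy, u, hu, huc, hr⟩ := h2
    refine ⟨a 0, x, α, β, c, a 5, γ, ?_, h1, y, mem_lowerFeasible.2 hy, u, hu, ?_, ?_⟩
    · ext1 i
      fin_cases i
      exacts [rfl, hx, hα, hβ, hc, rfl, hγ]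
    · rw [Fin.sum_univ_two]; exact huc
    · rw [← hrel, ← add_assoc] at hr; exact hr

theorem lowerInPStar_peakProblem : (peakProblem V p).LowerInPStar (affineClass V p) :=
  ⟨⟨lowerDecision_peakProblem_mem (Or.inl rfl), lowerDecision_peakProblem_mem (Or.inr rfl)⟩,
    lowerStarDecision_peakProblem_mem (Or.inl rfl), lowerStarDecision_peakProblem_mem (Or.inr rfl)⟩

/-- A value `γ > 0` is attained in the adversarial problem iff `γ ≤ 1` and there is a certificate
for `w`; so these certificates serve for the adversarial problem, too. -/
theorem adversarialDecision_peakProblem_mem (hV : V ∈ ClassP 2) :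
    (peakProblem V p).adversarialDecision (· ≤ ·) ∈ ClassNP 5 := by
  have p0 := polyTime_proj (m := 6) 0
  have p1 := polyTime_proj (m := 6) 1
  have p2 := polyTime_proj (m := 6) 2
  have p3 := polyTime_proj (m := 6) 3
  have p4 := polyTime_proj (m := 6) 4
  have p5 := polyTime_proj (m := 6) 5
  have d1 := polyReal_zero.le (p1.decVec (n := 1) 0).polyReal
  have d2 := (p2.decVec (n := 2) 0).polyReal.sq.le (p2.decVec (n := 2) 1).polyReal
  have hγ := p4.decFrac.polyReal
  have d3 := (hγ.le polyReal_zero).or ((hγ.le polyReal_one).and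
    ((polyDec_length_le p5 (p0.unary_eval p)).and (polyDec_mem hV (polyVec_two p0 p5))))
  have d := (polyDec_isVec p1 1).and ((polyDec_isVec p2 2).and ((polyDec_eq_nil p3).and
    ((polyDec_isFrac p4).and (d1.and (d2.and d3)))))
  refine ⟨_, d, p, fun a => ?_⟩
  have hsnoc : ∀ c : Word, (Fin.snoc (α := fun _ => Word) a c ∈ {b : Input 6 |
      (∃ x : Fin 1 → Frac, b 1 = encVec x) ∧ (∃ x : Fin 2 → Frac, b 2 = encVec x) ∧ b 3 = [] ∧
      (∃ r, b 4 = encFrac r) ∧ 0 ≤ (decVec 1 (b 1) 0).val ∧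
      (decVec 2 (b 2) 0).val ^ 2 ≤ (decVec 2 (b 2) 1).val ∧ ((decFrac (b 4)).val ≤ 0 ∨
      (decFrac (b 4)).val ≤ 1 ∧ (b 5).length ≤ (unary (p.eval (b 0).length)).length ∧
        ![b 0, b 5] ∈ V)}) ↔
      (∃ x : Fin 1 → Frac, a 1 = encVec x) ∧ (∃ x : Fin 2 → Frac, a 2 = encVec x) ∧ a 3 = [] ∧
      (∃ r, a 4 = encFrac r) ∧ 0 ≤ (decVec 1 (a 1) 0).val ∧
      (decVec 2 (a 2) 0).val ^ 2 ≤ (decVec 2 (a 2) 1).val ∧ ((decFrac (a 4)).val ≤ 0 ∨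
      (decFrac (a 4)).val ≤ 1 ∧ c.length ≤ (unary (p.eval (a 0).length)).length ∧
        ![a 0, c] ∈ V) := fun c => Iff.rfl
  simp only [hsnoc]
  constructor
  · rintro ⟨w, x, v, k, γ, rfl, hx, hv, hz⟩
    have hv' := mem_lowerFeasible.1 hv
    have hk : unary k = [] := by
      have : (k : ℕ) = 0 := by have := k.2; change (k : ℕ) < 1 at this; omega
      rw [this]; rfl
    rcases (exists_nearOptimal_le_iff hv').1 hz with h | ⟨h, hn⟩
    · refine ⟨[], by simp, ⟨x, rfl⟩, ⟨v, rfl⟩, hk, ⟨γ, rfl⟩, ?_, ?_, Or.inl ?_⟩ <;>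
        simp only [Matrix.cons_val, decVec_encVec, decFrac_encFrac]
      exacts [hx, hv', h]
    · obtain ⟨c, hc, hcV⟩ := exists_accepts_iff.1 hn
      have hw := length_le_size ![w, encVec x, encVec v, unary k, encFrac γ] 0
      refine ⟨c, hc.trans (eval_mono p hw), ⟨x, rfl⟩, ⟨v, rfl⟩, hk, ⟨γ, rfl⟩, ?_, ?_,
        Or.inr ⟨?_, by simpa [unary] using hc, hcV⟩⟩ <;>
        simp only [Matrix.cons_val, decVec_encVec, decFrac_encFrac]
      exacts [hx, hv', h]
  · rintro ⟨c, -, ⟨x, hx⟩, ⟨v, hv⟩, hk, ⟨γ, hγ⟩, h1, h2, h3⟩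
    rw [hx, decVec_encVec] at h1
    rw [hv, decVec_encVec] at h2
    rw [hγ, decFrac_encFrac] at h3
    refine ⟨a 0, x, v, 0, γ, ?_, h1, mem_lowerFeasible.2 h2, (exists_nearOptimal_le_iff h2).2 ?_⟩
    · ext1 i
      fin_cases i
      exacts [rfl, hx, hv, hk, hγ]
    · refine h3.imp_right fun h => ⟨h.1, exists_accepts_iff.2 ⟨c, ?_, h.2.2⟩⟩
      simpa [unary] using h.2.1

/-- The instances `w` without certificate are those for which the near-optimal robust problem has a
solution of value at most `0`. -/
theorem compl_mem_classNP {L : Set (Input 1)}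
    (hL : ∀ a : Input 1, a ∈ L ↔ ∃ c : Word, c.length ≤ p.eval (size a) ∧
      Fin.snoc (α := fun _ => Word) a c ∈ V)
    (h : (peakProblem V p).norDecision ∈ ClassNP 2) : Lᶜ ∈ ClassNP 1 := by
  obtain ⟨W, hW, q, hq⟩ := h
  have d := polyDec_mem hW (ψ := fun b : Input 2 => ![b 0, encFrac (0, 1), b 1])
    (polyVec_three (polyTime_proj 0) (polyTime_const _) (polyTime_proj 1))
  refine ⟨_, d, q.comp (Polynomial.X + Polynomial.C (encFrac (0, 1)).length), fun a => ?_⟩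
  have ha : size a = (a 0).length := by simp [size]
  have h0 : Frac.val (0, 1) = 0 := by simp [Frac.val]
  have hsnoc : ∀ c : Word, Fin.snoc (α := fun _ => Word) a c = ![a 0, c] := fun c => by
    ext1 i; fin_cases i <;> rfl
  have hsnoc' : ∀ c : Word, Fin.snoc (α := fun _ => Word) ![a 0, encFrac (0, 1)] c
      = ![a 0, encFrac (0, 1), c] := fun c => by
    ext1 i; fin_cases i <;> rfl
  have h1 := hq ![a 0, encFrac (0, 1)]
  rw [size_vec_two, ← ha] at h1
  simp only [hsnoc'] at h1
  have h2 : a ∈ Lᶜ ↔ ![a 0, encFrac (0, 1)] ∈ (peakProblem V p).norDecision := by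
    rw [Set.mem_compl_iff, hL]
    simp only [hsnoc, ha]
    rw [← exists_accepts_iff]
    constructor
    · intro hn
      refine ⟨a 0, (0, 1), rfl, fun _ => 0, fun _ => 0,
        norFeasible_peakProblem_iff.2 ⟨le_rfl, rfl, rfl, hn⟩, ?_⟩
      rw [h0]
    · rintro ⟨w, Γ, h3, x, v, h4, -⟩
      simp only [Matrix.vecCons_inj, and_true] at h3
      rw [h3.1]
      exact (norFeasible_peakProblem_iff.1 h4).2.2.2
  rw [h2, h1]
  simp only [Polynomial.eval_comp, Polynomial.eval_add, Polynomial.eval_X, Polynomial.eval_C]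
  refine exists_congr fun c => and_congr_right fun _ => ?_
  rw [hsnoc]
  rfl

theorem exists_mem_classNP_compl_not_mem (h : ClassNP 1 ≠ ClassCoNP 1) :
    ∃ L ∈ ClassNP 1, Lᶜ ∉ ClassNP 1 := by
  by_contra! hcon
  refine h (Set.ext fun L => ⟨fun hL => hcon L hL, fun hL => ?_⟩)
  have := hcon Lᶜ hL
  rwa [compl_compl] at this

end NearOptBilevel

end

open NearOptBilevel
theorem theorem2 :
    -- the near-optimal robust version is in NP
    (∀ (B : BilevelProblem) (H : B.FunctionClass),
      B.PolyPresented → B.LowerConvex → B.ConvexClass H → B.LowerInPStar H → B.NegUpperIn H →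
        BilevelProblem.PolySolvable B.adversarialDecision ∧
        B.norVerification ∈ ClassP 4 ∧
        (B.HasPolySizeSolutions → B.norDecision ∈ ClassNP 2)) ∧
    -- for convex non-affine upper-level constraints it is in general not in NP
    (ClassNP 1 ≠ ClassCoNP 1 →
      ∃ (B : BilevelProblem) (H : B.FunctionClass),
        B.PolyPresented ∧ B.HasPolySizeSolutions ∧
        B.LowerConvex ∧ B.ConvexClass H ∧ B.LowerInPStar H ∧
        B.UpperConvexNonaffine ∧
        B.adversarialDecision (· ≤ ·) ∈ ClassNP 5 ∧
        B.norDecision ∉ ClassNP 2) := by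
  refine ⟨fun B H hB _ _ hH hG => ?_, fun hne => ?_⟩
  · have hle := BilevelProblem.adversarialDecision_mem_classP hB hG (rel := (· ≤ ·))
      (fun r s => neg_le_neg_iff) hH.2.1
    have hlt := BilevelProblem.adversarialDecision_mem_classP hB hG (rel := (· < ·))
      (fun r s => neg_lt_neg_iff) hH.2.2
    have hver := BilevelProblem.norVerification_mem_classP hB hH.1.2 hlt
    exact ⟨⟨hle, hlt⟩, hver, BilevelProblem.norDecision_mem_classNP hver⟩
  · obtain ⟨L, ⟨V, hV, p, hL⟩, hcompl⟩ := exists_mem_classNP_compl_not_mem hne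
    exact ⟨peakProblem V p, affineClass V p, polyPresented_peakProblem hV,
      hasPolySizeSolutions_peakProblem, lowerConvex_peakProblem, convexClass_affineClass,
      lowerInPStar_peakProblem, upperConvexNonaffine_peakProblem,
      adversarialDecision_peakProblem_mem hV, fun h => hcompl (compl_mem_classNP hL h)⟩
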